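/- Work over $\mathbb{C}$, and let $\mathfrak g=\mathfrak n^-\oplus\mathfrak h\oplus\mathfrak n^+$ be one of the following Lie superalgebras with its standard triangular decomposition: (a) a $Q$-type Lie superalgebra. Here $\mathfrak q(n)$ is the space of block matrices $X_{A,B}=\begin{pmatrix}A&B\\B&A\end{pmatrix}$ with $A,B\in\mathrm{Mat}_n(\mathbb C)$, where the $X_{A,0}$ are even, the $X_{0,B}$ are odd, and the bracket is the supercommutator; $\mathfrak{sq}(n)=\{X_{A,B}\mid \operatorname{tr}B=0\}$; $\mathfrak{pq}(n)=\mathfrak q(n)/(\mathrm{Id})$; $\mathfrak{psq}(n)=\mathfrak{sq}(n)/(\mathrm{Id})$. We take $\mathfrak q(n)$ and $\mathfrak{sq}(n)$ for $n\ge2$, $\mathfrak{pq}(n)$ and $\mathfrak{psq}(n)$ for $n\ge3$. The subalgebra $\mathfrak h$ comes from diagonal $A,B$, and $\mathfrak n^+$ (resp. $\mathfrak n^-$) from strictly upper (resp. lower) triangular $A,B$; (b) a finite-dimensional contragredient (Kac–Moody) Lie superalgebra $\mathfrak g(A,\tau)$ with symmetrizable Cartan matrix $A$ of size at least $1$: the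 quotient of the Lie superalgebra with generators $e_i,f_i$ (of parity $\tau_i$) and $h\in\mathfrak h$ (even), where $(\mathfrak h,\alpha_i,\alpha_i^\vee)$ is a realization of $A$, and relations $[h,h']=0$, $[h,e_i]=\alpha_i(h)e_i$, $[h,f_i]=-\alpha_i(h)f_i$, $[e_i,f_j]=\delta_{ij}\alpha_i^\vee$, by its maximal graded ideal intersecting $\mathfrak h$ trivially. Here $\mathfrak n^+$ (resp. $\mathfrak n^-$) is generated by the $e_i$ (resp. the $f_i$). Let $Q(\pi)$ be the root lattice and $Q^+$ the set of non-negative integral combinations of the simple roots, ordered by $\nu\ge\mu\iff\nu-\mu\in Q^+$. Let $\mathcal U(\mathfrak n^+)_\mu$ be the weight spaces of $\mathcal U(\mathfrak n^+)$ for the adjoint action of $\mathfrak h_{\bar0}$, and put $\mathcal U(\mathfrak n^+)_{\ge\nu}=\sum_{\mu\ge\nu}\mathcal U(\mathfrak n^+)_\mu$. The left ideals $J(\nu)=\mathcal U(\mathfrak g)\,\mathcal U(\mathfrak n^+)_{\ge\nu}$, $\nu\in Q(\pi)$, form a basis of neighbourhoods of zero of a ring topology on $\mathcal U(\mathfrak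 g)$; let $\hat U$ be the completion of $\mathcal U(\mathfrak g)$ for this topology, with its unique structure of topological algebra extending that of $\mathcal U(\mathfrak g)$. For a superalgebra $B=B_{\bar0}\oplus B_{\bar1}$ let $\mathcal Z(B)=\mathcal Z(B)_{\bar0}\oplus\mathcal Z(B)_{\bar1}$ be its centre in the sense of superalgebras, where $\mathcal Z(B)_i=\{z\in B_i\mid zu=(-1)^{ij}uz \text{ for all } u\in B_j,\ j=0,1\}$, and put $\mathcal Z(\mathfrak g)=\mathcal Z(\mathcal U(\mathfrak g))$. The grading of $\hat U$ is the one extending that of $\mathcal U(\mathfrak g)$. Then the canonical map $\mathcal U(\mathfrak g)\to\hat U$ is injective and, identifying $\mathcal U(\mathfrak g)$ with its image, $\mathcal Z(\hat U)=\mathcal Z(\mathfrak g)$. -/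

import Mathlib

noncomputable section

namespace SuperLie

/-! ### Superalgebras and Lie superalgebras over `ℂ` -/

/-- The Koszul sign `(-1)^{ij}` for parities `i, j ∈ ℤ/2`. -/
def sgn (i j : ZMod 2) : ℂ := if i = 1 ∧ j = 1 then -1 else 1

/-- A (not necessarily associative) superalgebra structure on a complex vector space `V`:
a bilinear product and a `ℤ/2`-grading `V = V₀ ⊕ V₁` with `V_i V_j ⊆ V_{i+j}`. -/
structure Superalgebra (V : Type*) [AddCommGroup V] [Module ℂ V] where
  mul : V →ₗ[ℂ] V →ₗ[ℂ] V
  part : ZMod 2 → Submodule ℂ V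
  isCompl : IsCompl (part 0) (part 1)
  mul_mem : ∀ {i j : ZMod 2} {x y : V}, x ∈ part i → y ∈ part j → mul x y ∈ part (i + j)

/-- A Lie superalgebra structure on `V`: the product `mul x y = [x, y]` is super-skew-symmetric
and satisfies the super Jacobi identity. -/
structure LieSuperalgebra (V : Type*) [AddCommGroup V] [Module ℂ V] extends Superalgebra V where
  skew : ∀ {i j : ZMod 2} {x y : V}, x ∈ part i → y ∈ part j →
    mul x y = -(sgn i j • mul y x)
  jacobi : ∀ {i j : ZMod 2} {x y : V}, x ∈ part i → y ∈ part j → ∀ z : V,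
    mul x (mul y z) = mul (mul x y) z + sgn i j • mul y (mul x z)

section Basic

variable {V : Type*} [AddCommGroup V] [Module ℂ V]

/-- Graded two-sided ideals. -/
structure Superalgebra.IsGradedIdeal (S : Superalgebra V) (N : Submodule ℂ V) : Prop where
  mul_left : ∀ (x : V) {y : V}, y ∈ N → S.mul x y ∈ N
  mul_right : ∀ {x : V} (y : V), x ∈ N → S.mul x y ∈ N
  graded : ∀ {x y : V}, x ∈ S.part 0 → y ∈ S.part 1 → x + y ∈ N → x ∈ N

/-- The product induced on the quotient by a graded ideal. -/
def Superalgebra.quotMul (S : Superalgebra V) (N : Submodule ℂ V) (hN : S.IsGradedIdeal N) :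
    (V ⧸ N) →ₗ[ℂ] (V ⧸ N) →ₗ[ℂ] (V ⧸ N) :=
  N.liftQ
    { toFun := fun x => N.mapQ N (S.mul x) (fun _ hy => hN.mul_left x hy)
      map_add' := by
        intro x y
        ext z
        simp
      map_smul' := by
        intro c x
        ext z
        simp }
    (by
      intro x hx
      rw [LinearMap.mem_ker]
      ext z
      simpa using hN.mul_right z hx)

@[simp]
theorem Superalgebra.quotMul_mk (S : Superalgebra V) (N : Submodule ℂ V)
    (hN : S.IsGradedIdeal N) (x y : V) :
    S.quotMul N hN (N.mkQ x) (N.mkQ y) = N.mkQ (S.mul x y) := rfl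

/-- The quotient of a superalgebra by a graded ideal. -/
def Superalgebra.quot (S : Superalgebra V) (N : Submodule ℂ V) (hN : S.IsGradedIdeal N) :
    Superalgebra (V ⧸ N) where
  mul := S.quotMul N hN
  part := fun i => (S.part i).map N.mkQ
  isCompl := by
    constructor
    · rw [Submodule.disjoint_def]
      rintro _ ⟨x, hx, rfl⟩ ⟨y, hy, hxy⟩
      have h : x + -y ∈ N := by
        rw [← sub_eq_add_neg]
        exact (Submodule.Quotient.eq N).1 hxy.symm
      have := hN.graded hx (neg_mem hy) h
      simpa using this
    · rw [codisjoint_iff, ← Submodule.map_sup, S.isCompl.sup_eq_top, Submodule.map_top,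
        Submodule.range_mkQ]
  mul_mem := by
    rintro i j _ _ ⟨x, hx, rfl⟩ ⟨y, hy, rfl⟩
    exact ⟨_, S.mul_mem hx hy, rfl⟩

/-- The quotient of a superalgebra by a graded ideal modulo which the identities of Lie
superalgebras hold. -/
def Superalgebra.quotLie (S : Superalgebra V) (N : Submodule ℂ V) (hN : S.IsGradedIdeal N)
    (hskew : ∀ {i j : ZMod 2} {x y : V}, x ∈ S.part i → y ∈ S.part j →
      S.mul x y + sgn i j • S.mul y x ∈ N)
    (hjac : ∀ {i j : ZMod 2} {x y : V}, x ∈ S.part i → y ∈ S.part j → ∀ z : V,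
      S.mul x (S.mul y z) - (S.mul (S.mul x y) z + sgn i j • S.mul y (S.mul x z)) ∈ N) :
    LieSuperalgebra (V ⧸ N) where
  toSuperalgebra := S.quot N hN
  skew := by
    rintro i j _ _ ⟨x, hx, rfl⟩ ⟨y, hy, rfl⟩
    have h := hskew hx hy
    rw [← Submodule.Quotient.mk_eq_zero, ← Submodule.mkQ_apply, map_add, map_smul] at h
    exact eq_neg_of_add_eq_zero_left h
  jacobi := by
    rintro i j _ _ ⟨x, hx, rfl⟩ ⟨y, hy, rfl⟩ z
    obtain ⟨z, rfl⟩ := N.mkQ_surjective z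
    have h := hjac hx hy z
    rw [← Submodule.Quotient.mk_eq_zero, ← Submodule.mkQ_apply, map_sub, map_add, map_smul] at h
    exact sub_eq_zero.1 h

/-- The quotient of a Lie superalgebra by a graded ideal. -/
def LieSuperalgebra.quotient (L : LieSuperalgebra V) (N : Submodule ℂ V)
    (hN : L.IsGradedIdeal N) : LieSuperalgebra (V ⧸ N) :=
  L.quotLie N hN
    (fun hx hy => by rw [L.skew hx hy, neg_add_cancel]; exact N.zero_mem)
    (fun hx hy z => by rw [L.jacobi hx hy z, sub_self]; exact N.zero_mem)

/-- The Lie superalgebra structure on a graded subspace closed under the bracket. -/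
def LieSuperalgebra.sub (L : LieSuperalgebra V) (N : Submodule ℂ V)
    (hmul : ∀ {x y : V}, x ∈ N → y ∈ N → L.mul x y ∈ N)
    (hgr : ∀ {x y : V}, x ∈ L.part 0 → y ∈ L.part 1 → x + y ∈ N → x ∈ N) :
    LieSuperalgebra N where
  mul := LinearMap.mk₂ ℂ (fun x y : N => (⟨L.mul x y, hmul x.2 y.2⟩ : N))
    (by intros; ext; simp) (by intros; ext; simp) (by intros; ext; simp) (by intros; ext; simp)
  part := fun i => (L.part i).comap N.subtype
  isCompl := by
    constructor
    · rw [Submodule.disjoint_def]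
      intro x hx hy
      have := (Submodule.disjoint_def.1 L.isCompl.disjoint) (x : V) hx hy
      exact Subtype.ext this
    · rw [codisjoint_iff, eq_top_iff]
      intro x _
      have hx : (x : V) ∈ L.part 0 ⊔ L.part 1 := by
        rw [L.isCompl.sup_eq_top]; trivial
      obtain ⟨a, ha, b, hb, hab⟩ := Submodule.mem_sup.1 hx
      have haN : a ∈ N := hgr ha hb (by rw [hab]; exact x.2)
      have hbN : b ∈ N := by
        have : b = x - a := by rw [← hab]; abel
        rw [this]; exact N.sub_mem x.2 haN
      exact Submodule.mem_sup.2 ⟨⟨a, haN⟩, ha, ⟨b, hbN⟩, hb, Subtype.ext hab⟩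
  mul_mem := fun hx hy => L.mul_mem hx hy
  skew := fun hx hy => Subtype.ext (L.skew hx hy)
  jacobi := fun hx hy z => Subtype.ext (L.jacobi hx hy z)

/-- The smallest subspace that contains `s` and is closed under the product. -/
def Superalgebra.generated (S : Superalgebra V) (s : Set V) : Submodule ℂ V :=
  sInf {N | s ⊆ N ∧ ∀ x ∈ N, ∀ y ∈ N, S.mul x y ∈ N}

theorem Superalgebra.subset_generated (S : Superalgebra V) (s : Set V) :
    s ⊆ S.generated s := by
  intro x hx
  simp only [Superalgebra.generated, SetLike.mem_coe, Submodule.mem_sInf]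
  exact fun N hN => hN.1 hx

theorem Superalgebra.mul_mem_generated (S : Superalgebra V) (s : Set V) {x y : V}
    (hx : x ∈ S.generated s) (hy : y ∈ S.generated s) : S.mul x y ∈ S.generated s := by
  simp only [Superalgebra.generated, Submodule.mem_sInf] at *
  exact fun N hN => hN.2 x (hx N hN) y (hy N hN)

theorem Superalgebra.generated_le_span (S : Superalgebra V) {s E : Set V} (hs : s ⊆ E)
    (hE : ∀ x ∈ E, ∀ y ∈ E, S.mul x y ∈ E) : S.generated s ≤ Submodule.span ℂ E := by
  refine sInf_le ⟨hs.trans Submodule.subset_span, fun x hx y hy => ?_⟩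
  have h := Submodule.apply_mem_map₂ S.mul hx hy
  rw [Submodule.map₂_span_span] at h
  refine Submodule.span_mono ?_ h
  rintro _ ⟨a, ha, b, hb, rfl⟩
  exact hE a ha b hb

theorem Superalgebra.isGradedIdeal_sInf (S : Superalgebra V) (C : Set (Submodule ℂ V))
    (hC : ∀ N ∈ C, S.IsGradedIdeal N) : S.IsGradedIdeal (sInf C) where
  mul_left := fun x y hy => by
    rw [Submodule.mem_sInf] at *
    exact fun N hN => (hC N hN).mul_left x (hy N hN)
  mul_right := fun y hx => by
    rw [Submodule.mem_sInf] at *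
    exact fun N hN => (hC N hN).mul_right y (hx N hN)
  graded := fun hx hy h => by
    rw [Submodule.mem_sInf] at *
    exact fun N hN => (hC N hN).graded hx hy (h N hN)

theorem Superalgebra.isGradedIdeal_sSup (S : Superalgebra V) (C : Set (Submodule ℂ V))
    (hC : ∀ N ∈ C, S.IsGradedIdeal N) : S.IsGradedIdeal (sSup C) where
  mul_left := fun x y hy => by
    have : sSup C ≤ (sSup C).comap (S.mul x) :=
      sSup_le fun N hN z hz => (le_sSup hN : N ≤ sSup C) ((hC N hN).mul_left x hz)
    exact this hy
  mul_right := fun {x} y hx => by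
    have : sSup C ≤ (sSup C).comap (S.mul.flip y) :=
      sSup_le fun N hN z hz => (le_sSup hN : N ≤ sSup C) ((hC N hN).mul_right y hz)
    exact this hx
  graded := fun {x y} hx hy h => by
    have hle : sSup C ≤ (sSup C ⊓ S.part 0) ⊔ (sSup C ⊓ S.part 1) := by
      refine sSup_le fun N hN z hz => ?_
      have hzz : z ∈ S.part 0 ⊔ S.part 1 := by
        rw [S.isCompl.sup_eq_top]; trivial
      obtain ⟨a, ha, b, hb, rfl⟩ := Submodule.mem_sup.1 hzz
      have haN := (hC N hN).graded ha hb hz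
      have hbN : b ∈ N := by simpa using N.sub_mem hz haN
      exact Submodule.mem_sup.2 ⟨a, ⟨(le_sSup hN : N ≤ sSup C) haN, ha⟩, b,
        ⟨(le_sSup hN : N ≤ sSup C) hbN, hb⟩, rfl⟩
    obtain ⟨a, ha, b, hb, hab⟩ := Submodule.mem_sup.1 (hle h)
    have h0 : x - a = b - y := by
      rw [sub_eq_sub_iff_add_eq_add, ← hab]; abel
    have h1 : x - a = 0 := (Submodule.disjoint_def.1 S.isCompl.disjoint) _
      (Submodule.sub_mem _ hx ha.2) (by rw [h0]; exact Submodule.sub_mem _ hb.2 hy)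
    rw [sub_eq_zero.1 h1]
    exact ha.1

end Basic

/-! ### The universal enveloping algebra -/

section Enveloping

variable {V : Type*} [AddCommGroup V] [Module ℂ V] (L : LieSuperalgebra V)

/-- The defining relations `xy = [x, y] + (-1)^{p(x)p(y)} yx` of the enveloping algebra. -/
inductive EnvRel : TensorAlgebra ℂ V → TensorAlgebra ℂ V → Prop
  | bracket {i j : ZMod 2} {x y : V} (hx : x ∈ L.part i) (hy : y ∈ L.part j) :
      EnvRel (TensorAlgebra.ι ℂ x * TensorAlgebra.ι ℂ y)
        (TensorAlgebra.ι ℂ (L.mul x y) +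
          sgn i j • (TensorAlgebra.ι ℂ y * TensorAlgebra.ι ℂ x))

/-- The universal enveloping algebra `U(𝔤)` of a Lie superalgebra. -/
def Env : Type _ := RingQuot (EnvRel L)

instance : Ring (Env L) := inferInstanceAs (Ring (RingQuot (EnvRel L)))

instance : Algebra ℂ (Env L) := inferInstanceAs (Algebra ℂ (RingQuot (EnvRel L)))

/-- The canonical map `𝔤 → U(𝔤)`. -/
def Env.ι : V →ₗ[ℂ] Env L :=
  (RingQuot.mkAlgHom ℂ (EnvRel L)).toLinearMap ∘ₗ TensorAlgebra.ι ℂ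

variable {L} in
theorem Env.ι_mul {i j : ZMod 2} {x y : V} (hx : x ∈ L.part i) (hy : y ∈ L.part j) :
    Env.ι L x * Env.ι L y = Env.ι L (L.mul x y) + sgn i j • (Env.ι L y * Env.ι L x) := by
  have h := RingQuot.mkAlgHom_rel ℂ (EnvRel.bracket (L := L) hx hy)
  rw [map_mul, map_add, map_smul, map_mul] at h
  exact h

theorem Env.induction {P : Env L → Prop} (halg : ∀ c : ℂ, P (algebraMap ℂ (Env L) c))
    (hι : ∀ x : V, P (Env.ι L x)) (hmul : ∀ a b, P a → P b → P (a * b))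
    (hadd : ∀ a b, P a → P b → P (a + b)) (u : Env L) : P u := by
  obtain ⟨t, rfl⟩ := RingQuot.mkAlgHom_surjective ℂ (EnvRel L) u
  induction t using TensorAlgebra.induction with
  | algebraMap r =>
    rw [AlgHom.commutes]; exact halg r
  | ι x => exact hι x
  | mul a b ha hb => rw [map_mul]; exact hmul _ _ ha hb
  | add a b ha hb => rw [map_add]; exact hadd _ _ ha hb

/-- Products of homogeneous elements of `𝔤`, with their total parity. -/
inductive Env.IsMonomial : ZMod 2 → Env L → Prop
  | one : Env.IsMonomial 0 1
  | mul {i j : ZMod 2} {x : V} {u : Env L} (hx : x ∈ L.part i) (hu : Env.IsMonomial j u) :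
      Env.IsMonomial (i + j) (Env.ι L x * u)

/-- The `ℤ/2`-grading `U(𝔤) = U(𝔤)₀ ⊕ U(𝔤)₁`: the homogeneous component of parity `i` is
spanned by the products of homogeneous elements of `𝔤` of total parity `i`. -/
def Env.part (i : ZMod 2) : AddSubgroup (Env L) :=
  (Submodule.span ℂ {u | Env.IsMonomial L i u}).toAddSubgroup

end Enveloping

/-- Given a ring `A` with homogeneous components `A₀, A₁`, the homogeneous elements
`z ∈ A_i` with `z u = (-1)^{ij} u z` for all `u ∈ A_j`, `j = 0, 1`. -/
def superCentrePart {A : Type*} [Ring A] (part : ZMod 2 → AddSubgroup A) (i : ZMod 2) :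
    AddSubgroup A where
  carrier := {z | z ∈ part i ∧ ∀ j, ∀ u ∈ part j,
    z * u = if i = 1 ∧ j = 1 then -(u * z) else u * z}
  zero_mem' := ⟨zero_mem _, fun j u _ => by simp⟩
  add_mem' := by
    rintro a b ⟨ha, ha'⟩ ⟨hb, hb'⟩
    refine ⟨add_mem ha hb, fun j u hu => ?_⟩
    rw [add_mul, mul_add, ha' j u hu, hb' j u hu]
    split_ifs
    · abel
    · rfl
  neg_mem' := by
    rintro a ⟨ha, ha'⟩
    refine ⟨neg_mem ha, fun j u hu => ?_⟩
    rw [neg_mul, mul_neg, ha' j u hu]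
    split_ifs <;> rfl

/-- The centre (in the sense of superalgebras) `Z(A) = Z(A)₀ ⊕ Z(A)₁` of a superalgebra
`A = A₀ ⊕ A₁`. -/
def superCentre {A : Type*} [Ring A] (part : ZMod 2 → AddSubgroup A) : AddSubgroup A :=
  superCentrePart part 0 ⊔ superCentrePart part 1

/-- The centre `Z(𝔤)` of `U(𝔤)`. -/
def Env.centre {V : Type*} [AddCommGroup V] [Module ℂ V] (L : LieSuperalgebra V) :
    AddSubgroup (Env L) :=
  superCentre (Env.part L)

/-! ### Weights and the completion of the enveloping algebra -/

section Weights

variable {I H : Type*} [Fintype I] [AddCommGroup H] [Module ℂ H]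

/-- The element `∑ γ_i α_i` of the root lattice `Q(π)`; here `γ ∈ ℤ^I` stands for the coordinates
with respect to the simple roots `α_i`, so that the partial order on `Q(π)` (`ν ≥ μ` iff
`ν - μ ∈ Q⁺`) is the coordinatewise one. -/
def wt (root : I → Module.Dual ℂ H) (γ : I → ℤ) : Module.Dual ℂ H :=
  ∑ i, (γ i : ℂ) • root i

theorem wt_add (root : I → Module.Dual ℂ H) (γ δ : I → ℤ) :
    wt root (γ + δ) = wt root γ + wt root δ := by
  simp [wt, add_smul, Finset.sum_add_distrib]

theorem wt_zero (root : I → Module.Dual ℂ H) : wt root 0 = 0 := by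
  simp [wt]

theorem wt_injective {root : I → Module.Dual ℂ H} (h : LinearIndependent ℂ root) :
    Function.Injective (wt root) := by
  intro γ δ hγδ
  have h1 : ∑ i, ((γ i : ℂ) - (δ i : ℂ)) • root i = 0 := by
    simp only [sub_smul, Finset.sum_sub_distrib]
    exact sub_eq_zero.2 hγδ
  have h2 := Fintype.linearIndependent_iff.1 h _ h1
  funext i
  have := sub_eq_zero.1 (h2 i)
  exact_mod_cast this

theorem mem_of_mem_iSup_of_weight {M : Type*} [AddCommGroup M] [Module ℂ M]
    {root : I → Module.Dual ℂ H} (hroot : LinearIndependent ℂ root)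
    (T : H → Module.End ℂ M) (hT : ∀ s t, Commute (T s) (T t))
    (S : (I → ℤ) → Submodule ℂ M)
    (hS : ∀ γ, ∀ x ∈ S γ, ∀ t, T t x = wt root γ t • x) {γ : I → ℤ} {x : M}
    (hx : x ∈ ⨆ γ, S γ) (hγ : ∀ t, T t x = wt root γ t • x) : x ∈ S γ := by
  let W : (H → ℂ) → Submodule ℂ M := fun χ => ⨅ t, (T t).maxGenEigenspace (χ t)
  have hW : iSupIndep W := by
    refine Module.End.independent_iInf_maxGenEigenspace_of_forall_mapsTo T ?_
    intro s t φ
    exact Module.End.mapsTo_maxGenEigenspace_of_comm (hT t s) φ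
  let W' : (I → ℤ) → Submodule ℂ M := fun γ => W (fun t => wt root γ t)
  have hW' : iSupIndep W' := by
    refine hW.comp (f := fun (γ : I → ℤ) (t : H) => wt root γ t) ?_
    intro γ δ h
    apply wt_injective hroot
    ext t
    exact congrFun h t
  have hmem : ∀ (γ : I → ℤ) (y : M), (∀ t, T t y = wt root γ t • y) → y ∈ W' γ := by
    intro γ y hy
    simp only [W', W, Submodule.mem_iInf]
    intro t
    refine Module.End.mem_maxGenEigenspace _ _ _ |>.2 ⟨1, ?_⟩
    simp [hy t]
  obtain ⟨f, hf, rfl⟩ := (Submodule.mem_iSup_iff_exists_finsupp S x).1 hx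
  classical
  have hsub : (f.sum fun _ m => m) - f γ ∈ ⨆ (δ) (_ : δ ≠ γ), W' δ := by
    have : (f.sum fun _ m => m) - f γ = ∑ δ ∈ f.support.erase γ, f δ := by
      rw [Finsupp.sum]
      by_cases hγs : γ ∈ f.support
      · rw [← Finset.add_sum_erase _ _ hγs]; abel
      · rw [Finset.erase_eq_of_notMem hγs, Finsupp.notMem_support_iff.1 hγs, sub_zero]
    rw [this]
    refine Submodule.sum_mem _ fun δ hδ => ?_
    have hle : W' δ ≤ ⨆ (δ) (_ : δ ≠ γ), W' δ :=
      le_iSup₂_of_le δ (Finset.ne_of_mem_erase hδ) le_rfl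
    exact hle (hmem δ _ (hS δ _ (hf δ)))
  have h0 : (f.sum fun _ m => m) - f γ ∈ W' γ :=
    Submodule.sub_mem _ (hmem γ _ hγ) (hmem γ _ (hS γ _ (hf γ)))
  have := (Submodule.disjoint_def.1 (hW' γ)) _ h0 hsub
  rw [sub_eq_zero.1 this]
  exact hf γ

end Weights

/-- The part of a triangular decomposition `𝔤 = 𝔫⁻ ⊕ 𝔥 ⊕ 𝔫⁺` that the completion of `U(𝔤)`
depends on: the map `cartan : H → 𝔤` parametrizes `𝔥₀`, the simple roots are linear functionals
on `H`, and `nPos` is `𝔫⁺`. The remaining fields record that `𝔥₀` is an even commutative subalgebra,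
that the simple roots are linearly independent, that `𝔫⁺` is spanned by (homogeneous) weight vectors
with weights in the root lattice, and that `𝔤` is spanned by such vectors that lie in `𝔫⁺` or have
a weight in `-Q⁺`. -/
structure TriangularData (I H : Type*) [Fintype I] [AddCommGroup H] [Module ℂ H]
    {V : Type*} [AddCommGroup V] [Module ℂ V] (L : LieSuperalgebra V) where
  cartan : H →ₗ[ℂ] V
  root : I → Module.Dual ℂ H
  nPos : Submodule ℂ V
  cartan_even : ∀ t, cartan t ∈ L.part 0
  cartan_comm : ∀ s t, L.mul (cartan s) (cartan t) = 0
  root_indep : LinearIndependent ℂ root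
  nPos_le : nPos ≤ Submodule.span ℂ {x | x ∈ nPos ∧ (∃ p, x ∈ L.part p) ∧
    ∃ γ : I → ℤ, ∀ t, L.mul (cartan t) x = wt root γ t • x}
  top_le : ⊤ ≤ Submodule.span ℂ {x | (∃ p, x ∈ L.part p) ∧
    ∃ γ : I → ℤ, (∀ t, L.mul (cartan t) x = wt root γ t • x) ∧ (x ∈ nPos ∨ γ ≤ 0)}

namespace TriangularData

variable {I H : Type*} [Fintype I] [AddCommGroup H] [Module ℂ H]
  {V : Type*} [AddCommGroup V] [Module ℂ V] {L : LieSuperalgebra V}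

section Completion

variable (D : TriangularData I H L)

/-- The weight space `U(𝔫⁺)_μ` with respect to the adjoint action of `𝔥₀`, where `U(𝔫⁺)` is the
subalgebra of `U(𝔤)` generated by `𝔫⁺`. -/
def uPos (μ : I → ℤ) : Submodule ℂ (Env L) where
  carrier := {u | u ∈ Algebra.adjoin ℂ (Env.ι L '' D.nPos) ∧
    ∀ t, Env.ι L (D.cartan t) * u - u * Env.ι L (D.cartan t) = wt D.root μ t • u}
  zero_mem' := ⟨zero_mem _, fun t => by simp⟩
  add_mem' := by
    rintro a b ⟨ha, ha'⟩ ⟨hb, hb'⟩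
    refine ⟨add_mem ha hb, fun t => ?_⟩
    rw [smul_add, ← ha' t, ← hb' t, mul_add, add_mul]
    abel
  smul_mem' := by
    rintro c a ⟨ha, ha'⟩
    refine ⟨Subalgebra.smul_mem _ ha c, fun t => ?_⟩
    rw [mul_smul_comm, smul_mul_assoc, ← smul_sub, ha' t, smul_comm]

/-- The left ideal `J(ν) = U(𝔤) U(𝔫⁺)_{≥ ν}`. -/
def J (ν : I → ℤ) : Ideal (Env L) :=
  Ideal.span {u | ∃ μ, ν ≤ μ ∧ u ∈ D.uPos μ}

theorem J_anti {ν ν' : I → ℤ} (h : ν ≤ ν') : D.J ν' ≤ D.J ν :=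
  Ideal.span_mono fun _ ⟨μ, hμ, hu⟩ => ⟨μ, h.trans hμ, hu⟩

theorem smul_mem_J {ν : I → ℤ} (c : ℂ) {u : Env L} (hu : u ∈ D.J ν) : c • u ∈ D.J ν := by
  rw [Algebra.smul_def]
  exact Ideal.mul_mem_left _ _ hu

theorem J_eq_top {ν : I → ℤ} (h : ν ≤ 0) : D.J ν = ⊤ := by
  rw [Ideal.eq_top_iff_one]
  refine Ideal.subset_span ⟨0, h, one_mem _, fun t => ?_⟩
  simp [wt_zero]

theorem ι_weight {γ : I → ℤ} {x : V} (hx : ∃ p, x ∈ L.part p)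
    (hγ : ∀ t, L.mul (D.cartan t) x = wt D.root γ t • x) (t : H) :
    Env.ι L (D.cartan t) * Env.ι L x - Env.ι L x * Env.ι L (D.cartan t) =
      wt D.root γ t • Env.ι L x := by
  obtain ⟨p, hp⟩ := hx
  rw [Env.ι_mul (D.cartan_even t) hp, hγ t, map_smul]
  simp [sgn]

/-- Products of homogeneous weight vectors of `𝔫⁺`, with their total weight. -/
inductive Word : (I → ℤ) → Env L → Prop
  | one : Word 0 1
  | mul {μ α : I → ℤ} {w : Env L} {x : V} (hw : Word μ w) (hx : x ∈ D.nPos)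
      (hp : ∃ p, x ∈ L.part p) (hα : ∀ t, L.mul (D.cartan t) x = wt D.root α t • x) :
      Word (μ + α) (w * Env.ι L x)

theorem weight_mul {μ α : I → ℤ} {a b : Env L} {t : H}
    (ha : Env.ι L (D.cartan t) * a - a * Env.ι L (D.cartan t) = wt D.root μ t • a)
    (hb : Env.ι L (D.cartan t) * b - b * Env.ι L (D.cartan t) = wt D.root α t • b) :
    Env.ι L (D.cartan t) * (a * b) - (a * b) * Env.ι L (D.cartan t) =
      wt D.root (μ + α) t • (a * b) := by
  rw [wt_add, LinearMap.add_apply, add_smul, ← smul_mul_assoc, ← mul_smul_comm, ← ha, ← hb]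
  noncomm_ring

theorem Word.mem_uPos {D : TriangularData I H L} {μ : I → ℤ} {w : Env L} (h : D.Word μ w) :
    w ∈ D.uPos μ := by
  induction h with
  | one => exact ⟨one_mem _, fun t => by simp [wt_zero]⟩
  | mul hw hx hp hα ih =>
    exact ⟨mul_mem ih.1 (Algebra.subset_adjoin ⟨_, hx, rfl⟩),
      fun t => D.weight_mul (ih.2 t) (D.ι_weight hp hα t)⟩

theorem Word.append {D : TriangularData I H L} {μ ν : I → ℤ} {w w' : Env L} (h : D.Word μ w)
    (h' : D.Word ν w') : D.Word (μ + ν) (w * w') := by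
  induction h' with
  | one => simpa using h
  | mul hw hx hp hα ih =>
    rw [← mul_assoc, ← add_assoc]
    exact Word.mul ih hx hp hα

theorem adjoin_le_words {u : Env L} (hu : u ∈ Algebra.adjoin ℂ (Env.ι L '' D.nPos)) :
    u ∈ ⨆ μ, Submodule.span ℂ {w | D.Word μ w} := by
  rw [← Submodule.span_iUnion]
  induction hu using Algebra.adjoin_induction with
  | mem x hx =>
    obtain ⟨x, hx, rfl⟩ := hx
    have h := Submodule.mem_map_of_mem (f := Env.ι L) (D.nPos_le hx)
    rw [Submodule.map_span] at h
    refine Submodule.span_mono ?_ h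
    rintro _ ⟨y, ⟨hy, hp, γ, hγ⟩, rfl⟩
    refine Set.mem_iUnion.2 ⟨0 + γ, ?_⟩
    have := Word.mul (D := D) Word.one hy hp hγ
    rwa [one_mul] at this
  | algebraMap r =>
    rw [Algebra.algebraMap_eq_smul_one]
    exact Submodule.smul_mem _ _ (Submodule.subset_span (Set.mem_iUnion.2 ⟨0, Word.one⟩))
  | add x y _ _ hx hy => exact Submodule.add_mem _ hx hy
  | mul x y _ _ hx hy =>
    have h := Submodule.mul_mem_mul hx hy
    rw [Submodule.span_mul_span] at h
    refine Submodule.span_mono ?_ h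
    rintro _ ⟨a, ha, b, hb, rfl⟩
    obtain ⟨μ, ha⟩ := Set.mem_iUnion.1 ha
    obtain ⟨ν, hb⟩ := Set.mem_iUnion.1 hb
    exact Set.mem_iUnion.2 ⟨μ + ν, Word.append ha hb⟩

/-- The adjoint action of `𝔥₀` on `U(𝔤)`. -/
def adEnv (t : H) : Module.End ℂ (Env L) :=
  LinearMap.mulLeft ℂ (Env.ι L (D.cartan t)) - LinearMap.mulRight ℂ (Env.ι L (D.cartan t))

theorem adEnv_apply (t : H) (u : Env L) :
    D.adEnv t u = Env.ι L (D.cartan t) * u - u * Env.ι L (D.cartan t) := rfl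

theorem ι_cartan_comm (s t : H) : Env.ι L (D.cartan s) * Env.ι L (D.cartan t) =
    Env.ι L (D.cartan t) * Env.ι L (D.cartan s) := by
  rw [Env.ι_mul (D.cartan_even s) (D.cartan_even t), D.cartan_comm]
  simp [sgn]

theorem uPos_le_words (μ : I → ℤ) : D.uPos μ ≤ Submodule.span ℂ {w | D.Word μ w} := by
  intro u hu
  refine mem_of_mem_iSup_of_weight D.root_indep D.adEnv ?_
    (fun μ => Submodule.span ℂ {w | D.Word μ w}) ?_ (D.adjoin_le_words hu.1) hu.2
  · intro s t
    ext u
    have h := D.ι_cartan_comm s t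
    simp only [Module.End.mul_apply, adEnv_apply]
    generalize Env.ι L (D.cartan s) = a at *
    generalize Env.ι L (D.cartan t) = b at *
    have e1 : a * (b * u) = b * (a * u) := by rw [← mul_assoc, h, mul_assoc]
    have e2 : u * b * a = u * a * b := by rw [mul_assoc, ← h, mul_assoc]
    have e3 : a * (b * u - u * b) - (b * u - u * b) * a =
      a * (b * u) - a * u * b - b * (u * a) + u * b * a := by noncomm_ring
    rw [e3, e1, e2]
    noncomm_ring
  · intro γ x hx t
    have : Submodule.span ℂ {w | D.Word γ w} ≤ D.uPos γ :=
      Submodule.span_le.2 fun w hw => Word.mem_uPos hw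
    exact (this hx).2 t

theorem ι_mem_J {γ : I → ℤ} {x : V} (hγ : ∀ t, L.mul (D.cartan t) x = wt D.root γ t • x) :
    Env.ι L x ∈ D.J γ := by
  let S : (I → ℤ) → Submodule ℂ V := fun γ => Submodule.span ℂ {x | (∃ p, x ∈ L.part p) ∧
    (∀ t, L.mul (D.cartan t) x = wt D.root γ t • x) ∧ (x ∈ D.nPos ∨ γ ≤ 0)}
  have hx : x ∈ S γ := by
    refine mem_of_mem_iSup_of_weight D.root_indep (fun t => L.mul (D.cartan t)) ?_ S ?_ ?_ hγ
    · intro s t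
      ext y
      have h := L.jacobi (D.cartan_even s) (D.cartan_even t) y
      rw [D.cartan_comm] at h
      simpa [sgn] using h
    · intro γ y hy t
      have : S γ ≤ LinearMap.ker (L.mul (D.cartan t) - wt D.root γ t • LinearMap.id) := by
        refine Submodule.span_le.2 fun y hy => ?_
        simp [hy.2.1 t]
      have := this hy
      rw [LinearMap.mem_ker, LinearMap.sub_apply, sub_eq_zero] at this
      exact this
    · have h : x ∈ (⊤ : Submodule ℂ V) := trivial
      have h := D.top_le h
      simp only [S]
      rw [← Submodule.span_iUnion]
      refine Submodule.span_mono ?_ h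
      rintro y ⟨hp, γ, h1, h2⟩
      exact Set.mem_iUnion.2 ⟨γ, hp, h1, h2⟩
  have hle : S γ ≤ ((D.J γ).restrictScalars ℂ).comap (Env.ι L) := by
    refine Submodule.span_le.2 ?_
    rintro y ⟨hp, h1, h2 | h2⟩
    · exact Ideal.subset_span ⟨γ, le_rfl, Algebra.subset_adjoin ⟨y, h2, rfl⟩, D.ι_weight hp h1⟩
    · change Env.ι L y ∈ D.J γ
      rw [D.J_eq_top h2]
      trivial
  exact hle hx

theorem J_mul_ι {κ α : I → ℤ} {u : Env L} (hu : u ∈ D.J κ) {x : V} (hx : x ∈ D.nPos)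
    (hp : ∃ p, x ∈ L.part p) (hα : ∀ t, L.mul (D.cartan t) x = wt D.root α t • x) :
    u * Env.ι L x ∈ D.J (κ + α) := by
  induction hu using Submodule.span_induction with
  | mem u hu =>
    obtain ⟨μ, hμ, hu⟩ := hu
    refine Ideal.subset_span ⟨μ + α, by gcongr, mul_mem hu.1 (Algebra.subset_adjoin ⟨_, hx, rfl⟩),
      fun t => D.weight_mul (hu.2 t) (D.ι_weight hp hα t)⟩
  | zero => simp
  | add a b _ _ ha hb => rw [add_mul]; exact add_mem ha hb
  | smul c a _ ha => rw [smul_eq_mul, mul_assoc]; exact Ideal.mul_mem_left _ _ ha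

theorem Word.mul_ι_mem {D : TriangularData I H L} {μ : I → ℤ} {w : Env L} (hw : D.Word μ w) :
    ∀ {γ : I → ℤ} {x : V}, (∃ p, x ∈ L.part p) →
      (∀ t, L.mul (D.cartan t) x = wt D.root γ t • x) → w * Env.ι L x ∈ D.J (μ + γ) := by
  induction hw with
  | one =>
    intro γ x hp hγ
    rw [one_mul, zero_add]
    exact D.ι_mem_J hγ
  | @mul μ α w e hw he hpe hα ih =>
    intro γ x hp hγ
    obtain ⟨p, hp⟩ := hp
    obtain ⟨q, hq⟩ := hpe
    have hbr : ∀ t, L.mul (D.cartan t) (L.mul e x) = wt D.root (α + γ) t • L.mul e x := by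
      intro t
      rw [L.jacobi (D.cartan_even t) hq x, hα t, hγ t, wt_add]
      simp [sgn, add_smul]
    rw [mul_assoc, Env.ι_mul hq hp, mul_add, mul_smul_comm, ← mul_assoc]
    refine add_mem ?_ (D.smul_mem_J _ ?_)
    · rw [add_assoc]
      exact ih ⟨_, L.mul_mem hq hp⟩ hbr
    · have := D.J_mul_ι (ih ⟨p, hp⟩ hγ) he ⟨q, hq⟩ hα
      rwa [add_right_comm] at this

/-- Right multiplications are continuous. -/
theorem exists_J_mul (v : Env L) : ∀ ν, ∃ ν', ∀ u ∈ D.J ν', u * v ∈ D.J ν := by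
  induction v using Env.induction with
  | halg c =>
    intro ν
    refine ⟨ν, fun u hu => ?_⟩
    rw [← Algebra.commutes, ← Algebra.smul_def]
    exact D.smul_mem_J _ hu
  | hmul a b ha hb =>
    intro ν
    obtain ⟨ν', h'⟩ := hb ν
    obtain ⟨ν'', h''⟩ := ha ν'
    refine ⟨ν'', fun u hu => ?_⟩
    rw [← mul_assoc]
    exact h' _ (h'' u hu)
  | hadd a b ha hb =>
    intro ν
    obtain ⟨ν', h'⟩ := hb ν
    obtain ⟨ν'', h''⟩ := ha ν
    refine ⟨ν' ⊔ ν'', fun u hu => ?_⟩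
    rw [mul_add]
    exact add_mem (h'' u (D.J_anti le_sup_right hu)) (h' u (D.J_anti le_sup_left hu))
  | hι x =>
    have hx := D.top_le (Submodule.mem_top (x := x))
    refine Submodule.span_induction
      (p := fun x _ => ∀ ν, ∃ ν', ∀ u ∈ D.J ν', u * Env.ι L x ∈ D.J ν) ?_ ?_ ?_ ?_ hx
    · intro x hx
      obtain ⟨hp, γ, hγ, -⟩ := hx
      intro ν
      refine ⟨ν - γ, fun u hu => ?_⟩
      induction hu using Submodule.span_induction with
      | zero => simp
      | add a b _ _ ha hb => rw [add_mul]; exact add_mem ha hb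
      | smul c a _ ha => rw [smul_eq_mul, mul_assoc]; exact Ideal.mul_mem_left _ _ ha
      | mem u hu =>
        obtain ⟨μ, hμ, hu⟩ := hu
        replace hu := D.uPos_le_words μ hu
        refine D.J_anti (sub_le_iff_le_add.1 hμ) ?_
        induction hu using Submodule.span_induction with
        | zero => simp
        | add a b _ _ ha hb => rw [add_mul]; exact add_mem ha hb
        | smul c a _ ha => rw [smul_mul_assoc]; exact D.smul_mem_J _ ha
        | mem w hw => exact Word.mul_ι_mem hw hp hγ
    · exact fun ν => ⟨ν, fun u _ => by simp⟩
    · intro a b _ _ ha hb ν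
      obtain ⟨ν', h'⟩ := hb ν
      obtain ⟨ν'', h''⟩ := ha ν
      refine ⟨ν' ⊔ ν'', fun u hu => ?_⟩
      rw [map_add, mul_add]
      exact add_mem (h'' u (D.J_anti le_sup_right hu)) (h' u (D.J_anti le_sup_left hu))
    · intro c a _ ha ν
      obtain ⟨ν', h'⟩ := ha ν
      refine ⟨ν', fun u hu => ?_⟩
      rw [map_smul, mul_smul_comm]
      exact D.smul_mem_J _ (h' u hu)

theorem subgroupsBasis :
    RingSubgroupsBasis (fun ν : I → ℤ => (D.J ν).toAddSubgroup) where
  inter := fun ν ν' => ⟨ν ⊔ ν', fun _ hu =>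
    ⟨D.J_anti le_sup_left hu, D.J_anti le_sup_right hu⟩⟩
  mul := fun ν => ⟨ν, by
    rintro _ ⟨a, _, b, hb, rfl⟩
    exact Ideal.mul_mem_left _ _ hb⟩
  leftMul := fun x ν => ⟨ν, fun _ hu => Ideal.mul_mem_left _ _ hu⟩
  rightMul := fun x ν => D.exists_J_mul x ν

/-- A copy of `U(𝔤)`, to carry the topology defined by the left ideals `J(ν)`. -/
def U (_ : TriangularData I H L) : Type _ := Env L

instance : Ring D.U := inferInstanceAs (Ring (Env L))

/-- The topology on `U(𝔤)` in which the left ideals `J(ν)`, `ν ∈ Q(π)`, form a basis of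
neighbourhoods of zero. -/
instance : TopologicalSpace D.U := D.subgroupsBasis.topology

instance : IsTopologicalRing D.U :=
  D.subgroupsBasis.toRingFilterBasis.isTopologicalRing

instance : UniformSpace D.U := IsTopologicalAddGroup.rightUniformSpace D.U

instance : IsUniformAddGroup D.U := isUniformAddGroup_of_addCommGroup

/-- The completion `Û` of `U(𝔤)`: it carries the unique ring structure that makes it a topological
ring in which the image of `U(𝔤)` is a dense subring. -/
abbrev UHat : Type _ := UniformSpace.Completion D.U

/-- The canonical ring homomorphism `U(𝔤) → Û`. -/
def toHat : Env L →+* D.UHat := (UniformSpace.Completion.coeRingHom : D.U →+* D.UHat)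

/-- The `ℤ/2`-grading `Û = Û₀ ⊕ Û₁`; `Û_i` is the closure of the image of `U(𝔤)_i`. -/
def hatPart (i : ZMod 2) : AddSubgroup D.UHat :=
  ((Env.part L i).map D.toHat.toAddMonoidHom).topologicalClosure

/-- The centre `Z(Û)` of the completion. -/
def centreHat : AddSubgroup D.UHat := superCentre D.hatPart

/-- The image in `Û` of the centre `Z(𝔤)` of `U(𝔤)`. -/
def centreImage : AddSubgroup D.UHat := (Env.centre L).map D.toHat.toAddMonoidHom

end Completion

/-- The triangular data induced on a quotient by a graded ideal. -/
def quotient (D : TriangularData I H L) (N : Submodule ℂ V) (hN : L.IsGradedIdeal N) :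
    TriangularData I H (L.quotient N hN) where
  cartan := N.mkQ ∘ₗ D.cartan
  root := D.root
  nPos := D.nPos.map N.mkQ
  cartan_even := fun t => ⟨_, D.cartan_even t, rfl⟩
  cartan_comm := fun s t => by
    have : N.mkQ (L.mul (D.cartan s) (D.cartan t)) = 0 := by rw [D.cartan_comm, map_zero]
    exact this
  root_indep := D.root_indep
  nPos_le := by
    refine (Submodule.map_mono D.nPos_le).trans ?_
    rw [Submodule.map_span]
    refine Submodule.span_mono ?_
    rintro _ ⟨x, ⟨hx, ⟨p, hp⟩, γ, hγ⟩, rfl⟩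
    refine ⟨⟨x, hx, rfl⟩, ⟨p, x, hp, rfl⟩, γ, fun t => ?_⟩
    have : N.mkQ (L.mul (D.cartan t) x) = wt D.root γ t • N.mkQ x := by rw [hγ, map_smul]
    exact this
  top_le := by
    rw [← Submodule.range_mkQ N, ← Submodule.map_top]
    refine (Submodule.map_mono D.top_le).trans ?_
    rw [Submodule.map_span]
    refine Submodule.span_mono ?_
    rintro _ ⟨x, ⟨⟨p, hp⟩, γ, hγ, h⟩, rfl⟩
    refine ⟨⟨p, x, hp, rfl⟩, γ, fun t => ?_, h.imp (fun hx => ⟨x, hx, rfl⟩) id⟩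
    have : N.mkQ (L.mul (D.cartan t) x) = wt D.root γ t • N.mkQ x := by rw [hγ, map_smul]
    exact this

end TriangularData

/-! ### The `Q`-type Lie superalgebras -/

section QType

/-- The bracket of `𝔮(n)` in terms of pairs `(A, B)` standing for the block matrices
`X_{A,B} = (A B; B A)`: `[X_{A,0}, X_{A',0}] = X_{[A,A'],0}`, `[X_{A,0}, X_{0,B}] = X_{0,[A,B]}`,
`[X_{0,B}, X_{0,B'}] = X_{BB'+B'B,0}`. -/
def qMul (n : ℕ) :
    (Matrix (Fin n) (Fin n) ℂ × Matrix (Fin n) (Fin n) ℂ) →ₗ[ℂ]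
    (Matrix (Fin n) (Fin n) ℂ × Matrix (Fin n) (Fin n) ℂ) →ₗ[ℂ]
    (Matrix (Fin n) (Fin n) ℂ × Matrix (Fin n) (Fin n) ℂ) :=
  LinearMap.mk₂ ℂ
    (fun X Y => ((X.1 * Y.1 - Y.1 * X.1) + (X.2 * Y.2 + Y.2 * X.2),
      (X.1 * Y.2 - Y.2 * X.1) + (X.2 * Y.1 - Y.1 * X.2)))
    (by intro X X' Y; ext1 <;> simp only [Prod.fst_add, Prod.snd_add] <;> noncomm_ring)
    (by
      intro c X Y
      ext1 <;> simp only [Prod.smul_fst, Prod.smul_snd, smul_mul_assoc, mul_smul_comm, smul_add,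
        smul_sub])
    (by intro X Y Y'; ext1 <;> simp only [Prod.fst_add, Prod.snd_add] <;> noncomm_ring)
    (by
      intro c X Y
      ext1 <;> simp only [Prod.smul_fst, Prod.smul_snd, smul_mul_assoc, mul_smul_comm, smul_add,
        smul_sub])

theorem qMul_apply (n : ℕ) (X Y : Matrix (Fin n) (Fin n) ℂ × Matrix (Fin n) (Fin n) ℂ) :
    qMul n X Y = ((X.1 * Y.1 - Y.1 * X.1) + (X.2 * Y.2 + Y.2 * X.2),
      (X.1 * Y.2 - Y.2 * X.1) + (X.2 * Y.1 - Y.1 * X.2)) := rfl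

/-- The homogeneous components of `𝔮(n)`: the even part consists of the `X_{A,0}` and the odd
part of the `X_{0,B}`. -/
def qPart (n : ℕ) (i : ZMod 2) :
    Submodule ℂ (Matrix (Fin n) (Fin n) ℂ × Matrix (Fin n) (Fin n) ℂ) :=
  if i = 0 then LinearMap.ker (LinearMap.snd ℂ _ _) else LinearMap.ker (LinearMap.fst ℂ _ _)

theorem mem_qPart_zero {n : ℕ} {X : Matrix (Fin n) (Fin n) ℂ × Matrix (Fin n) (Fin n) ℂ} :
    X ∈ qPart n 0 ↔ X.2 = 0 := by
  simp [qPart]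

theorem mem_qPart_one {n : ℕ} {X : Matrix (Fin n) (Fin n) ℂ × Matrix (Fin n) (Fin n) ℂ} :
    X ∈ qPart n 1 ↔ X.1 = 0 := by
  simp [qPart]

theorem zmod_two_cases (i : ZMod 2) : i = 0 ∨ i = 1 := by
  revert i
  decide

/-- The Lie superalgebra `𝔮(n)`. -/
def q (n : ℕ) :
    LieSuperalgebra (Matrix (Fin n) (Fin n) ℂ × Matrix (Fin n) (Fin n) ℂ) where
  mul := qMul n
  part := qPart n
  isCompl := by
    constructor
    · rw [Submodule.disjoint_def]
      intro X h0 h1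
      exact Prod.ext (mem_qPart_one.1 h1) (mem_qPart_zero.1 h0)
    · rw [codisjoint_iff, eq_top_iff]
      intro X _
      exact Submodule.mem_sup.2 ⟨(X.1, 0), mem_qPart_zero.2 rfl, (0, X.2), mem_qPart_one.2 rfl,
        by simp⟩
  mul_mem := by
    intro i j X Y hX hY
    have h11 : (1 : ZMod 2) + 1 = 0 := rfl
    rcases zmod_two_cases i with rfl | rfl <;> rcases zmod_two_cases j with rfl | rfl <;>
      simp only [zero_add, add_zero, h11, mem_qPart_zero, mem_qPart_one] at * <;>
      simp [qMul_apply, hX, hY]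
  skew := by
    intro i j X Y hX hY
    rcases zmod_two_cases i with rfl | rfl <;> rcases zmod_two_cases j with rfl | rfl <;>
      simp only [mem_qPart_zero, mem_qPart_one] at * <;>
      ext1 <;> simp [qMul_apply, hX, hY, sgn, add_comm]
  jacobi := by
    intro i j X Y hX hY Z
    rcases zmod_two_cases i with rfl | rfl <;> rcases zmod_two_cases j with rfl | rfl <;>
      simp only [mem_qPart_zero, mem_qPart_one] at * <;>
      ext1 <;> simp [qMul_apply, hX, hY, sgn] <;> noncomm_ring

/-- The simple root `ε_i - ε_{i+1}` (with `0 ≤ i < n - 1`), as a functional on the diagonal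
matrices. -/
def qRoot (n : ℕ) (i : Fin (n - 1)) : Module.Dual ℂ (Fin n → ℂ) :=
  (LinearMap.proj (⟨i, by omega⟩ : Fin n) : (Fin n → ℂ) →ₗ[ℂ] ℂ) -
    LinearMap.proj (⟨i + 1, by omega⟩ : Fin n)

/-- The even part of the Cartan subalgebra of `𝔮(n)`: `X_{A,0}` with `A` diagonal. -/
def qCartan (n : ℕ) :
    (Fin n → ℂ) →ₗ[ℂ] (Matrix (Fin n) (Fin n) ℂ × Matrix (Fin n) (Fin n) ℂ) :=
  LinearMap.inl ℂ _ _ ∘ₗ Matrix.diagonalLinearMap (Fin n) ℂ ℂ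

/-- The subalgebra `𝔫⁺` of `𝔮(n)`: `X_{A,B}` with `A, B` strictly upper triangular. -/
def qPos (n : ℕ) : Submodule ℂ (Matrix (Fin n) (Fin n) ℂ × Matrix (Fin n) (Fin n) ℂ) where
  carrier := {X | ∀ i j, j ≤ i → X.1 i j = 0 ∧ X.2 i j = 0}
  zero_mem' := by simp
  add_mem' := by
    intro X Y hX hY i j h
    simp [hX i j h, hY i j h]
  smul_mem' := by
    intro c X hX i j h
    simp [hX i j h]

theorem qCartan_apply (n : ℕ) (t : Fin n → ℂ) : qCartan n t = (Matrix.diagonal t, 0) := rfl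

/-- The coordinates of `ε_i - ε_j` with respect to the simple roots. -/
def qWt (n : ℕ) (i j : Fin n) (k : Fin (n - 1)) : ℤ :=
  (if i.1 ≤ k.1 then 1 else 0) - (if j.1 ≤ k.1 then 1 else 0)

theorem wt_qWt (n : ℕ) (i j : Fin n) (t : Fin n → ℂ) :
    wt (qRoot n) (qWt n i j) t = t i - t j := by
  let a : ℕ → ℂ := fun k => if h : k < n then t ⟨k, h⟩ else 0
  have key : ∀ (m i : ℕ), i ≤ m →
      ∑ k ∈ Finset.range m, (if i ≤ k then (1 : ℂ) else 0) * (a k - a (k + 1)) = a i - a m := by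
    intro m
    induction m with
    | zero =>
      intro i hi
      obtain rfl : i = 0 := by omega
      simp
    | succ m ih =>
      intro i hi
      rw [Finset.sum_range_succ]
      rcases Nat.lt_or_ge m i with h | h
      · obtain rfl : i = m + 1 := by omega
        rw [Finset.sum_eq_zero]
        · simp
        · intro k hk
          have := Finset.mem_range.1 hk
          rw [if_neg (by omega), zero_mul]
      · rw [ih i h, if_pos h]
        ring
  have hs : ∀ i : Fin n, ∑ k : Fin (n - 1), (if i.1 ≤ k.1 then (1 : ℂ) else 0) * qRoot n k t =
      t i - a (n - 1) := by
    intro i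
    have h1 := key (n - 1) i.1 (by omega)
    rw [← Fin.sum_univ_eq_sum_range
      (fun k => (if i.1 ≤ k then (1 : ℂ) else 0) * (a k - a (k + 1)))] at h1
    have h2 : a i.1 = t i := by simp [a]
    rw [h2] at h1
    rw [← h1]
    refine Finset.sum_congr rfl fun k _ => ?_
    have e1 : a k.1 = t ⟨k, by omega⟩ := dif_pos (by omega)
    have e2 : a (k.1 + 1) = t ⟨k + 1, by omega⟩ := dif_pos (by omega)
    rw [e1, e2]
    rfl
  have : wt (qRoot n) (qWt n i j) t =
      ∑ k : Fin (n - 1), (if i.1 ≤ k.1 then (1 : ℂ) else 0) * qRoot n k t -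
      ∑ k : Fin (n - 1), (if j.1 ≤ k.1 then (1 : ℂ) else 0) * qRoot n k t := by
    rw [← Finset.sum_sub_distrib]
    simp only [wt, LinearMap.sum_apply, LinearMap.smul_apply, smul_eq_mul]
    refine Finset.sum_congr rfl fun k _ => ?_
    rw [← sub_mul]
    simp only [qWt]
    push_cast
    rfl
  rw [this, hs, hs]
  ring

theorem qRoot_indep (n : ℕ) : LinearIndependent ℂ (qRoot n) := by
  rw [Fintype.linearIndependent_iff]
  intro g hg k
  -- evaluate at `t = (1, …, 1, 0, …, 0)` with `k + 1` ones
  have h := LinearMap.congr_fun hg (fun j : Fin n => if j.1 ≤ k.1 then (1 : ℂ) else 0)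
  simp only [LinearMap.sum_apply, LinearMap.smul_apply, smul_eq_mul, LinearMap.zero_apply,
    qRoot, LinearMap.sub_apply, LinearMap.proj_apply] at h
  rw [Finset.sum_eq_single k] at h
  · simpa using h
  · intro b _ hb
    have hb' : b.1 ≠ k.1 := fun h => hb (Fin.ext h)
    rcases Nat.lt_or_ge b.1 k.1 with h1 | h1
    · rw [if_pos (by omega), if_pos (by omega)]; simp
    · rw [if_neg (by omega), if_neg (by omega)]; simp
  · simp

theorem q_weight_fst (n : ℕ) (i j : Fin n) (c : ℂ) (t : Fin n → ℂ) :
    qMul n (qCartan n t) (Matrix.single i j c, 0) =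
      wt (qRoot n) (qWt n i j) t • (Matrix.single i j c, 0) := by
  rw [wt_qWt, qMul_apply, qCartan_apply]
  ext a b
  · by_cases ha : i = a <;> by_cases hb : j = b <;>
      simp [Matrix.single_apply, Matrix.diagonal_apply, Matrix.mul_apply, ha, hb] <;> grind
  · simp

theorem q_weight_snd (n : ℕ) (i j : Fin n) (c : ℂ) (t : Fin n → ℂ) :
    qMul n (qCartan n t) (0, Matrix.single i j c) =
      wt (qRoot n) (qWt n i j) t • (0, Matrix.single i j c) := by
  rw [wt_qWt, qMul_apply, qCartan_apply]
  ext a b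
  · simp
  · by_cases ha : i = a <;> by_cases hb : j = b <;>
      simp [Matrix.single_apply, Matrix.diagonal_apply, Matrix.mul_apply, ha, hb] <;> grind

theorem q_weight_diag (n : ℕ) (s t : Fin n → ℂ) :
    qMul n (qCartan n t) (0, Matrix.diagonal s) =
      wt (qRoot n) 0 t • (0, Matrix.diagonal s) := by
  rw [wt_zero, qMul_apply, qCartan_apply]
  simp [Matrix.diagonal_mul_diagonal, mul_comm]

theorem qWt_nonpos {n : ℕ} {i j : Fin n} (h : j ≤ i) : qWt n i j ≤ 0 := by
  intro k
  have : j.1 ≤ i.1 := h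
  simp only [qWt, Pi.zero_apply]
  split_ifs <;> omega

theorem single_fst_mem_qPos {n : ℕ} {i j : Fin n} (h : i < j) (c : ℂ) :
    ((Matrix.single i j c, 0) : Matrix (Fin n) (Fin n) ℂ × Matrix (Fin n) (Fin n) ℂ) ∈
      qPos n := by
  intro a b hab
  refine ⟨?_, rfl⟩
  refine Matrix.single_apply_of_ne _ _ _ _ _ ?_
  rintro ⟨rfl, rfl⟩
  exact absurd hab (not_le.2 h)

theorem single_snd_mem_qPos {n : ℕ} {i j : Fin n} (h : i < j) (c : ℂ) :
    ((0, Matrix.single i j c) : Matrix (Fin n) (Fin n) ℂ × Matrix (Fin n) (Fin n) ℂ) ∈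
      qPos n := by
  intro a b hab
  refine ⟨rfl, ?_⟩
  refine Matrix.single_apply_of_ne _ _ _ _ _ ?_
  rintro ⟨rfl, rfl⟩
  exact absurd hab (not_le.2 h)

/-- Decomposition of `X_{A,B}` into matrix units and an odd diagonal matrix. -/
theorem q_decomp {n : ℕ} (X : Matrix (Fin n) (Fin n) ℂ × Matrix (Fin n) (Fin n) ℂ) :
    X = ∑ i, ∑ j, (Matrix.single i j (X.1 i j), 0) +
      (∑ i, ∑ j, (0, Matrix.single i j (if i = j then 0 else X.2 i j)) +
        (0, Matrix.diagonal fun i => X.2 i i)) := by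
  ext a b
  · simp [Prod.fst_sum, Matrix.sum_apply, Matrix.single_apply, ite_and]
  · by_cases hab : a = b <;>
      simp [Prod.snd_sum, Matrix.sum_apply, Matrix.single_apply, ite_and, hab]

/-- The natural triangular data of `𝔮(n)`. -/
def qData (n : ℕ) : TriangularData (Fin (n - 1)) (Fin n → ℂ) (q n) where
  cartan := qCartan n
  root := qRoot n
  nPos := qPos n
  cartan_even := fun t => mem_qPart_zero.2 rfl
  cartan_comm := fun s t => by
    change qMul n _ _ = 0
    rw [qMul_apply, qCartan_apply, qCartan_apply]
    simp [Matrix.diagonal_mul_diagonal, mul_comm]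
  root_indep := qRoot_indep n
  nPos_le := by
    intro X hX
    rw [q_decomp X]
    refine add_mem (sum_mem fun i _ => sum_mem fun j _ => ?_)
      (add_mem (sum_mem fun i _ => sum_mem fun j _ => ?_) ?_)
    · rcases lt_or_ge i j with h | h
      · exact Submodule.subset_span ⟨single_fst_mem_qPos h _, ⟨0, mem_qPart_zero.2 rfl⟩,
          qWt n i j, q_weight_fst n i j _⟩
      · rw [(hX i j h).1, Matrix.single_zero]
        exact zero_mem _
    · rcases lt_or_ge i j with h | h
      · exact Submodule.subset_span ⟨single_snd_mem_qPos h _, ⟨1, mem_qPart_one.2 rfl⟩,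
          qWt n i j, q_weight_snd n i j _⟩
      · rw [(hX i j h).2, ite_self, Matrix.single_zero]
        exact zero_mem _
    · have : (fun i => X.2 i i) = 0 := funext fun i => (hX i i le_rfl).2
      rw [this, Matrix.diagonal_zero']
      exact zero_mem _
  top_le := by
    intro X _
    rw [q_decomp X]
    refine add_mem (sum_mem fun i _ => sum_mem fun j _ => ?_)
      (add_mem (sum_mem fun i _ => sum_mem fun j _ => ?_) ?_)
    · refine Submodule.subset_span ⟨⟨0, mem_qPart_zero.2 rfl⟩, qWt n i j, q_weight_fst n i j _, ?_⟩
      rcases lt_or_ge i j with h | h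
      · exact Or.inl (single_fst_mem_qPos h _)
      · exact Or.inr (qWt_nonpos h)
    · refine Submodule.subset_span ⟨⟨1, mem_qPart_one.2 rfl⟩, qWt n i j, q_weight_snd n i j _, ?_⟩
      rcases lt_or_ge i j with h | h
      · exact Or.inl (single_snd_mem_qPos h _)
      · exact Or.inr (qWt_nonpos h)
    · exact Submodule.subset_span ⟨⟨1, mem_qPart_one.2 rfl⟩, 0, q_weight_diag n _, Or.inr le_rfl⟩

/-- The subspace `{X_{A,B} | tr B = 0}` of `𝔮(n)`. -/
def sqSubmodule (n : ℕ) : Submodule ℂ (Matrix (Fin n) (Fin n) ℂ × Matrix (Fin n) (Fin n) ℂ) :=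
  LinearMap.ker (Matrix.traceLinearMap (Fin n) ℂ ℂ ∘ₗ LinearMap.snd ℂ _ _)

theorem mem_sqSubmodule {n : ℕ} {X : Matrix (Fin n) (Fin n) ℂ × Matrix (Fin n) (Fin n) ℂ} :
    X ∈ sqSubmodule n ↔ X.2.trace = 0 := Iff.rfl

/-- The Lie superalgebra `𝔰𝔮(n)`. -/
def sq (n : ℕ) : LieSuperalgebra (sqSubmodule n) :=
  (q n).sub (sqSubmodule n)
    (by
      intro X Y _ _
      change (qMul n X Y).2.trace = 0
      rw [qMul_apply]
      simp only [Matrix.trace_add, Matrix.trace_sub]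
      rw [Matrix.trace_mul_comm X.1 Y.2, Matrix.trace_mul_comm X.2 Y.1]
      ring)
    (by
      intro X Y hX _ _
      rw [mem_sqSubmodule, mem_qPart_zero.1 hX, Matrix.trace_zero])

theorem trace_single_off {n : ℕ} (i j : Fin n) (c : ℂ) :
    (Matrix.single i j (if i = j then 0 else c)).trace = 0 := by
  by_cases h : i = j
  · simp [h]
  · exact Matrix.trace_single_eq_of_ne _ _ _ h

/-- The triangular data of `𝔰𝔮(n)` induced from `𝔮(n)`. -/
def sqData (n : ℕ) : TriangularData (Fin (n - 1)) (Fin n → ℂ) (sq n) where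
  cartan := (qCartan n).codRestrict (sqSubmodule n) (fun t => by
    rw [mem_sqSubmodule, qCartan_apply, Matrix.trace_zero])
  root := qRoot n
  nPos := (qPos n).comap (sqSubmodule n).subtype
  cartan_even := fun t => (qData n).cartan_even t
  cartan_comm := fun s t => Subtype.ext ((qData n).cartan_comm s t)
  root_indep := qRoot_indep n
  nPos_le := by
    rintro ⟨X, hXs⟩ hX
    have hX : X ∈ qPos n := hX
    have hspan : X ∈ (Submodule.span ℂ {x : sqSubmodule n |
        x ∈ (qPos n).comap (sqSubmodule n).subtype ∧ (∃ p, x ∈ (sq n).part p) ∧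
        ∃ γ : Fin (n - 1) → ℤ, ∀ t, qMul n (qCartan n t) x =
          wt (qRoot n) γ t • (x : Matrix (Fin n) (Fin n) ℂ × Matrix (Fin n) (Fin n) ℂ)}).map
        (sqSubmodule n).subtype := by
      rw [Submodule.map_span, q_decomp X]
      refine add_mem (sum_mem fun i _ => sum_mem fun j _ => ?_)
        (add_mem (sum_mem fun i _ => sum_mem fun j _ => ?_) ?_)
      · rcases lt_or_ge i j with h | h
        · exact Submodule.subset_span ⟨⟨_, mem_sqSubmodule.2 (Matrix.trace_zero _ _)⟩,
            ⟨single_fst_mem_qPos h _, ⟨0, mem_qPart_zero.2 rfl⟩,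
              qWt n i j, q_weight_fst n i j _⟩, rfl⟩
        · rw [(hX i j h).1, Matrix.single_zero]
          exact zero_mem _
      · rcases lt_or_ge i j with h | h
        · exact Submodule.subset_span ⟨⟨_, mem_sqSubmodule.2 (trace_single_off i j _)⟩,
            ⟨single_snd_mem_qPos h _, ⟨1, mem_qPart_one.2 rfl⟩,
              qWt n i j, q_weight_snd n i j _⟩, rfl⟩
        · rw [(hX i j h).2, ite_self, Matrix.single_zero]
          exact zero_mem _
      · have : (fun i => X.2 i i) = 0 := funext fun i => (hX i i le_rfl).2
        rw [this, Matrix.diagonal_zero']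
        exact zero_mem _
    obtain ⟨y, hy, hyX⟩ := hspan
    obtain rfl : y = ⟨X, hXs⟩ := Subtype.ext hyX
    refine Submodule.span_mono ?_ hy
    rintro x ⟨h1, h2, γ, hγ⟩
    exact ⟨h1, h2, γ, fun t => Subtype.ext (hγ t)⟩
  top_le := by
    rintro ⟨X, hXs⟩ -
    have hspan : X ∈ (Submodule.span ℂ {x : sqSubmodule n | (∃ p, x ∈ (sq n).part p) ∧
        ∃ γ : Fin (n - 1) → ℤ, (∀ t, qMul n (qCartan n t) x =
          wt (qRoot n) γ t • (x : Matrix (Fin n) (Fin n) ℂ × Matrix (Fin n) (Fin n) ℂ)) ∧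
        (x ∈ (qPos n).comap (sqSubmodule n).subtype ∨ γ ≤ 0)}).map
        (sqSubmodule n).subtype := by
      rw [Submodule.map_span, q_decomp X]
      refine add_mem (sum_mem fun i _ => sum_mem fun j _ => ?_)
        (add_mem (sum_mem fun i _ => sum_mem fun j _ => ?_) ?_)
      · refine Submodule.subset_span ⟨⟨_, mem_sqSubmodule.2 (Matrix.trace_zero _ _)⟩,
          ⟨⟨0, mem_qPart_zero.2 rfl⟩, qWt n i j, q_weight_fst n i j _, ?_⟩, rfl⟩
        rcases lt_or_ge i j with h | h
        · exact Or.inl (single_fst_mem_qPos h _)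
        · exact Or.inr (qWt_nonpos h)
      · refine Submodule.subset_span ⟨⟨_, mem_sqSubmodule.2 (trace_single_off i j _)⟩,
          ⟨⟨1, mem_qPart_one.2 rfl⟩, qWt n i j, q_weight_snd n i j _, ?_⟩, rfl⟩
        rcases lt_or_ge i j with h | h
        · exact Or.inl (single_snd_mem_qPos h _)
        · exact Or.inr (qWt_nonpos h)
      · exact Submodule.subset_span ⟨⟨_, mem_sqSubmodule.2 (by
            rw [Matrix.trace_diagonal]; exact mem_sqSubmodule.1 hXs)⟩,
          ⟨⟨1, mem_qPart_one.2 rfl⟩, 0, q_weight_diag n _, Or.inr le_rfl⟩, rfl⟩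
    obtain ⟨y, hy, hyX⟩ := hspan
    obtain rfl : y = ⟨X, hXs⟩ := Subtype.ext hyX
    refine Submodule.span_mono ?_ hy
    rintro x ⟨h2, γ, hγ, h3⟩
    exact ⟨h2, γ, fun t => Subtype.ext (hγ t), h3⟩

/-- A line spanned by an even central element is a graded ideal. -/
theorem isGradedIdeal_span_singleton {V : Type*} [AddCommGroup V] [Module ℂ V]
    (L : LieSuperalgebra V) {z : V} (hz : z ∈ L.part 0) (hl : ∀ x, L.mul x z = 0)
    (hr : ∀ x, L.mul z x = 0) : L.IsGradedIdeal (Submodule.span ℂ {z}) where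
  mul_left := fun x y hy => by
    obtain ⟨c, rfl⟩ := Submodule.mem_span_singleton.1 hy
    rw [map_smul, hl, smul_zero]
    exact zero_mem _
  mul_right := fun {x} y hx => by
    obtain ⟨c, rfl⟩ := Submodule.mem_span_singleton.1 hx
    rw [map_smul, LinearMap.smul_apply, hr, smul_zero]
    exact zero_mem _
  graded := fun {x y} hx hy h => by
    obtain ⟨c, hc⟩ := Submodule.mem_span_singleton.1 h
    have h0 : c • z - x = y := by rw [hc]; abel
    have h1 : c • z - x = 0 := (Submodule.disjoint_def.1 L.isCompl.disjoint) _
      (Submodule.sub_mem _ (Submodule.smul_mem _ c hz) hx) (by rw [h0]; exact hy)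
    rw [← sub_eq_zero.1 h1]
    exact Submodule.smul_mem _ _ (Submodule.mem_span_singleton_self z)

/-- The identity matrix `Id = X_{1,0}` of `𝔮(n)`. -/
def qId (n : ℕ) : Matrix (Fin n) (Fin n) ℂ × Matrix (Fin n) (Fin n) ℂ := (1, 0)

/-- The identity matrix as an element of `𝔰𝔮(n)`. -/
def sqId (n : ℕ) : sqSubmodule n := ⟨qId n, mem_sqSubmodule.2 (Matrix.trace_zero _ _)⟩

theorem isGradedIdeal_qId (n : ℕ) : (q n).IsGradedIdeal (Submodule.span ℂ {qId n}) :=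
  isGradedIdeal_span_singleton (q n) (mem_qPart_zero.2 rfl)
    (fun X => by
      change qMul n X (qId n) = 0
      simp [qMul_apply, qId])
    (fun X => by
      change qMul n (qId n) X = 0
      simp [qMul_apply, qId])

theorem isGradedIdeal_sqId (n : ℕ) : (sq n).IsGradedIdeal (Submodule.span ℂ {sqId n}) :=
  isGradedIdeal_span_singleton (sq n) (mem_qPart_zero.2 rfl)
    (fun X => Subtype.ext (by
      change qMul n X (qId n) = 0
      simp [qMul_apply, qId]))
    (fun X => Subtype.ext (by
      change qMul n (qId n) X = 0
      simp [qMul_apply, qId]))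

/-- The Lie superalgebra `𝔭𝔮(n) = 𝔮(n)/(Id)`. -/
def pq (n : ℕ) := (q n).quotient _ (isGradedIdeal_qId n)

/-- The triangular data of `𝔭𝔮(n)` induced from `𝔮(n)`. -/
def pqData (n : ℕ) : TriangularData (Fin (n - 1)) (Fin n → ℂ) (pq n) :=
  (qData n).quotient _ (isGradedIdeal_qId n)

/-- The Lie superalgebra `𝔭𝔰𝔮(n) = 𝔰𝔮(n)/(Id)`. -/
def psq (n : ℕ) := (sq n).quotient _ (isGradedIdeal_sqId n)

/-- The triangular data of `𝔭𝔰𝔮(n)` induced from `𝔰𝔮(n)`. -/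
def psqData (n : ℕ) : TriangularData (Fin (n - 1)) (Fin n → ℂ) (psq n) :=
  (sqData n).quotient _ (isGradedIdeal_sqId n)

end QType

/-! ### Contragredient (Kac-Moody) Lie superalgebras -/

section Contragredient

/-- A realization of a complex square matrix `A = (a_{ij})`: linearly independent simple roots
`α_i ∈ 𝔥^*` and simple coroots `α_i^∨ ∈ 𝔥` with `α_j(α_i^∨) = a_{ij}` and
`dim 𝔥 = 2 |I| - rank A`. -/
structure Realization {I : Type*} [Fintype I] (A : Matrix I I ℂ)
    (H : Type*) [AddCommGroup H] [Module ℂ H] where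
  root : I → Module.Dual ℂ H
  coroot : I → H
  root_indep : LinearIndependent ℂ root
  coroot_indep : LinearIndependent ℂ coroot
  root_coroot : ∀ i j, root j (coroot i) = A i j
  finite : FiniteDimensional ℂ H
  finrank_eq : Module.finrank ℂ H + A.rank = 2 * Fintype.card I

/-- A matrix `A` is symmetrizable if `D A` is symmetric for some invertible diagonal matrix `D`. -/
def IsSymmetrizable {I : Type*} (A : Matrix I I ℂ) : Prop :=
  ∃ d : I → ℂ, (∀ i, d i ≠ 0) ∧ ∀ i j, d i * A i j = d j * A j i

/-- The generators `e_i`, `f_i` (`i ∈ I`) and `h ∈ 𝔥`. -/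
inductive Gen (I H : Type*)
  | e (i : I) : Gen I H
  | f (i : I) : Gen I H
  | h (t : H) : Gen I H

/-- Parities of the generators: `e_i` and `f_i` have parity `τ i`, and `𝔥` is even. -/
def genParity {I H : Type*} (τ : I → ZMod 2) : Gen I H → ZMod 2
  | Gen.e i => τ i
  | Gen.f i => τ i
  | Gen.h _ => 0

/-- The parity of a non-associative word in the generators. -/
def wordParity {I H : Type*} (τ : I → ZMod 2) : FreeMagma (Gen I H) → ZMod 2
  | FreeMagma.of x => genParity τ x
  | FreeMagma.mul a b => wordParity τ a + wordParity τ b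

/-- The product of the free non-associative algebra. -/
def freeMul (X : Type*) : (FreeMagma X →₀ ℂ) →ₗ[ℂ] (FreeMagma X →₀ ℂ) →ₗ[ℂ] (FreeMagma X →₀ ℂ) :=
  Finsupp.linearCombination ℂ fun a =>
    Finsupp.linearCombination ℂ fun b => Finsupp.single (a * b) (1 : ℂ)

theorem freeMul_single {X : Type*} (a b : FreeMagma X) (c d : ℂ) :
    freeMul X (Finsupp.single a c) (Finsupp.single b d) = Finsupp.single (a * b) (c * d) := by
  simp [freeMul, Finsupp.linearCombination_single]

/-- The free non-associative superalgebra on the generators. -/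
def freeSuperalgebra {I H : Type*} (τ : I → ZMod 2) :
    Superalgebra (FreeMagma (Gen I H) →₀ ℂ) where
  mul := freeMul _
  part := fun p => Finsupp.supported ℂ ℂ {w | wordParity τ w = p}
  isCompl := by
    constructor
    · refine Finsupp.disjoint_supported_supported ?_
      rw [Set.disjoint_left]
      intro w h0 h1
      have : (0 : ZMod 2) = 1 := h0.symm.trans h1
      exact absurd this (by decide)
    · refine Finsupp.codisjoint_supported_supported ?_
      rw [codisjoint_iff_le_sup]
      intro w _
      exact zmod_two_cases (wordParity τ w)
  mul_mem := by
    intro i j x y hx hy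
    rw [Finsupp.supported_eq_span_single] at hx hy
    have h := Submodule.apply_mem_map₂ (freeMul _) hx hy
    rw [Submodule.map₂_span_span] at h
    refine (Submodule.span_le.2 ?_) h
    rintro _ ⟨_, ⟨a, ha, rfl⟩, _, ⟨b, hb, rfl⟩, rfl⟩
    beta_reduce
    rw [SetLike.mem_coe, freeMul_single]
    refine Finsupp.single_mem_supported ℂ _ ?_
    change wordParity τ a + wordParity τ b = i + j
    rw [ha, hb]

section Tilde

variable {I H : Type*} [Fintype I] [AddCommGroup H] [Module ℂ H]
  {A : Matrix I I ℂ} (τ : I → ZMod 2) (R : Realization A H)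

/-- A generator as an element of the free superalgebra. -/
def gen (x : Gen I H) : FreeMagma (Gen I H) →₀ ℂ := Finsupp.single (FreeMagma.of x) 1

/-- The defining relators of `𝔤̃(A, τ)`: the identities of Lie superalgebras, the linear relations
between the elements of `𝔥`, and `[h, h'] = 0`, `[h, e_i] = α_i(h) e_i`, `[h, f_i] = -α_i(h) f_i`,
`[e_i, f_j] = δ_{ij} α_i^∨`. -/
inductive IsRelator : (FreeMagma (Gen I H) →₀ ℂ) → Prop
  | skew {p p' : ZMod 2} {x y : FreeMagma (Gen I H) →₀ ℂ}
      (hx : x ∈ (freeSuperalgebra τ).part p) (hy : y ∈ (freeSuperalgebra τ).part p') :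
      IsRelator (freeMul _ x y + sgn p p' • freeMul _ y x)
  | jacobi {p p' : ZMod 2} {x y : FreeMagma (Gen I H) →₀ ℂ}
      (hx : x ∈ (freeSuperalgebra τ).part p) (hy : y ∈ (freeSuperalgebra τ).part p')
      (z : FreeMagma (Gen I H) →₀ ℂ) :
      IsRelator (freeMul _ x (freeMul _ y z) -
        (freeMul _ (freeMul _ x y) z + sgn p p' • freeMul _ y (freeMul _ x z)))
  | h_add (s t : H) : IsRelator (gen (Gen.h (s + t)) - (gen (Gen.h s) + gen (Gen.h t)))
  | h_smul (c : ℂ) (t : H) : IsRelator (gen (Gen.h (c • t)) - c • gen (Gen.h t))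
  | hh (s t : H) : IsRelator (freeMul _ (gen (Gen.h s)) (gen (Gen.h t)))
  | he (t : H) (i : I) :
      IsRelator (freeMul _ (gen (Gen.h t)) (gen (Gen.e i)) - R.root i t • gen (Gen.e i))
  | hf (t : H) (i : I) :
      IsRelator (freeMul _ (gen (Gen.h t)) (gen (Gen.f i)) + R.root i t • gen (Gen.f i))
  | ef (i : I) : IsRelator (freeMul _ (gen (Gen.e i)) (gen (Gen.f i)) - gen (Gen.h (R.coroot i)))
  | ef_ne (i j : I) (hij : i ≠ j) : IsRelator (freeMul _ (gen (Gen.e i)) (gen (Gen.f j)))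

/-- The graded ideal of the free superalgebra generated by the relators. -/
def relIdeal : Submodule ℂ (FreeMagma (Gen I H) →₀ ℂ) :=
  sInf {N | (freeSuperalgebra τ).IsGradedIdeal N ∧ ∀ x, IsRelator τ R x → x ∈ N}

theorem isGradedIdeal_relIdeal : (freeSuperalgebra τ).IsGradedIdeal (relIdeal τ R) :=
  Superalgebra.isGradedIdeal_sInf _ _ fun _ hN => hN.1

variable {τ R} in
theorem IsRelator.mem {x : FreeMagma (Gen I H) →₀ ℂ} (hx : IsRelator τ R x) :
    x ∈ relIdeal τ R :=
  (Submodule.mem_sInf).2 fun _ hN => hN.2 x hx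

/-- The underlying vector space of `𝔤̃(A, τ)`. -/
abbrev TildeSpace : Type _ := (FreeMagma (Gen I H) →₀ ℂ) ⧸ relIdeal τ R

/-- The Lie superalgebra `𝔤̃(A, τ)` with generators `e_i, f_i, 𝔥` and the relations above. -/
def tilde : LieSuperalgebra (TildeSpace τ R) :=
  (freeSuperalgebra τ).quotLie (relIdeal τ R) (isGradedIdeal_relIdeal τ R)
    (fun hx hy => (IsRelator.skew hx hy).mem) (fun hx hy z => (IsRelator.jacobi hx hy z).mem)

/-- The images of the generators in `𝔤̃(A, τ)`. -/
def tildeGen (x : Gen I H) : TildeSpace τ R := (relIdeal τ R).mkQ (gen x)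

/-- The map `𝔥 → 𝔤̃(A, τ)`. -/
def tildeCartan : H →ₗ[ℂ] TildeSpace τ R where
  toFun := fun t => tildeGen τ R (Gen.h t)
  map_add' := fun s t => by
    have h := (IsRelator.h_add (τ := τ) (R := R) s t).mem
    rw [← Submodule.Quotient.mk_eq_zero, ← Submodule.mkQ_apply, map_sub, map_add] at h
    exact sub_eq_zero.1 h
  map_smul' := fun c t => by
    have h := (IsRelator.h_smul (τ := τ) (R := R) c t).mem
    rw [← Submodule.Quotient.mk_eq_zero, ← Submodule.mkQ_apply, map_sub, map_smul] at h
    exact sub_eq_zero.1 h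

theorem tildeGen_mem (x : Gen I H) : tildeGen τ R x ∈ (tilde τ R).part (genParity τ x) :=
  ⟨gen x, Finsupp.single_mem_supported ℂ _ rfl, rfl⟩

theorem tilde_hh (s t : H) :
    (tilde τ R).mul (tildeCartan τ R s) (tildeCartan τ R t) = 0 := by
  have h := (IsRelator.hh (τ := τ) (R := R) s t).mem
  rw [← Submodule.Quotient.mk_eq_zero, ← Submodule.mkQ_apply] at h
  exact h

theorem tilde_he (t : H) (i : I) : (tilde τ R).mul (tildeCartan τ R t) (tildeGen τ R (Gen.e i)) =
    R.root i t • tildeGen τ R (Gen.e i) := by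
  have h := (IsRelator.he (τ := τ) (R := R) t i).mem
  rw [← Submodule.Quotient.mk_eq_zero, ← Submodule.mkQ_apply, map_sub, map_smul] at h
  exact sub_eq_zero.1 h

theorem tilde_hf (t : H) (i : I) : (tilde τ R).mul (tildeCartan τ R t) (tildeGen τ R (Gen.f i)) =
    -(R.root i t • tildeGen τ R (Gen.f i)) := by
  have h := (IsRelator.hf (τ := τ) (R := R) t i).mem
  rw [← Submodule.Quotient.mk_eq_zero, ← Submodule.mkQ_apply, map_add, map_smul] at h
  exact eq_neg_of_add_eq_zero_left h

theorem tilde_ef (i j : I) : (tilde τ R).mul (tildeGen τ R (Gen.e i)) (tildeGen τ R (Gen.f j)) ∈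
    LinearMap.range (tildeCartan τ R) := by
  by_cases hij : i = j
  · subst hij
    have h := (IsRelator.ef (τ := τ) (R := R) i).mem
    rw [← Submodule.Quotient.mk_eq_zero, ← Submodule.mkQ_apply, map_sub] at h
    exact ⟨R.coroot i, (sub_eq_zero.1 h).symm⟩
  · have h := (IsRelator.ef_ne (τ := τ) (R := R) i j hij).mem
    rw [← Submodule.Quotient.mk_eq_zero, ← Submodule.mkQ_apply] at h
    exact ⟨0, (map_zero _).trans h.symm⟩

end Tilde

/-- In a Lie superalgebra, let `c : H → V` have even commuting values, let `f_j` be weight vectors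
with weights satisfying an additive condition `P`, and let `g` be homogeneous with
`[g, f_j] ∈ c(H)`. Then the subalgebra `𝔫` generated by the `f_j` is spanned by homogeneous weight
vectors `y` with weights satisfying `P` and with `[g, y] ∈ 𝔫 + c(H)`. -/
theorem generated_le_span_weight {I H : Type*} [Fintype I] [AddCommGroup H] [Module ℂ H]
    {V : Type*} [AddCommGroup V] [Module ℂ V] (L : LieSuperalgebra V) (c : H →ₗ[ℂ] V)
    (root : I → Module.Dual ℂ H) (hc : ∀ t, c t ∈ L.part 0) (f : I → V)
    (P : (I → ℤ) → Prop) (hP : ∀ γ δ, P γ → P δ → P (γ + δ))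
    (hf : ∀ j, (∃ p, f j ∈ L.part p) ∧
      ∃ γ, P γ ∧ ∀ t, L.mul (c t) (f j) = wt root γ t • f j)
    (G : Set V) (hG : ∀ g ∈ G, ∃ p, g ∈ L.part p)
    (hGf : ∀ g ∈ G, ∀ j, L.mul g (f j) ∈ LinearMap.range c) :
    L.generated (Set.range f) ≤ Submodule.span ℂ {y | y ∈ L.generated (Set.range f) ∧
      (∃ p, y ∈ L.part p) ∧ (∃ γ, P γ ∧ ∀ t, L.mul (c t) y = wt root γ t • y) ∧
      ∀ g ∈ G, L.mul g y ∈ L.generated (Set.range f) ⊔ LinearMap.range c} := by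
  refine L.generated_le_span ?_ ?_
  · rintro _ ⟨j, rfl⟩
    exact ⟨L.subset_generated _ ⟨j, rfl⟩, (hf j).1, (hf j).2, fun g hg =>
      Submodule.mem_sup_right (hGf g hg j)⟩
  · rintro x ⟨hx, ⟨p, hp⟩, ⟨γ, hγ, hxγ⟩, hxg⟩ y ⟨hy, ⟨p', hp'⟩, ⟨δ, hδ, hyδ⟩, hyg⟩
    refine ⟨L.mul_mem_generated _ hx hy, ⟨_, L.mul_mem hp hp'⟩, ⟨γ + δ, hP _ _ hγ hδ, ?_⟩, ?_⟩
    · intro t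
      rw [L.jacobi (hc t) hp, hxγ t, hyδ t, wt_add]
      simp [sgn, add_smul]
    · intro g hg
      obtain ⟨r, hr⟩ := hG g hg
      rw [L.jacobi hr hp]
      refine Submodule.mem_sup_left (add_mem ?_ (Submodule.smul_mem _ _ ?_))
      · obtain ⟨a, ha, _, ⟨t, rfl⟩, hat⟩ := Submodule.mem_sup.1 (hxg g hg)
        rw [← hat, map_add, LinearMap.add_apply, hyδ t]
        exact add_mem (L.mul_mem_generated _ ha hy) (Submodule.smul_mem _ _ hy)
      · obtain ⟨a, ha, _, ⟨t, rfl⟩, hat⟩ := Submodule.mem_sup.1 (hyg g hg)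
        rw [← hat, map_add, L.skew hp (hc t), hxγ t]
        exact add_mem (L.mul_mem_generated _ hx ha)
          (neg_mem (Submodule.smul_mem _ _ (Submodule.smul_mem _ _ hx)))

section KacMoody

variable {I H : Type*} [Fintype I] [AddCommGroup H] [Module ℂ H]
  {A : Matrix I I ℂ} (τ : I → ZMod 2) (R : Realization A H)

/-- The subalgebra of `𝔤̃(A, τ)` generated by the `e_i`. -/
def tildePos : Submodule ℂ (TildeSpace τ R) :=
  (tilde τ R).generated (Set.range fun i => tildeGen τ R (Gen.e i))

/-- The subalgebra of `𝔤̃(A, τ)` generated by the `f_i`. -/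
def tildeNeg : Submodule ℂ (TildeSpace τ R) :=
  (tilde τ R).generated (Set.range fun i => tildeGen τ R (Gen.f i))

theorem wt_single [DecidableEq I] (root : I → Module.Dual ℂ H) (i : I) (c : ℤ) :
    wt root (Pi.single i c) = (c : ℂ) • root i := by
  rw [wt, Finset.sum_eq_single i]
  · simp
  · intro j _ hj
    simp [Pi.single_eq_of_ne hj]
  · simp

theorem tildePos_le : tildePos τ R ≤ Submodule.span ℂ {y | y ∈ tildePos τ R ∧
    (∃ p, y ∈ (tilde τ R).part p) ∧ (∃ γ : I → ℤ, 0 ≤ γ ∧ ∀ t,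
      (tilde τ R).mul (tildeCartan τ R t) y = wt R.root γ t • y) ∧
    ∀ g ∈ Set.range fun i => tildeGen τ R (Gen.f i),
      (tilde τ R).mul g y ∈ tildePos τ R ⊔ LinearMap.range (tildeCartan τ R)} := by
  classical
  refine generated_le_span_weight (tilde τ R) (tildeCartan τ R) R.root
    (fun t => tildeGen_mem τ R (Gen.h t)) _ (fun γ => 0 ≤ γ) (fun _ _ => add_nonneg) ?_ _ ?_ ?_
  · intro j
    refine ⟨⟨_, tildeGen_mem τ R _⟩, Pi.single j 1, Pi.single_nonneg.2 zero_le_one, fun t => ?_⟩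
    rw [tilde_he, wt_single]
    simp
  · rintro _ ⟨i, rfl⟩
    exact ⟨_, tildeGen_mem τ R _⟩
  · rintro _ ⟨i, rfl⟩ j
    rw [(tilde τ R).skew (tildeGen_mem τ R _) (tildeGen_mem τ R _)]
    exact neg_mem (Submodule.smul_mem _ _ (tilde_ef τ R j i))

theorem tildeNeg_le : tildeNeg τ R ≤ Submodule.span ℂ {y | y ∈ tildeNeg τ R ∧
    (∃ p, y ∈ (tilde τ R).part p) ∧ (∃ γ : I → ℤ, γ ≤ 0 ∧ ∀ t,
      (tilde τ R).mul (tildeCartan τ R t) y = wt R.root γ t • y) ∧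
    ∀ g ∈ Set.range fun i => tildeGen τ R (Gen.e i),
      (tilde τ R).mul g y ∈ tildeNeg τ R ⊔ LinearMap.range (tildeCartan τ R)} := by
  classical
  refine generated_le_span_weight (tilde τ R) (tildeCartan τ R) R.root
    (fun t => tildeGen_mem τ R (Gen.h t)) _ (fun γ => γ ≤ 0) (fun _ _ => add_nonpos) ?_ _ ?_ ?_
  · intro j
    refine ⟨⟨_, tildeGen_mem τ R _⟩, Pi.single j (-1), ?_, fun t => ?_⟩
    · rw [Pi.single_neg, neg_nonpos]
      exact Pi.single_nonneg.2 zero_le_one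
    · rw [tilde_hf, wt_single]
      simp
  · rintro _ ⟨i, rfl⟩
    exact ⟨_, tildeGen_mem τ R _⟩
  · rintro _ ⟨i, rfl⟩ j
    exact tilde_ef τ R i j

/-- The sum `𝔫̃⁻ + 𝔥 + 𝔫̃⁺`. -/
def tildeSum : Submodule ℂ (TildeSpace τ R) :=
  tildeNeg τ R ⊔ LinearMap.range (tildeCartan τ R) ⊔ tildePos τ R

theorem gen_mul_mem_tildeSum (g : Gen I H) {x : TildeSpace τ R} (hx : x ∈ tildeSum τ R) :
    (tilde τ R).mul (tildeGen τ R g) x ∈ tildeSum τ R := by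
  have hN : tildeNeg τ R ⊔ LinearMap.range (tildeCartan τ R) ≤ tildeSum τ R := le_sup_left
  have hP : tildePos τ R ⊔ LinearMap.range (tildeCartan τ R) ≤ tildeSum τ R :=
    sup_le le_sup_right (le_sup_right.trans hN)
  have hle : tildeSum τ R ≤ (tildeSum τ R).comap ((tilde τ R).mul (tildeGen τ R g)) := by
    refine sup_le (sup_le ?_ ?_) ?_
    · cases g with
      | e i =>
        refine (tildeNeg_le τ R).trans (Submodule.span_le.2 ?_)
        rintro y ⟨-, -, -, hy⟩
        exact hN (hy _ ⟨i, rfl⟩)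
      | f i =>
        intro y hy
        exact hN (Submodule.mem_sup_left ((tilde τ R).mul_mem_generated _
          ((tilde τ R).subset_generated _ ⟨i, rfl⟩) hy))
      | h t =>
        refine (tildeNeg_le τ R).trans (Submodule.span_le.2 ?_)
        rintro y ⟨hy, -, ⟨γ, -, hγ⟩, -⟩
        have : (tilde τ R).mul (tildeCartan τ R t) y ∈ tildeSum τ R := by
          rw [hγ t]
          exact hN (Submodule.mem_sup_left (Submodule.smul_mem _ _ hy))
        exact this
    · rintro _ ⟨s, rfl⟩
      have hs : tildeCartan τ R s ∈ (tilde τ R).part 0 := tildeGen_mem τ R (Gen.h s)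
      rw [Submodule.mem_comap, (tilde τ R).skew (tildeGen_mem τ R _) hs]
      refine neg_mem (Submodule.smul_mem _ _ ?_)
      cases g with
      | e i =>
        rw [tilde_he]
        exact hP (Submodule.mem_sup_left (Submodule.smul_mem _ _
          ((tilde τ R).subset_generated _ ⟨i, rfl⟩)))
      | f i =>
        rw [tilde_hf]
        exact hN (Submodule.mem_sup_left (neg_mem (Submodule.smul_mem _ _
          ((tilde τ R).subset_generated _ ⟨i, rfl⟩))))
      | h t =>
        have : (tilde τ R).mul (tildeCartan τ R s) (tildeCartan τ R t) ∈ tildeSum τ R := by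
          rw [tilde_hh]
          exact zero_mem _
        exact this
    · cases g with
      | f i =>
        refine (tildePos_le τ R).trans (Submodule.span_le.2 ?_)
        rintro y ⟨-, -, -, hy⟩
        exact hP (hy _ ⟨i, rfl⟩)
      | e i =>
        intro y hy
        exact hP (Submodule.mem_sup_left ((tilde τ R).mul_mem_generated _
          ((tilde τ R).subset_generated _ ⟨i, rfl⟩) hy))
      | h t =>
        refine (tildePos_le τ R).trans (Submodule.span_le.2 ?_)
        rintro y ⟨hy, -, ⟨γ, -, hγ⟩, -⟩
        have : (tilde τ R).mul (tildeCartan τ R t) y ∈ tildeSum τ R := by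
          rw [hγ t]
          exact hP (Submodule.mem_sup_left (Submodule.smul_mem _ _ hy))
        exact this
  exact hle hx

theorem tildeSum_eq_top : tildeSum τ R = ⊤ := by
  let m : FreeMagma (Gen I H) → TildeSpace τ R := fun w =>
    (relIdeal τ R).mkQ (Finsupp.single w 1)
  have hm : ∀ a b, m (a * b) = (tilde τ R).mul (m a) (m b) := by
    intro a b
    have : (relIdeal τ R).mkQ (freeMul _ (Finsupp.single a 1) (Finsupp.single b 1)) =
      (tilde τ R).mul (m a) (m b) := rfl
    rw [← this, freeMul_single, mul_one]
  have hpar : ∀ w, m w ∈ (tilde τ R).part (wordParity τ w) := fun w =>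
    ⟨_, Finsupp.single_mem_supported ℂ _ rfl, rfl⟩
  have key : ∀ w, m w ∈ tildeSum τ R ∧
      ∀ x ∈ tildeSum τ R, (tilde τ R).mul (m w) x ∈ tildeSum τ R := by
    intro w
    induction w with
    | ih1 g =>
      refine ⟨?_, fun x hx => gen_mul_mem_tildeSum τ R g hx⟩
      change tildeGen τ R g ∈ _
      cases g with
      | e i => exact Submodule.mem_sup_right ((tilde τ R).subset_generated _ ⟨i, rfl⟩)
      | f i => exact Submodule.mem_sup_left (Submodule.mem_sup_left
          ((tilde τ R).subset_generated _ ⟨i, rfl⟩))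
      | h t => exact Submodule.mem_sup_left (Submodule.mem_sup_right ⟨t, rfl⟩)
    | ih2 a b ha hb =>
      rw [hm]
      refine ⟨ha.2 _ hb.1, fun x hx => ?_⟩
      have hj := (tilde τ R).jacobi (hpar a) (hpar b) x
      rw [eq_comm, ← eq_sub_iff_add_eq] at hj
      rw [hj]
      exact sub_mem (ha.2 _ (hb.2 x hx)) (Submodule.smul_mem _ _ (hb.2 _ (ha.2 x hx)))
  rw [eq_top_iff]
  rintro x -
  obtain ⟨x, rfl⟩ := (relIdeal τ R).mkQ_surjective x
  induction x using Finsupp.induction_linear with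
  | zero => rw [map_zero]; exact zero_mem _
  | add a b ha hb => rw [map_add]; exact add_mem ha hb
  | single w c =>
    have : (Finsupp.single w c : FreeMagma (Gen I H) →₀ ℂ) = c • Finsupp.single w 1 := by simp
    rw [this, map_smul]
    exact Submodule.smul_mem _ _ (key w).1

/-- The triangular data of `𝔤̃(A, τ)`. -/
def tildeData : TriangularData I H (tilde τ R) where
  cartan := tildeCartan τ R
  root := R.root
  nPos := tildePos τ R
  cartan_even := fun t => tildeGen_mem τ R (Gen.h t)
  cartan_comm := tilde_hh τ R
  root_indep := R.root_indep
  nPos_le := by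
    refine (tildePos_le τ R).trans (Submodule.span_mono ?_)
    rintro y ⟨h1, h2, ⟨γ, -, hγ⟩, -⟩
    exact ⟨h1, h2, γ, hγ⟩
  top_le := by
    rw [← tildeSum_eq_top τ R]
    refine sup_le (sup_le ?_ ?_) ?_
    · refine (tildeNeg_le τ R).trans (Submodule.span_mono ?_)
      rintro y ⟨-, h2, ⟨γ, h0, hγ⟩, -⟩
      exact ⟨h2, γ, hγ, Or.inr h0⟩
    · rintro _ ⟨s, rfl⟩
      refine Submodule.subset_span ⟨⟨_, tildeGen_mem τ R (Gen.h s)⟩, 0, fun t => ?_, Or.inr le_rfl⟩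
      rw [tilde_hh, wt_zero, LinearMap.zero_apply, zero_smul]
    · refine (tildePos_le τ R).trans (Submodule.span_mono ?_)
      rintro y ⟨h1, h2, ⟨γ, -, hγ⟩, -⟩
      exact ⟨h2, γ, hγ, Or.inl h1⟩

/-- The sum of all graded ideals of `𝔤̃(A, τ)` that intersect `𝔥` trivially (it is the maximal
ideal with this property). -/
def maxIdeal : Submodule ℂ (TildeSpace τ R) :=
  sSup {N | (tilde τ R).IsGradedIdeal N ∧ Disjoint N (LinearMap.range (tildeCartan τ R))}

theorem isGradedIdeal_maxIdeal : (tilde τ R).IsGradedIdeal (maxIdeal τ R) :=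
  Superalgebra.isGradedIdeal_sSup _ _ fun _ hN => hN.1

/-- The underlying vector space of `𝔤(A, τ)`. -/
abbrev KMSpace : Type _ := TildeSpace τ R ⧸ maxIdeal τ R

/-- The contragredient (Kac-Moody) Lie superalgebra `𝔤(A, τ)`: the quotient of `𝔤̃(A, τ)` by the
maximal ideal that intersects `𝔥` trivially. -/
def km : LieSuperalgebra (KMSpace τ R) :=
  (tilde τ R).quotient _ (isGradedIdeal_maxIdeal τ R)

/-- The standard triangular data of `𝔤(A, τ)`: `𝔫⁺` is generated by the `e_i`. -/
def kmData : TriangularData I H (km τ R) :=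
  (tildeData τ R).quotient _ (isGradedIdeal_maxIdeal τ R)

end KacMoody

end Contragredient

end SuperLie

end

/-! Take a homogeneous basis of 𝔤 consisting of weight vectors, ordered so that the letters from 𝔫⁺
come last. By the Poincaré–Birkhoff–Witt theorem the ordered monomials form a basis of U(𝔤), and in
this basis J(ν) is spanned by the monomials whose 𝔫⁺-part has weight at least ν (`mem_J_iff`). The
J(ν) therefore intersect in zero, which is the injectivity of U(𝔤) → Û, and an element of Û can be
thought of as an infinite sum of ordered monomials with finitely many terms outside each J(ν).

The heart of the matter is that a homogeneous supercentral z in Û has bounded degree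
(`length_le_or_succ_le_ph`). Let d bound the degrees of the terms outside J(1,…,1), and call the
height of the 𝔫⁺-part of a monomial simply its height. Suppose that the terms of height less than n
have degree at most d, but that some term of height n has larger degree. Supercommuting with a
vector f of weight opposite to that of a letter e from 𝔫⁺, with [e, f] ≠ 0, replaces e by an even
letter i of weight zero: the degree is kept and the height drops below n. If the monomial, e and i
are chosen extremally, no other term produces the same monomial (`replace_unique`), so the
supercommutator has a nonzero coefficient there, which is absurd. The computation is carried out on
elements u of U(𝔤) that approximate z modulo J(ν) and have supercommutators in J(ν)
(`exists_approx`).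

Since 𝔤 is finite-dimensional, monomials of degree at most d have bounded 𝔫⁺-weight. The truncations
of the approximations to degree at most d thus become constant, and z lies in U(𝔤)
(`exists_eq_toHat`). The centres are then compared by injectivity in one direction and by continuity
in the other (`superCentrePart_hatPart`).

What 𝔤 has to provide is a `Frame`: for every basis vector e of 𝔫⁺ a dual vector f with [e, f] ≠ 0
and with [e', f] odd for the other basis vectors e' of the same weight. In the Q-types, opposite
matrix units do this: a root space has one even and one odd basis vector, so e' and f have different
parities. For 𝔤(A, τ) dual bases for a nondegenerate even invariant form do it, and then even [e',
f] = 0 (`exists_pairing`). The form extends a nondegenerate form on 𝔥 that exists because A is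
symmetrizable (`Realization.exists_form`, `Chevalley.exists_form`). Its kernel is an ideal meeting 𝔥
trivially, hence zero. That 𝔥 embeds in 𝔤̃(A, τ), and then in 𝔤(A, τ), is seen on Verma modules. -/

noncomputable section

namespace SuperLie

/-! ### The Poincaré–Birkhoff–Witt theorem for Lie superalgebras -/

namespace PBW

open Module Finsupp

section Lists

variable {ι : Type*} [LinearOrder ι] (par : ι → ZMod 2)

/-- The relation between consecutive letters of an ordered monomial: even letters may be
repeated, odd ones may not. -/
def Rel (i j : ι) : Prop := i < j ∨ (i = j ∧ par i = 0)

instance : DecidableRel (Rel par) := fun _ _ => inferInstanceAs (Decidable (_ ∨ _))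

/-- The ordered monomials. -/
def Valid (l : List ι) : Prop := l.Pairwise (Rel par)

instance : DecidablePred (Valid par) := fun l => inferInstanceAs (Decidable (l.Pairwise _))

variable {par}

theorem Rel.trans {i j k : ι} (h : Rel par i j) (h' : Rel par j k) : Rel par i k := by
  rcases h with h | ⟨rfl, h⟩
  · rcases h' with h' | ⟨rfl, -⟩
    · exact Or.inl (h.trans h')
    · exact Or.inl h
  · exact h'

theorem Rel.le {i j : ι} (h : Rel par i j) : i ≤ j := by
  rcases h with h | ⟨rfl, -⟩
  · exact h.le
  · exact le_rfl

/-- `Rel` is transitive, so only neighbouring letters have to be compared. -/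
theorem valid_cons_cons {i j : ι} {M : List ι} :
    Valid par (i :: j :: M) ↔ Rel par i j ∧ Valid par (j :: M) := by
  constructor
  · intro h
    rw [Valid, List.pairwise_cons] at h
    exact ⟨h.1 j (by simp), h.2⟩
  · rintro ⟨h, h'⟩
    refine List.pairwise_cons.2 ⟨fun k hk => ?_, h'⟩
    rcases List.mem_cons.1 hk with rfl | hk
    · exact h
    · exact h.trans ((List.pairwise_cons.1 h').1 k hk)

theorem Valid.tail {j : ι} {M : List ι} (h : Valid par (j :: M)) : Valid par M :=
  (List.pairwise_cons.1 h).2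

/-- Used after a larger letter `i` has been moved past `j` into the tail `M`: the resulting ordered
words are permutations of `i :: M`, so `j` may still be put in front. -/
theorem Valid.cons_of_perm {i j : ι} {M l : List ι} (h : Valid par (j :: M)) (hl : Valid par l)
    (hji : j < i) (hp : l.Perm (i :: M)) : Valid par (j :: l) := by
  refine List.pairwise_cons.2 ⟨fun k hk => ?_, hl⟩
  rcases List.mem_cons.1 (hp.mem_iff.1 hk) with rfl | hk
  · exact Or.inl hji
  · exact (List.pairwise_cons.1 h).1 k hk

end Lists

section Linear

variable {X Y : Type*}

theorem linearCombination_mem {M : Type*} [AddCommGroup M] [Module ℂ M] {g : X → M} {s : Set X}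
    {p : Submodule ℂ M} (h : ∀ x ∈ s, g x ∈ p) {v : X →₀ ℂ} (hv : v ∈ supported ℂ ℂ s) :
    linearCombination ℂ g v ∈ p := by
  rw [linearCombination_apply]
  exact Submodule.sum_mem _ fun x hx => Submodule.smul_mem _ _ (h x (hv hx))

theorem linearCombination_congr_on {M : Type*} [AddCommGroup M] [Module ℂ M] {g g' : X → M}
    {s : Set X} (h : ∀ x ∈ s, g x = g' x) {v : X →₀ ℂ} (hv : v ∈ supported ℂ ℂ s) :
    linearCombination ℂ g v = linearCombination ℂ g' v := by
  simp only [linearCombination_apply]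
  exact Finsupp.sum_congr fun x hx => by rw [h x (hv hx)]

theorem eqOn_supported {M : Type*} [AddCommGroup M] [Module ℂ M] {f g : (X →₀ ℂ) →ₗ[ℂ] M}
    {s : Set X} (h : ∀ x ∈ s, f (single x 1) = g (single x 1)) {v : X →₀ ℂ}
    (hv : v ∈ supported ℂ ℂ s) : f v = g v := by
  rw [supported_eq_span_single] at hv
  refine LinearMap.eqOn_span ?_ hv
  rintro _ ⟨x, hx, rfl⟩
  exact h x hx

theorem constr_mem {V M : Type*} [AddCommGroup V] [Module ℂ V] [AddCommGroup M] [Module ℂ M]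
    (b : Basis X ℂ V) {g : X → M} {p : Submodule ℂ M} (h : ∀ k, g k ∈ p) (x : V) :
    b.constr ℂ g x ∈ p := by
  rw [Basis.constr_apply]
  exact Submodule.sum_mem _ fun k _ => Submodule.smul_mem _ _ (h k)

end Linear

section Monomials

variable {V : Type*} [AddCommGroup V] [Module ℂ V] {L : LieSuperalgebra V} {ι : Type*}
  {b : Basis ι ℂ V} {par : ι → ZMod 2}

/-- The basis vectors of each parity span a subspace of the corresponding component; the two
subspaces add up to everything and the components are independent. -/
theorem mem_span_of_mem_part (hb : ∀ i, b i ∈ L.part (par i)) {p : ZMod 2} {x : V}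
    (hx : x ∈ L.part p) : x ∈ Submodule.span ℂ (b '' {i | par i = p}) := by
  have hle : ∀ q, Submodule.span ℂ (b '' {i | par i = q}) ≤ L.part q := fun q =>
    Submodule.span_le.2 (by rintro _ ⟨i, rfl, rfl⟩; exact hb i)
  have htop : x ∈ Submodule.span ℂ (b '' {i | par i = p}) ⊔
      Submodule.span ℂ (b '' {i | par i = p + 1}) := by
    rw [← Submodule.span_union, ← Set.image_union]
    have : {i | par i = p} ∪ {i | par i = p + 1} = Set.univ := by
      ext i
      simp only [Set.mem_union, Set.mem_ofPred_eq, Set.mem_univ, iff_true]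
      generalize par i = q
      clear hx
      revert p q
      decide
    rw [this, Set.image_univ, b.span_eq]
    trivial
  obtain ⟨y, hy, z, hz, rfl⟩ := Submodule.mem_sup.1 htop
  have hz' : z ∈ L.part p := by simpa using sub_mem hx (hle p hy)
  have hz0 : z = 0 := by
    rcases zmod_two_cases p with rfl | rfl
    · exact Submodule.disjoint_def.1 L.isCompl.disjoint z hz' (hle _ hz)
    · exact Submodule.disjoint_def.1 L.isCompl.disjoint z (hle _ hz) hz'
  rwa [hz0, add_zero]

variable (L b) in
/-- The product of the letters of a word in `U(𝔤)`. -/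
def mon (l : List ι) : Env L := (l.map fun i => Env.ι L (b i)).prod

@[simp]
theorem mon_nil : mon L b [] = 1 := rfl

@[simp]
theorem mon_cons (i : ι) (l : List ι) : mon L b (i :: l) = Env.ι L (b i) * mon L b l := by
  simp [mon]

theorem mon_append (l l' : List ι) : mon L b (l ++ l') = mon L b l * mon L b l' := by
  simp [mon]

end Monomials

/-! ### The action of 𝔤 on the span of the ordered monomials -/

section Action

variable {V : Type*} [AddCommGroup V] [Module ℂ V] (L : LieSuperalgebra V)
  {ι : Type*} [LinearOrder ι] (b : Basis ι ℂ V) (par : ι → ZMod 2)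

/-- Prefixing a letter. -/
def consMap (j : ι) : (List ι →₀ ℂ) →ₗ[ℂ] (List ι →₀ ℂ) := lmapDomain ℂ ℂ (List.cons j)

/-- The leading term of the action of `x_i` on an ordered monomial. -/
def top (i : ι) : List ι → (List ι →₀ ℂ)
  | [] => single [i] 1
  | j :: M => if Rel par i j then single (i :: j :: M) 1 else if i = j then 0 else
      sgn (par i) (par j) • consMap j (top i M)

/-- The terms of lower degree of the action of `x_i` on an ordered monomial of length at
most `n`. -/
def rem : ℕ → ι → List ι → (List ι →₀ ℂ)
  | 0, _, _ => 0
  | _ + 1, _, [] => 0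
  | n + 1, i, j :: M =>
    -- An odd letter squares to half its bracket; a letter out of order is exchanged by `x_i x_j = ±
    -- x_j x_i + [x_i, x_j]`. The number `n` is fuel: `x_j` has to act on the words in `rem n i M`,
    -- which are no longer than `M` but are not subterms of `j :: M`.
    if Rel par i j then 0 else if i = j then
      (1 / 2 : ℂ) • b.constr ℂ (fun k => top par k M + rem n k M) (L.mul (b i) (b i))
    else sgn (par i) (par j) •
        linearCombination ℂ (fun N => top par j N + rem n j N) (rem n i M) +
      b.constr ℂ (fun k => top par k M + rem n k M) (L.mul (b i) (b j))

/-- The span of the ordered monomials of length at most `m`. -/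
def lenLE (m : ℕ) : Submodule ℂ (List ι →₀ ℂ) :=
  supported ℂ ℂ {l | Valid par l ∧ l.length ≤ m}

variable {par}

theorem lenLE_mono {m n : ℕ} (h : m ≤ n) : lenLE par m ≤ lenLE par n :=
  supported_mono fun _ hl => ⟨hl.1, hl.2.trans h⟩

theorem single_mem_lenLE {m : ℕ} {l : List ι} (h : Valid par l) (h' : l.length ≤ m) :
    single l 1 ∈ lenLE par m := single_mem_supported ℂ _ ⟨h, h'⟩

/-- The leading term only moves the new letter to the right. Knowing the multiset of letters, and
not just the length, is what later allows a smaller letter to be prefixed. -/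
theorem top_mem (i : ι) {M : List ι} (hM : Valid par M) :
    top par i M ∈ supported ℂ ℂ {l | Valid par l ∧ l.Perm (i :: M)} := by
  induction M with
  | nil => exact single_mem_supported ℂ _ ⟨List.pairwise_singleton _ _, List.Perm.refl _⟩
  | cons j M ih =>
    rw [top]
    split_ifs with h1 h2
    · exact single_mem_supported ℂ _ ⟨valid_cons_cons.2 ⟨h1, hM⟩, List.Perm.refl _⟩
    · exact zero_mem _
    · refine Submodule.smul_mem _ _ ?_
      have h := linearCombination_mem (s := {l | Valid par l ∧ l.Perm (i :: M)})
        (g := fun l => single (j :: l) (1 : ℂ))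
        (p := supported ℂ ℂ {l | Valid par l ∧ l.Perm (i :: j :: M)}) ?_ (ih hM.tail)
      · have e : consMap j = linearCombination ℂ fun l => single (j :: l) (1 : ℂ) :=
          Finsupp.lhom_ext fun l c => by simp [consMap]
        rw [e]
        exact h
      · rintro l ⟨hl, hp⟩
        have hji : j < i := by
          rcases lt_trichotomy i j with h | h | h
          · exact absurd (Or.inl h) h1
          · exact absurd h h2
          · exact h
        exact single_mem_supported ℂ _ ⟨hM.cons_of_perm hl hji hp,
          (hp.cons j).trans (List.Perm.swap i j M)⟩

theorem top_mem_lenLE (i : ι) {M : List ι} (hM : Valid par M) {m : ℕ} (h : M.length ≤ m) :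
    top par i M ∈ lenLE par (m + 1) := by
  refine supported_mono ?_ (top_mem i hM)
  rintro l ⟨hl, hp⟩
  exact ⟨hl, by rw [hp.length_eq]; simpa using h⟩

theorem rem_mem (n : ℕ) : ∀ (i : ι) {M : List ι}, Valid par M → ∀ {m : ℕ}, M.length ≤ m →
    rem L b par n i M ∈ lenLE par m := by
  induction n with
  | zero => intro i M _ m _; exact zero_mem _
  | succ n ih =>
    intro i M hM m hm
    cases M with
    | nil => exact zero_mem _
    | cons j M =>
      obtain ⟨m, rfl⟩ : ∃ m', m = m' + 1 := ⟨m - 1, by simp at hm; omega⟩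
      have hm' : M.length ≤ m := by simpa using hm
      have hk : ∀ (k : ι) {N : List ι}, Valid par N → N.length ≤ m →
          top par k N + rem L b par n k N ∈ lenLE par (m + 1) := fun k N hN hl =>
        add_mem (top_mem_lenLE k hN hl) (lenLE_mono (Nat.le_succ m) (ih k hN hl))
      rw [rem]
      split_ifs
      · exact zero_mem _
      · exact Submodule.smul_mem _ _ (constr_mem b (fun k => hk k hM.tail hm') _)
      · exact add_mem (Submodule.smul_mem _ _ (linearCombination_mem
          (fun N hN => hk j hN.1 hN.2) (ih i hM.tail hm')))
          (constr_mem b (fun k => hk k hM.tail hm') _)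

/-- The recursion calls itself on words no longer than the tail, so fuel beyond the length of the
word has no effect. -/
theorem rem_succ (n : ℕ) : ∀ (i : ι) {M : List ι}, Valid par M → M.length ≤ n →
    rem L b par (n + 1) i M = rem L b par n i M := by
  induction n with
  | zero =>
    intro i M _ h
    obtain rfl : M = [] := List.length_eq_zero_iff.1 (by omega)
    rfl
  | succ n ih =>
    intro i M hM h
    cases M with
    | nil => rfl
    | cons j M =>
      have h' : M.length ≤ n := by simpa using h
      have e1 : (fun k => top par k M + rem L b par (n + 1) k M) =
          fun k => top par k M + rem L b par n k M := by
        funext k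
        rw [ih k hM.tail h']
      rw [rem, rem, e1, ih i hM.tail h']
      congr 3
      -- The inner remainders are evaluated only on words occurring in `rem n i M`; by `rem_mem`
      -- these have length at most `n`, so the inductive hypothesis covers them.
      refine congrArg _ (linearCombination_congr_on (fun N hN => ?_) (rem_mem L b n i hM.tail h'))
      rw [ih j hN.1 hN.2]

theorem rem_eq (i : ι) {M : List ι} (hM : Valid par M) {n : ℕ} (h : M.length ≤ n) :
    rem L b par n i M = rem L b par M.length i M := by
  induction n, h using Nat.le_induction with
  | base => rfl
  | succ n h ih => rw [rem_succ L b n i hM h, ih]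

variable (par)

/-- The action of the basis vector `x_i` of `𝔤` on the span of the ordered monomials. -/
def op (i : ι) : (List ι →₀ ℂ) →ₗ[ℂ] (List ι →₀ ℂ) :=
  -- Killing the unordered words makes the operator total on the free module on all words; on these
  -- words every relation holds trivially.
  linearCombination ℂ fun M => if Valid par M then top par i M + rem L b par M.length i M else 0

/-- The action of `𝔤` on the span of the ordered monomials. -/
def opV : V →ₗ[ℂ] Module.End ℂ (List ι →₀ ℂ) := b.constr ℂ (op L b par)

variable {par}

theorem op_single (i : ι) {M : List ι} (hM : Valid par M) :
    op L b par i (single M 1) = top par i M + rem L b par M.length i M := by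
  simp [op, hM]

theorem op_single_of_not (i : ι) {M : List ι} (hM : ¬ Valid par M) :
    op L b par i (single M 1) = 0 := by
  simp [op, hM]

theorem opV_basis (i : ι) : opV L b par (b i) = op L b par i := by
  simp [opV]

theorem opV_single (x : V) {M : List ι} (hM : Valid par M) {n : ℕ} (h : M.length ≤ n) :
    opV L b par x (single M 1) =
      b.constr ℂ (fun k => top par k M + rem L b par n k M) x := by
  have : (LinearMap.applyₗ (single M 1)) ∘ₗ opV L b par =
      b.constr ℂ (fun k => top par k M + rem L b par n k M) := by
    refine b.ext fun k => ?_
    rw [Basis.constr_basis, LinearMap.comp_apply, opV_basis, LinearMap.applyₗ_apply_apply,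
      op_single L b k hM, rem_eq L b k hM h]
  rw [← this]
  rfl

/-- With `op_cons_self` and `op_cons_of_lt` this gives the rewriting rules of the action: prefix the
letter if the result is ordered, halve the bracket for an odd square, and exchange otherwise. -/
theorem op_cons (i : ι) {M : List ι} (hM : Valid par (i :: M)) :
    op L b par i (single M 1) = single (i :: M) 1 := by
  rw [op_single L b i hM.tail]
  cases M with
  | nil => simp [top, rem]
  | cons j M =>
    have := (valid_cons_cons.1 hM).1
    rw [List.length_cons, top, rem, if_pos this, if_pos this, add_zero]

theorem op_cons_self (i : ι) (hi : par i = 1) {M : List ι} (hM : Valid par (i :: M)) :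
    op L b par i (single (i :: M) 1) =
      (1 / 2 : ℂ) • opV L b par (L.mul (b i) (b i)) (single M 1) := by
  have h : ¬ Rel par i i := by
    rintro (h | ⟨-, h⟩)
    · exact lt_irrefl _ h
    · rw [hi] at h; exact absurd h (by decide)
  rw [op_single L b i hM, List.length_cons, top, rem, if_neg h, if_pos rfl, if_neg h, if_pos rfl,
    zero_add, opV_single L b _ hM.tail le_rfl]

theorem op_cons_of_lt {i j : ι} (hji : j < i) {M : List ι} (hM : Valid par (j :: M)) :
    op L b par i (single (j :: M) 1) =
      sgn (par i) (par j) • op L b par j (op L b par i (single M 1)) +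
        opV L b par (L.mul (b i) (b j)) (single M 1) := by
  have h : ¬ Rel par i j := fun h => absurd h.le (not_le.2 hji)
  rw [op_single L b i hM, List.length_cons, top, rem, if_neg h, if_neg hji.ne', if_neg h,
    if_neg hji.ne', opV_single L b _ hM.tail le_rfl, op_single L b i hM.tail, map_add, smul_add,
    add_assoc]
  congr 2
  · refine eqOn_supported (fun l hl => ?_) (top_mem i hM.tail)
    rw [op_cons L b j (hM.cons_of_perm hl.1 hji hl.2)]
    simp [consMap]
  · congr 1
    refine linearCombination_congr_on (fun N hN => ?_) (rem_mem L b _ i hM.tail le_rfl)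
    rw [if_pos hN.1, rem_eq L b j hN.1 hN.2]

/-- The defect of the commutation relation of `x` and `y` in the action. -/
def defect (p p' : ZMod 2) (x y : V) : (List ι →₀ ℂ) →ₗ[ℂ] (List ι →₀ ℂ) :=
  opV L b par x * opV L b par y - sgn p p' • (opV L b par y * opV L b par x) -
    opV L b par (L.mul x y)

theorem sgn_comm (i j : ZMod 2) : sgn i j = sgn j i := by
  simp only [sgn, and_comm]

theorem sgn_mul_self (i j : ZMod 2) : sgn i j * sgn i j = 1 := by
  unfold sgn
  split_ifs <;> norm_num

theorem sgn_eq (i j : ZMod 2) : sgn i j = 1 ∨ sgn i j = -1 := by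
  unfold sgn
  split_ifs <;> simp

theorem sgn_add (i j k : ZMod 2) : sgn (i + j) k = sgn i k * sgn j k := by
  rcases zmod_two_cases i with rfl | rfl <;> rcases zmod_two_cases j with rfl | rfl <;>
    rcases zmod_two_cases k with rfl | rfl <;> simp [sgn, show (1 : ZMod 2) + 1 = 0 from rfl]

theorem defect_symm {p p' : ZMod 2} {x y : V} (hx : x ∈ L.part p) (hy : y ∈ L.part p') :
    defect L b (par := par) p p' x y = -(sgn p p' • defect L b (par := par) p' p y x) := by
  rw [defect, defect, L.skew hx hy, sgn_comm p' p, map_neg, map_smul]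
  rcases sgn_eq p p' with h | h <;> rw [h] <;> module

/-- The super Jacobi identity for the defects. -/
theorem defect_jacobi {p q r : ZMod 2} {x y z : V} (hx : x ∈ L.part p) (hy : y ∈ L.part q)
    (hz : z ∈ L.part r) {v : List ι →₀ ℂ}
    (h1 : defect L b (par := par) p q x y v = 0) (h2 : defect L b (par := par) q r y z v = 0)
    (h3 : defect L b (par := par) r p z x v = 0)
    (h4 : defect L b (par := par) (p + q) r (L.mul x y) z v = 0)
    (h5 : defect L b (par := par) (q + r) p (L.mul y z) x v = 0)
    (h6 : defect L b (par := par) (r + p) q (L.mul z x) y v = 0) :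
    sgn p r • defect L b (par := par) p q x y (opV L b par z v) +
      sgn p q • defect L b (par := par) q r y z (opV L b par x v) +
      sgn q r • defect L b (par := par) r p z x (opV L b par y v) = 0 := by
  have hj : sgn p r • L.mul (L.mul x y) z + sgn p q • L.mul (L.mul y z) x +
      sgn q r • L.mul (L.mul z x) y = 0 := by
    rw [L.skew (L.mul_mem hy hz) hx, L.skew (L.mul_mem hz hx) hy, L.jacobi hx hy z, L.skew hz hx,
      map_neg, map_smul]
    rcases zmod_two_cases p with rfl | rfl <;> rcases zmod_two_cases q with rfl | rfl <;>
      rcases zmod_two_cases r with rfl | rfl <;> simp [sgn]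
  have hj' := congrArg (fun w => opV L b par w v) hj
  simp only [map_add, map_smul, map_zero, LinearMap.add_apply, LinearMap.smul_apply,
    LinearMap.zero_apply] at hj'
  have a1 := congrArg (opV L b par z) h1
  have a2 := congrArg (opV L b par x) h2
  have a3 := congrArg (opV L b par y) h3
  simp only [defect, LinearMap.sub_apply, Module.End.mul_apply, LinearMap.smul_apply, map_sub,
    map_smul, map_zero, sgn_add, sgn_comm r p, sgn_comm r q, sgn_comm q p] at *
  clear h1 h2 h3 hj
  have e1 := sgn_eq p q
  have e2 := sgn_eq q r
  have e3 := sgn_eq p r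
  generalize sgn p q = α at *
  generalize sgn q r = β at *
  generalize sgn p r = γ at *
  -- All signs are functions of the three pairwise ones, each equal to 1 or -1; in each of the eight
  -- cases the claim is a combination of the vanishing defects and the Jacobi identity.
  rcases e1 with rfl | rfl <;> rcases e2 with rfl | rfl <;> rcases e3 with rfl | rfl <;>
    simp only [one_smul, neg_smul, mul_one, mul_neg, neg_neg] at *
  · linear_combination (norm := module) a1 + a2 + a3 - h4 - h5 - h6 - hj'
  · linear_combination (norm := module) a1 - a2 + a3 + h4 - h5 - h6 - hj'
  · linear_combination (norm := module) -a1 + a2 + a3 - h4 - h5 + h6 - hj'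
  · linear_combination (norm := module) -a1 - a2 + a3 + h4 - h5 + h6 - hj'
  · linear_combination (norm := module) a1 + a2 - a3 - h4 + h5 - h6 - hj'
  · linear_combination (norm := module) a1 - a2 - a3 + h4 + h5 - h6 - hj'
  · linear_combination (norm := module) -a1 + a2 - a3 - h4 + h5 + h6 - hj'
  · linear_combination (norm := module) -a1 - a2 - a3 + h4 + h5 + h6 - hj'

theorem sgn_zero_left (i : ZMod 2) : sgn 0 i = 1 := by simp [sgn]

theorem sgn_one_one : sgn 1 1 = -1 := by simp [sgn]

theorem mul_self_of_even {x : V} (hx : x ∈ L.part 0) : L.mul x x = 0 := by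
  have h := L.skew hx hx
  rw [sgn_zero_left, one_smul] at h
  have h2 : (2 : ℂ) • L.mul x x = 0 := by
    rw [two_smul]
    nth_rw 1 [h]
    exact neg_add_cancel _
  exact (smul_eq_zero.1 h2).resolve_left two_ne_zero

variable {L} {b}

/-- Here `x_j M` is just the word `j :: M`, and the rule for `x_i` acting on that word is exactly
the commutation relation. -/
theorem defect_of_valid (hb : ∀ i, b i ∈ L.part (par i)) {i j : ι} (hji : j ≤ i) {M : List ι}
    (hM : Valid par (j :: M)) :
    defect L b (par := par) (par i) (par j) (b i) (b j) (single M 1) = 0 := by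
  rw [defect, opV_basis, opV_basis, LinearMap.sub_apply, LinearMap.sub_apply, LinearMap.smul_apply,
    Module.End.mul_apply, Module.End.mul_apply, op_cons L b j hM]
  rcases hji.lt_or_eq with h | rfl
  · rw [op_cons_of_lt L b h hM]
    abel
  · rcases zmod_two_cases (par j) with h | h
    · have h' := hb j
      rw [h] at h'
      rw [mul_self_of_even L h', h, sgn_zero_left, op_cons L b j hM]
      simp
    · rw [h, sgn_one_one, op_cons L b j hM, op_cons_self L b j h hM]
      module

theorem defect_of_basis (hb : ∀ i, b i ∈ L.part (par i)) {v : List ι →₀ ℂ}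
    (h : ∀ i j, defect L b (par := par) (par i) (par j) (b i) (b j) v = 0) {p q : ZMod 2} {x y : V}
    (hx : x ∈ L.part p) (hy : y ∈ L.part q) : defect L b (par := par) p q x y v = 0 := by
  replace hx := mem_span_of_mem_part hb hx
  replace hy := mem_span_of_mem_part hb hy
  have e : ∀ x y, defect L b (par := par) p q x y v = opV L b par x (opV L b par y v) -
      sgn p q • opV L b par y (opV L b par x v) - opV L b par (L.mul x y) v := fun _ _ => rfl
  induction hx using Submodule.span_induction with
  | zero => simp [e]
  | add x x' _ _ hx hx' =>
    rw [e] at *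
    simp only [map_add, LinearMap.add_apply]
    linear_combination (norm := module) hx + hx'
  | smul c x _ hx =>
    rw [e] at *
    simp only [map_smul, LinearMap.smul_apply]
    linear_combination (norm := module) c • hx
  | mem x hx =>
    obtain ⟨i, rfl, rfl⟩ := hx
    induction hy using Submodule.span_induction with
    | zero => simp [e]
    | add x x' _ _ hx hx' =>
      rw [e] at *
      simp only [map_add, LinearMap.add_apply]
      linear_combination (norm := module) hx + hx'
    | smul c x _ hx =>
      rw [e] at *
      simp only [map_smul, LinearMap.smul_apply]
      linear_combination (norm := module) c • hx
    | mem y hy =>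
      obtain ⟨j, rfl, rfl⟩ := hy
      exact h i j

/-- The core of the PBW theorem, by induction on the length of the word. If prefixing `j` does not
give an ordered word, the first letter `k` of the word is split off and the Jacobi identity for
defects shifts the problem to pairs containing `k`. -/
theorem defect_single (hb : ∀ i, b i ∈ L.part (par i)) (n : ℕ) : ∀ {M : List ι}, Valid par M →
    M.length = n → ∀ i j, defect L b (par := par) (par i) (par j) (b i) (b j) (single M 1) = 0 := by
  induction n using Nat.strong_induction_on with
  | _ n IH =>
  intro M hM hn
  have hle : ∀ i j, j ≤ i →
      defect L b (par := par) (par i) (par j) (b i) (b j) (single M 1) = 0 := by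
    intro i j hji
    cases M with
    | nil => exact defect_of_valid hb hji (List.pairwise_singleton _ _)
    | cons k M =>
      by_cases hv : Valid par (j :: k :: M)
      · exact defect_of_valid hb hji hv
      have hkj : k < j ∨ (k = j ∧ par j = 1) := by
        rcases lt_trichotomy k j with h | h | h
        · exact Or.inl h
        · refine Or.inr ⟨h, (zmod_two_cases (par j)).resolve_left fun h0 => hv ?_⟩
          exact valid_cons_cons.2 ⟨Or.inr ⟨h.symm, h0⟩, hM⟩
        · exact absurd (valid_cons_cons.2 ⟨Or.inl h, hM⟩) hv
      have hshort : ∀ {v : List ι →₀ ℂ}, v ∈ lenLE par M.length → ∀ {p q : ZMod 2} {x y : V},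
          x ∈ L.part p → y ∈ L.part q → defect L b (par := par) p q x y v = 0 := by
        intro v hv p q x y hx hy
        refine defect_of_basis hb (fun i j => ?_) hx hy
        rw [← LinearMap.zero_apply (σ₁₂ := RingHom.id ℂ) v]
        refine eqOn_supported (fun l hl => ?_) hv
        rw [LinearMap.zero_apply]
        exact IH l.length (by rw [← hn]; exact Nat.lt_succ_of_le hl.2) hl.1 rfl i j
      have hMs := single_mem_lenLE hM.tail le_rfl
      -- All six hypotheses concern the tail `M` and hold by induction. The first of the three
      -- remaining terms, evaluated at `x_k M = k :: M`, is the wanted one.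
      have E := defect_jacobi L b (hb i) (hb j) (hb k) (hshort hMs (hb i) (hb j))
        (hshort hMs (hb j) (hb k)) (hshort hMs (hb k) (hb i))
        (hshort hMs (L.mul_mem (hb i) (hb j)) (hb k))
        (hshort hMs (L.mul_mem (hb j) (hb k)) (hb i))
        (hshort hMs (L.mul_mem (hb k) (hb i)) (hb j))
      -- `x_i' M` consists of leading words, which may be prefixed by the smaller letter `k`, and of
      -- words no longer than `M`, to which the inductive hypothesis applies.
      have hop : ∀ i' j', k < i' → k ≤ j' → defect L b (par := par) (par j') (par k) (b j') (b k)
          (opV L b par (b i') (single M 1)) = 0 := by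
        intro i' j' hi' hj'
        rw [opV_basis, op_single L b i' hM.tail, map_add,
          hshort (rem_mem L b _ i' hM.tail le_rfl) (hb j') (hb k), add_zero]
        rw [← LinearMap.zero_apply (σ₁₂ := RingHom.id ℂ) (top par i' M)]
        refine eqOn_supported (fun l hl => ?_) (top_mem i' hM.tail)
        exact defect_of_valid hb hj' (hM.cons_of_perm hl.1 hi' hl.2)
      have hk : opV L b par (b k) (single M 1) = single (k :: M) 1 := by
        rw [opV_basis, op_cons L b k hM]
      rw [hk] at E
      have hs : ∀ p q, sgn p q ≠ 0 := fun p q h => by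
        have := sgn_mul_self p q
        rw [h] at this
        simp at this
      rcases hkj with h | ⟨rfl, h⟩
      · rw [hop i j (h.trans_le hji) h.le, defect_symm L b (hb k) (hb i), LinearMap.neg_apply,
          LinearMap.smul_apply, hop j i h (h.le.trans hji)] at E
        simpa [hs] using E
      · rcases hji.lt_or_eq with h' | rfl
        · rw [hop i k h' le_rfl, defect_symm L b (hb k) (hb i), hk, LinearMap.neg_apply,
            LinearMap.smul_apply, h, sgn_one_one, sgn_comm 1] at E
          rw [h]
          -- When `j = k` the third term is the wanted one again, up to super-skew-symmetry, so the
          -- identity counts it twice.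
          have h2 : (2 * sgn (par i) 1) • defect L b (par := par) (par i) 1 (b i) (b k)
              (single (k :: M) 1) = 0 := by
            linear_combination (norm := module) E
          exact (smul_eq_zero.1 h2).resolve_left (mul_ne_zero two_ne_zero (hs _ _))
        · rw [hk, h, sgn_one_one] at E
          rw [h]
          -- When all three letters coincide, all three terms are equal.
          have h2 : (3 : ℂ) • defect L b (par := par) 1 1 (b k) (b k)
              (single (k :: M) 1) = 0 := by
            linear_combination (norm := module) -E
          exact (smul_eq_zero.1 h2).resolve_left three_ne_zero
  intro i j
  rcases le_total j i with h | h
  · exact hle i j h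
  · rw [defect_symm L b (hb i) (hb j), LinearMap.neg_apply, LinearMap.smul_apply, hle j i h,
      smul_zero, neg_zero]

theorem defect_eq_zero (hb : ∀ i, b i ∈ L.part (par i)) {p q : ZMod 2} {x y : V}
    (hx : x ∈ L.part p) (hy : y ∈ L.part q) : defect L b (par := par) p q x y = 0 := by
  have hinv : ∀ x : V, ∀ M : List ι, ¬ Valid par M → opV L b par x (single M 1) = 0 := by
    intro x M hM
    have : (LinearMap.applyₗ (single M (1 : ℂ))) ∘ₗ opV L b par = 0 := b.ext fun k => by
      simp [opV_basis, op_single_of_not L b k hM]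
    exact LinearMap.congr_fun this x
  refine Finsupp.lhom_ext' fun M => LinearMap.ext_ring ?_
  change defect L b (par := par) p q x y (single M 1) = 0
  by_cases hM : Valid par M
  · exact defect_of_basis hb (fun i j => defect_single hb _ hM rfl i j) hx hy
  · change opV L b par x (opV L b par y (single M 1)) -
      sgn p q • opV L b par y (opV L b par x (single M 1)) - opV L b par (L.mul x y) (single M 1) = 0
    simp [hinv _ M hM]

/-- The action of `U(𝔤)` on the span of the ordered monomials. -/
def rep (hb : ∀ i, b i ∈ L.part (par i)) : Env L →ₐ[ℂ] Module.End ℂ (List ι →₀ ℂ) :=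
  RingQuot.liftAlgHom ℂ ⟨TensorAlgebra.lift ℂ (opV L b par), by
    rintro _ _ ⟨hx, hy⟩
    rename_i p q x y
    refine LinearMap.ext fun v => ?_
    have h : opV L b par x (opV L b par y v) - sgn p q • opV L b par y (opV L b par x v) -
        opV L b par (L.mul x y) v = 0 := LinearMap.congr_fun (defect_eq_zero hb hx hy) v
    simp only [map_mul, map_add, map_smul, TensorAlgebra.lift_ι_apply, Module.End.mul_apply,
      LinearMap.add_apply, LinearMap.smul_apply]
    linear_combination (norm := module) h⟩

theorem rep_ι (hb : ∀ i, b i ∈ L.part (par i)) (x : V) :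
    rep hb (Env.ι L x) = opV L b par x := by
  change RingQuot.liftAlgHom ℂ _ (RingQuot.mkAlgHom ℂ (EnvRel L) (TensorAlgebra.ι ℂ x)) = _
  rw [RingQuot.liftAlgHom_mkAlgHom_apply, TensorAlgebra.lift_ι_apply]

/-- The coordinates of an element of `U(𝔤)` with respect to the ordered monomials. -/
def coord (hb : ∀ i, b i ∈ L.part (par i)) : Env L →ₗ[ℂ] (List ι →₀ ℂ) :=
  LinearMap.applyₗ (single [] 1) ∘ₗ (rep hb).toLinearMap

/-- An ordered monomial applied to the empty word rebuilds its own word letter by letter. This is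
the linear independence half of the PBW theorem. -/
theorem coord_mon (hb : ∀ i, b i ∈ L.part (par i)) {l : List ι} (hl : Valid par l) :
    coord hb (mon L b l) = single l 1 := by
  induction l with
  | nil =>
    change (rep hb 1) (single [] 1) = _
    rw [map_one]
    rfl
  | cons i l ih =>
    change rep hb (mon L b (i :: l)) (single [] 1) = _
    rw [mon_cons, map_mul, rep_ι, opV_basis, Module.End.mul_apply]
    have : rep hb (mon L b l) (single [] 1) = single l 1 := ih hl.tail
    rw [this, op_cons L b i hl]

end Action

end PBW

end SuperLie

end

/-! ### Words in U(𝔤) and the properties preserved by straightening -/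

noncomputable section

namespace SuperLie

namespace PBW

open Module Finsupp

section Words

variable {V : Type*} [AddCommGroup V] [Module ℂ V] {L : LieSuperalgebra V} {ι : Type*}
  {b : Basis ι ℂ V} {par : ι → ZMod 2}

variable (L b) in
/-- Properties of words that are preserved by straightening: exchanging two consecutive letters and
replacing them by a letter that occurs in their bracket. -/
structure Stable (Q : List ι → Prop) : Prop where
  swap : ∀ {a : List ι} {i j : ι} {c : List ι}, Q (a ++ i :: j :: c) → Q (a ++ j :: i :: c)
  bracket : ∀ {a : List ι} {i j k : ι} {c : List ι}, Q (a ++ i :: j :: c) →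
    b.repr (L.mul (b i) (b j)) k ≠ 0 → Q (a ++ k :: c)

theorem Stable.cons {Q : List ι → Prop} (hQ : Stable L b Q) (i : ι) :
    Stable L b fun l => Q (i :: l) where
  swap := fun {a} _ _ _ h => hQ.swap (a := i :: a) h
  bracket := fun {a} _ _ _ _ h h' => hQ.bracket (a := i :: a) h h'

theorem Stable.and {Q Q' : List ι → Prop} (hQ : Stable L b Q) (hQ' : Stable L b Q') :
    Stable L b fun l => Q l ∧ Q' l where
  swap := fun h => ⟨hQ.swap h.1, hQ'.swap h.2⟩
  bracket := fun h h' => ⟨hQ.bracket h.1 h', hQ'.bracket h.2 h'⟩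

theorem stable_length_le (n : ℕ) : Stable L b fun l => l.length ≤ n where
  swap := fun h => by simpa using h
  bracket := fun h _ => by simp at *; omega

/-- Exchanges permute the letters and brackets shorten the word. -/
theorem stable_perm (w : List ι) : Stable L b fun l => l.Perm w ∨ l.length < w.length where
  swap := fun {a i j c} h => h.imp
    (fun h => ((List.Perm.swap i j c).append_left a).trans h) (fun h => by simpa using h)
  bracket := fun h _ => Or.inr (by
    rcases h with h | h
    · rw [← h.length_eq]; simp
    · simp at *; omega)

/-- A grading of the letters for which the bracket is homogeneous induces a stable property of
words. -/
theorem stable_grade {Γ : Type*} [AddCommMonoid Γ] (g : ι → Γ)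
    (hg : ∀ i j k, b.repr (L.mul (b i) (b j)) k ≠ 0 → g k = g i + g j) (γ : Γ) :
    Stable L b fun l => (l.map g).sum = γ where
  swap := fun {a i j c} h => by
    rw [← h]; simp [add_left_comm]
  bracket := fun {a i j k c} h h' => by
    rw [← h]; simp [hg i j k h', add_assoc]

theorem stable_forall (P : ι → Prop)
    (hP : ∀ i j k, P i → P j → b.repr (L.mul (b i) (b j)) k ≠ 0 → P k) :
    Stable L b fun l => ∀ i ∈ l, P i where
  swap := fun {a i j c} h x hx => h x (by
    simp only [List.mem_append, List.mem_cons] at *; tauto)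
  bracket := fun {a i j k c} h h' x hx => by
    simp only [List.mem_append, List.mem_cons] at hx
    rcases hx with hx | rfl | hx
    · exact h x (by simp [hx])
    · exact hP i j x (h i (by simp)) (h j (by simp)) h'
    · exact h x (by simp [hx])

theorem ι_mul_mem {x : V} {u : Env L} {p : Submodule ℂ (Env L)}
    (h : ∀ k, b.repr x k ≠ 0 → Env.ι L (b k) * u ∈ p) : Env.ι L x * u ∈ p := by
  rw [← b.linearCombination_repr x, linearCombination_apply, Finsupp.sum, map_sum,
    Finset.sum_mul]
  refine Submodule.sum_mem _ fun k hk => ?_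
  rw [map_smul, smul_mul_assoc]
  exact Submodule.smul_mem _ _ (h k (Finsupp.mem_support_iff.1 hk))

theorem mon_swap (hb : ∀ i, b i ∈ L.part (par i)) (i j : ι) (l : List ι) :
    mon L b (i :: j :: l) = sgn (par i) (par j) • mon L b (j :: i :: l) +
      Env.ι L (L.mul (b i) (b j)) * mon L b l := by
  simp only [mon_cons, ← mul_assoc]
  rw [Env.ι_mul (hb i) (hb j), add_mul, smul_mul_assoc, add_comm]

theorem span_mon_eq_top : Submodule.span ℂ (Set.range (mon L b)) = ⊤ := by
  rw [eq_top_iff]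
  rintro u -
  have h1 : ∀ u ∈ Submodule.span ℂ (Set.range (mon L b)),
      ∀ v ∈ Submodule.span ℂ (Set.range (mon L b)),
      u * v ∈ Submodule.span ℂ (Set.range (mon L b)) := by
    intro u hu v hv
    have h := Submodule.mul_mem_mul hu hv
    rw [Submodule.span_mul_span] at h
    refine Submodule.span_mono ?_ h
    rintro _ ⟨_, ⟨l, rfl⟩, _, ⟨l', rfl⟩, rfl⟩
    exact ⟨l ++ l', mon_append l l'⟩
  induction u using Env.induction with
  | halg c =>
    rw [Algebra.algebraMap_eq_smul_one]
    exact Submodule.smul_mem _ _ (Submodule.subset_span ⟨[], rfl⟩)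
  | hι x =>
    rw [← mul_one (Env.ι L x)]
    exact ι_mul_mem (b := b) fun k _ => Submodule.subset_span ⟨[k], by simp⟩
  | hmul a b ha hb => exact h1 a ha b hb
  | hadd a b ha hb => exact add_mem ha hb

variable (L b) in
/-- The span of the words of length less than `n`. -/
def lower (n : ℕ) : Submodule ℂ (Env L) := Submodule.span ℂ (mon L b '' {l | l.length < n})

theorem ι_mul_mem_lower (x : V) {n : ℕ} {u : Env L} (hu : u ∈ lower L b n) :
    Env.ι L x * u ∈ lower L b (n + 1) := by
  refine ι_mul_mem (b := b) fun k _ => ?_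
  have : lower L b n ≤ (lower L b (n + 1)).comap (LinearMap.mulLeft ℂ (Env.ι L (b k))) := by
    refine Submodule.span_le.2 ?_
    rintro _ ⟨l, hl, rfl⟩
    exact Submodule.subset_span ⟨k :: l, by simpa using hl, by simp⟩
  exact this hu

theorem ι_mul_mon_mem_lower (x : V) (l : List ι) :
    Env.ι L x * mon L b l ∈ lower L b (l.length + 2) := by
  refine ι_mul_mem (b := b) fun k _ => ?_
  exact Submodule.subset_span ⟨k :: l, by simp, by simp⟩

/-- Each transposition of neighbours costs a sign and a bracket term, which is one letter shorter.
-/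
theorem mon_perm (hb : ∀ i, b i ∈ L.part (par i)) {w w' : List ι} (h : w.Perm w') :
    ∃ ε : ℂ, ε ≠ 0 ∧ mon L b w - ε • mon L b w' ∈ lower L b w.length := by
  induction h with
  | nil => exact ⟨1, one_ne_zero, by simp⟩
  | @cons i l l' _ ih =>
    obtain ⟨ε, hε, h⟩ := ih
    refine ⟨ε, hε, ?_⟩
    have := ι_mul_mem_lower (b i) h
    rwa [mul_sub, mul_smul_comm, ← mon_cons, ← mon_cons] at this
  | swap i j l =>
    refine ⟨sgn (par j) (par i), fun h => ?_, ?_⟩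
    · have := sgn_mul_self (par j) (par i)
      rw [h] at this
      simp at this
    · rw [mon_swap hb, add_sub_cancel_left]
      exact ι_mul_mon_mem_lower _ _
  | @trans l l' l'' h h' ih ih' =>
    obtain ⟨ε, hε, h1⟩ := ih
    obtain ⟨ε', hε', h2⟩ := ih'
    refine ⟨ε * ε', mul_ne_zero hε hε', ?_⟩
    rw [← h.length_eq] at h2
    have := add_mem h1 (Submodule.smul_mem _ ε h2)
    rwa [smul_sub, smul_smul, sub_add_sub_cancel] at this

/-- Even letters commute with all letters up to terms of lower degree. -/
theorem mon_even (hb : ∀ i, b i ∈ L.part (par i)) {i : ι} (hi : par i = 0) (P Q : List ι) :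
    mon L b (P ++ i :: Q) - mon L b (i :: (P ++ Q)) ∈ lower L b (P.length + Q.length + 1) := by
  induction P with
  | nil => simp
  | cons j P ih =>
    have h1 := ι_mul_mem_lower (b j) ih
    rw [mul_sub, ← mon_cons, ← mon_cons, mon_swap hb, hi, sgn_comm, sgn_zero_left, one_smul] at h1
    have h2 := ι_mul_mon_mem_lower (L := L) (b := b) (L.mul (b j) (b i)) (P ++ Q)
    rw [List.length_append] at h2
    have e : (j :: P).length + Q.length + 1 = P.length + Q.length + 1 + 1 := by
      simp only [List.length_cons]; omega
    rw [e]
    have := add_mem h1 h2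
    simpa [sub_add_eq_sub_sub] using this

end Words

/-! ### Straightening and coordinates with respect to the ordered monomials -/

section Straightening

variable {V : Type*} [AddCommGroup V] [Module ℂ V] {L : LieSuperalgebra V} {ι : Type*}
  [LinearOrder ι] {b : Basis ι ℂ V} {par : ι → ZMod 2}

variable (L b par) in
/-- The span of the ordered monomials with a given property. -/
def monSpan (Q : List ι → Prop) : Submodule ℂ (Env L) :=
  Submodule.span ℂ (mon L b '' {l | Valid par l ∧ Q l})

/-- Insertion of one letter into an ordered word: the letter is moved to the right by an inner
induction, and every bracket term is a shorter word, left to the outer hypothesis `IH`. -/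
theorem mon_cons_mem_monSpan (hb : ∀ i, b i ∈ L.part (par i)) {n : ℕ}
    (IH : ∀ {Q : List ι → Prop}, Stable L b Q → ∀ {w : List ι}, w.length ≤ n → Q w →
      mon L b w ∈ monSpan L b par Q) {l : List ι} (hl : l.length ≤ n) (hv : Valid par l) :
    ∀ {i : ι} {Q : List ι → Prop}, Stable L b Q → Q (i :: l) →
      mon L b (i :: l) ∈ monSpan L b par Q := by
  induction l with
  | nil =>
    intro i Q _ h
    exact Submodule.subset_span ⟨_, ⟨List.pairwise_singleton _ _, h⟩, rfl⟩
  | cons j l ih =>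
    intro i Q hQ h
    have hlen : ∀ k, (k :: l).length ≤ n := fun k => by simpa using hl
    by_cases hij : Rel par i j
    · exact Submodule.subset_span ⟨_, ⟨valid_cons_cons.2 ⟨hij, hv⟩, h⟩, rfl⟩
    have hbr : Env.ι L (L.mul (b i) (b j)) * mon L b l ∈ monSpan L b par Q := by
      refine ι_mul_mem (b := b) fun k hk => ?_
      rw [← mon_cons]
      exact IH hQ (hlen k) (hQ.bracket (a := []) h hk)
    rcases lt_trichotomy i j with hlt | rfl | hlt
    · exact absurd (Or.inl hlt) hij
    · have hi : par i = 1 := (zmod_two_cases _).resolve_left fun h0 => hij (Or.inr ⟨rfl, h0⟩)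
      have h1 := mon_swap hb i i l
      rw [hi, sgn_one_one] at h1
      have h2 : mon L b (i :: i :: l) = (1 / 2 : ℂ) • (Env.ι L (L.mul (b i) (b i)) * mon L b l) := by
        linear_combination (norm := module) (1 / 2 : ℂ) • h1
      rw [h2]
      exact Submodule.smul_mem _ _ hbr
    · rw [mon_swap hb]
      refine add_mem (Submodule.smul_mem _ _ ?_) hbr
      -- Carrying `stable_perm` along ensures that each word of the result is either a permutation
      -- of `i :: l`, which accepts the prefix `j`, or shorter, so that `IH` applies after
      -- prefixing.
      have h1 := ih (by simp at hl; omega) hv.tail (i := i)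
        ((hQ.cons j).and (stable_perm (i :: l)))
        ⟨hQ.swap (a := []) h, Or.inl (List.Perm.refl _)⟩
      rw [mon_cons]
      have hle : monSpan L b par (fun l' => Q (j :: l') ∧
          (l'.Perm (i :: l) ∨ l'.length < (i :: l).length)) ≤
          (monSpan L b par Q).comap (LinearMap.mulLeft ℂ (Env.ι L (b j))) := by
        refine Submodule.span_le.2 ?_
        rintro _ ⟨l', ⟨hv', hq, hp⟩, rfl⟩
        change Env.ι L (b j) * mon L b l' ∈ monSpan L b par Q
        rw [← mon_cons]
        rcases hp with hp | hp
        · exact Submodule.subset_span ⟨_, ⟨hv.cons_of_perm hv' hlt hp, hq⟩, rfl⟩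
        · exact IH hQ (by have := hlen i; simp at *; omega) hq
      exact hle h1

/-- Straightening: a word lies in the span of ordered monomials that share its stable properties. -/
theorem mon_mem_monSpan (hb : ∀ i, b i ∈ L.part (par i)) {Q : List ι → Prop} (hQ : Stable L b Q)
    {w : List ι} (hw : Q w) : mon L b w ∈ monSpan L b par Q := by
  have key : ∀ n : ℕ, ∀ {Q : List ι → Prop}, Stable L b Q → ∀ {w : List ι}, w.length ≤ n → Q w →
      mon L b w ∈ monSpan L b par Q := by
    intro n
    induction n with
    | zero =>
      intro Q _ w h hw
      obtain rfl : w = [] := List.length_eq_zero_iff.1 (by omega)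
      exact Submodule.subset_span ⟨[], ⟨List.Pairwise.nil, hw⟩, rfl⟩
    | succ n IH =>
      intro Q hQ w h hw
      cases w with
      | nil => exact Submodule.subset_span ⟨[], ⟨List.Pairwise.nil, hw⟩, rfl⟩
      | cons i w =>
        have hl : w.length ≤ n := by simpa using h
        have h1 := IH ((hQ.cons i).and (stable_length_le n)) hl ⟨hw, hl⟩
        rw [mon_cons]
        have hle : monSpan L b par (fun l => Q (i :: l) ∧ l.length ≤ n) ≤
            (monSpan L b par Q).comap (LinearMap.mulLeft ℂ (Env.ι L (b i))) := by
          refine Submodule.span_le.2 ?_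
          rintro _ ⟨l, ⟨hv, hq, hlen⟩, rfl⟩
          change Env.ι L (b i) * mon L b l ∈ monSpan L b par Q
          rw [← mon_cons]
          exact mon_cons_mem_monSpan hb IH hlen hv hQ hq
        exact hle h1
  exact key _ hQ le_rfl hw

theorem coord_mem_of_mem_monSpan (hb : ∀ i, b i ∈ L.part (par i)) {Q : List ι → Prop} {u : Env L}
    (hu : u ∈ monSpan L b par Q) : coord hb u ∈ supported ℂ ℂ {l | Valid par l ∧ Q l} := by
  have : monSpan L b par Q ≤ (supported ℂ ℂ {l | Valid par l ∧ Q l}).comap (coord hb) := by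
    refine Submodule.span_le.2 ?_
    rintro _ ⟨l, hl, rfl⟩
    change coord hb (mon L b l) ∈ supported ℂ ℂ {l | Valid par l ∧ Q l}
    rw [coord_mon hb hl.1]
    exact single_mem_supported ℂ _ hl
  exact this hu

theorem coord_mon_mem (hb : ∀ i, b i ∈ L.part (par i)) {Q : List ι → Prop} (hQ : Stable L b Q)
    {w : List ι} (hw : Q w) : coord hb (mon L b w) ∈ supported ℂ ℂ {l | Valid par l ∧ Q l} :=
  coord_mem_of_mem_monSpan hb (mon_mem_monSpan hb hQ hw)

theorem monSpan_eq_top (hb : ∀ i, b i ∈ L.part (par i)) : monSpan L b par (fun _ => True) = ⊤ := by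
  rw [eq_top_iff, ← span_mon_eq_top (b := b)]
  refine Submodule.span_le.2 ?_
  rintro _ ⟨l, rfl⟩
  exact mon_mem_monSpan hb ⟨fun _ => trivial, fun _ _ => trivial⟩ trivial

theorem coord_valid (hb : ∀ i, b i ∈ L.part (par i)) (u : Env L) {l : List ι}
    (h : coord hb u l ≠ 0) : Valid par l := by
  have hu : u ∈ monSpan L b par (fun _ => True) := by rw [monSpan_eq_top hb]; trivial
  exact (coord_mem_of_mem_monSpan hb hu (Finsupp.mem_support_iff.2 h)).1

/-- The two halves of the PBW theorem combined: ordered monomials span, and `coord` reads off their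
coefficients. -/
theorem linearCombination_coord (hb : ∀ i, b i ∈ L.part (par i)) (u : Env L) :
    linearCombination ℂ (mon L b) (coord hb u) = u := by
  have hu : u ∈ monSpan L b par (fun _ => True) := by rw [monSpan_eq_top hb]; trivial
  have : monSpan L b par (fun _ => True) ≤
      LinearMap.eqLocus (linearCombination ℂ (mon L b) ∘ₗ coord hb) LinearMap.id := by
    refine Submodule.span_le.2 ?_
    rintro _ ⟨l, hl, rfl⟩
    change linearCombination ℂ (mon L b) (coord hb (mon L b l)) = mon L b l
    rw [coord_mon hb hl.1, linearCombination_single, one_smul]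
  exact this hu

theorem coord_injective (hb : ∀ i, b i ∈ L.part (par i)) : Function.Injective (coord hb) :=
  Function.LeftInverse.injective (linearCombination_coord hb)

/-- Truncation of an element of `U(𝔤)` to the ordered monomials with a given property. -/
theorem exists_truncation (hb : ∀ i, b i ∈ L.part (par i)) (u : Env L) (P : List ι → Prop) :
    ∃ v : Env L, (∀ l, P l → coord hb v l = coord hb u l) ∧ (∀ l, ¬ P l → coord hb v l = 0) := by
  classical
  refine ⟨linearCombination ℂ (mon L b) ((coord hb u).filter P), ?_⟩
  have : coord hb (linearCombination ℂ (mon L b) ((coord hb u).filter P)) =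
      (coord hb u).filter P := by
    rw [linearCombination_apply, Finsupp.sum, map_sum]
    conv_rhs => rw [← Finsupp.sum_single ((coord hb u).filter P), Finsupp.sum]
    refine Finset.sum_congr rfl fun l hl => ?_
    rw [Finsupp.support_filter, Finset.mem_filter, Finsupp.mem_support_iff] at hl
    rw [map_smul, coord_mon hb (coord_valid hb u hl.1), smul_single, smul_eq_mul, mul_one]
  rw [this]
  exact ⟨fun l hl => Finsupp.filter_apply_pos _ _ hl, fun l hl => Finsupp.filter_apply_neg _ _ hl⟩

/-- Straightening never lengthens a word. -/
theorem coord_lower (hb : ∀ i, b i ∈ L.part (par i)) {n : ℕ} {u : Env L} (hu : u ∈ lower L b n)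
    {T : List ι} (hT : n ≤ T.length) : coord hb u T = 0 := by
  by_contra hne
  have hle : lower L b n ≤ (supported ℂ ℂ {l | l.length < n}).comap (coord hb) := by
    refine Submodule.span_le.2 ?_
    rintro _ ⟨l, hl, rfl⟩
    -- The truncated subtraction is harmless: the word `l` of length less than `n` shows that `n` is
    -- positive.
    refine supported_mono ?_ (coord_mon_mem hb (stable_length_le (n - 1)) (w := l) ?_)
    · rintro l' ⟨-, h⟩
      have hl : l.length < n := hl
      have h : l'.length ≤ n - 1 := h
      change l'.length < n
      omega
    · have hl : l.length < n := hl
      omega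
  have : T.length < n := hle hu (Finsupp.mem_support_iff.2 hne)
  omega

/-- Modulo shorter words a rearrangement is a nonzero multiple of the ordered word, and shorter
words do not contribute at `T`. -/
theorem coord_mon_perm (hb : ∀ i, b i ∈ L.part (par i)) {w T : List ι} (hT : Valid par T)
    (h : w.Perm T) : coord hb (mon L b w) T ≠ 0 := by
  obtain ⟨ε, hε, h1⟩ := mon_perm hb h
  have h2 := coord_lower hb h1 (T := T) h.length_eq.le
  rw [map_sub, map_smul, coord_mon hb hT, Finsupp.sub_apply, sub_eq_zero] at h2
  rw [h2]
  simpa using hε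

/-- Straightening `w` yields only permutations of `w` and strictly shorter words, and `T` is
neither. -/
theorem coord_mon_not_perm (hb : ∀ i, b i ∈ L.part (par i)) {w T : List ι}
    (hl : w.length ≤ T.length) (h : ¬ T.Perm w) : coord hb (mon L b w) T = 0 := by
  by_contra hne
  have := (coord_mon_mem hb (stable_perm w) (w := w) (Or.inl (List.Perm.refl w)))
    (Finsupp.mem_support_iff.2 hne)
  rcases this.2 with h' | h'
  · exact h h'
  · omega

/-- Evenness is essential: an even letter may be repeated, so it can be inserted even if it already
occurs. -/
theorem exists_valid_cons_perm {l : List ι} (hl : Valid par l) {i : ι} (hi : par i = 0) :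
    ∃ T, Valid par T ∧ T.Perm (i :: l) := by
  induction l with
  | nil => exact ⟨[i], List.pairwise_singleton _ _, List.Perm.refl _⟩
  | cons j l ih =>
    by_cases hij : Rel par i j
    · exact ⟨_, valid_cons_cons.2 ⟨hij, hl⟩, List.Perm.refl _⟩
    · have hji : j < i := by
        rcases lt_trichotomy i j with h | h | h
        · exact absurd (Or.inl h) hij
        · exact absurd (Or.inr ⟨h, hi⟩) hij
        · exact h
      obtain ⟨T, hT, hp⟩ := ih hl.tail
      exact ⟨j :: T, hl.cons_of_perm hT hji hp, (hp.cons j).trans (List.Perm.swap i j l)⟩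

theorem Valid.eq_of_perm {l l' : List ι} (hl : Valid par l) (hl' : Valid par l')
    (h : l.Perm l') : l = l' :=
  h.eq_of_pairwise (fun _ _ _ _ h h' => le_antisymm (Rel.le h) (Rel.le h')) hl hl'

end Straightening

end PBW

end SuperLie

end

noncomputable section

namespace SuperLie

open Module Finsupp PBW

/-! ### Frames of triangular decompositions -/

theorem repr_par {V ι : Type*} [AddCommGroup V] [Module ℂ V] {L : LieSuperalgebra V}
    {b : Basis ι ℂ V} {par : ι → ZMod 2} (hb : ∀ i, b i ∈ L.part (par i)) {p : ZMod 2} {x : V}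
    (hx : x ∈ L.part p) {k : ι} (hk : b.repr x k ≠ 0) : par k = p :=
  (b.mem_span_image.1 (mem_span_of_mem_part hb hx)) (Finsupp.mem_support_iff.2 hk)

namespace TriangularData

variable {I H : Type*} [Fintype I] [AddCommGroup H] [Module ℂ H]
  {V : Type*} [AddCommGroup V] [Module ℂ V] {L : LieSuperalgebra V}

/-- A frame of a triangular decomposition: a homogeneous basis of weight vectors, in which the
basis vectors of `𝔫⁺` are the ones of positive weight and come last, together with vectors
dual to the basis vectors `e` of `𝔫⁺`: the vector `f` dual to `e` has the opposite weight, `[e, f]`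
is a nonzero element of the even part of the Cartan subalgebra, and `[e', f]` is odd for all other
`e'` of the same weight. -/
structure Frame (D : TriangularData I H L) (ι : Type*) [LinearOrder ι] where
  b : Basis ι ℂ V
  par : ι → ZMod 2
  weight : ι → I → ℤ
  b_mem : ∀ i, b i ∈ L.part (par i)
  b_weight : ∀ i t, L.mul (D.cartan t) (b i) = wt D.root (weight i) t • b i
  pos_or : ∀ i, 0 < weight i ∨ weight i ≤ 0
  b_mem_nPos : ∀ i, 0 < weight i → b i ∈ D.nPos
  nPos_le_span : D.nPos ≤ Submodule.span ℂ (b '' {i | 0 < weight i})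
  lt_of_pos : ∀ i j, weight i ≤ 0 → 0 < weight j → i < j
  dual : ι → V
  dual_mem : ∀ i, 0 < weight i → dual i ∈ L.part (par i)
  dual_weight : ∀ i, 0 < weight i → ∀ t,
    L.mul (D.cartan t) (dual i) = wt D.root (-weight i) t • dual i
  bracket_dual_ne : ∀ i, 0 < weight i → L.mul (b i) (dual i) ≠ 0
  bracket_dual_odd : ∀ i j, 0 < weight i → i ≠ j → weight i = weight j →
    L.mul (b j) (dual i) ∈ L.part 1

/-- Weights are additive under the bracket. -/
theorem mul_weight (D : TriangularData I H L) {p : ZMod 2} {α β : I → ℤ} {x y : V}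
    (hp : x ∈ L.part p) (hx : ∀ t, L.mul (D.cartan t) x = wt D.root α t • x)
    (hy : ∀ t, L.mul (D.cartan t) y = wt D.root β t • y) (t : H) :
    L.mul (D.cartan t) (L.mul x y) = wt D.root (α + β) t • L.mul x y := by
  rw [L.jacobi (D.cartan_even t) hp, hx t, hy t, wt_add, sgn_zero_left]
  simp [add_smul]

namespace Frame

variable {D : TriangularData I H L} {ι : Type*} [LinearOrder ι] (F : D.Frame ι)

/-- The coordinate functional is an eigenvector of the transpose of `ad t` with the weight of its
basis vector; comparing eigenvalues for all `t` identifies the weights because the simple roots are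
independent. -/
theorem repr_weight {x : V} {δ : I → ℤ} (hx : ∀ t, L.mul (D.cartan t) x = wt D.root δ t • x)
    {k : ι} (hk : F.b.repr x k ≠ 0) : F.weight k = δ := by
  refine wt_injective D.root_indep (LinearMap.ext fun t => ?_)
  have h1 : (F.b.coord k) ∘ₗ L.mul (D.cartan t) = wt D.root (F.weight k) t • F.b.coord k := by
    refine F.b.ext fun j => ?_
    rw [LinearMap.comp_apply, F.b_weight, map_smul, LinearMap.smul_apply]
    by_cases h : j = k
    · rw [h]
    · simp [Finsupp.single_eq_of_ne' h]
  have h2 := LinearMap.congr_fun h1 x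
  rw [LinearMap.comp_apply, hx, map_smul, LinearMap.smul_apply, smul_eq_mul, smul_eq_mul] at h2
  exact (mul_right_cancel₀ hk h2).symm

theorem repr_bracket_weight {x : V} {δ : I → ℤ} (i : ι)
    (hx : ∀ t, L.mul (D.cartan t) x = wt D.root δ t • x) {k : ι}
    (hk : F.b.repr (L.mul (F.b i) x) k ≠ 0) : F.weight k = F.weight i + δ :=
  F.repr_weight (D.mul_weight (F.b_mem i) (F.b_weight i) hx) hk

theorem stable_weight (γ : I → ℤ) : Stable L F.b fun l => (l.map F.weight).sum = γ :=
  stable_grade _ (fun i j _ h => F.repr_bracket_weight i (F.b_weight j) h) γ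

theorem stable_par (p : ZMod 2) : Stable L F.b fun l => (l.map F.par).sum = p :=
  stable_grade _ (fun i j _ h => repr_par F.b_mem (L.mul_mem (F.b_mem i) (F.b_mem j)) h) p

theorem stable_pos : Stable L F.b fun l => ∀ i ∈ l, 0 < F.weight i :=
  stable_forall _ fun i j k hi hj h => by
    rw [F.repr_bracket_weight i (F.b_weight j) h]
    exact add_pos hi hj

open Classical in
/-- The positive part of the weight of a letter. -/
def posWeight (i : ι) : I → ℤ := if 0 < F.weight i then F.weight i else 0

/-- The total weight of the letters from `𝔫⁺` in a word. -/
def pw (l : List ι) : I → ℤ := (l.map F.posWeight).sum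

theorem posWeight_of_pos {i : ι} (h : 0 < F.weight i) : F.posWeight i = F.weight i := if_pos h

theorem posWeight_of_nonpos {i : ι} (h : F.weight i ≤ 0) : F.posWeight i = 0 :=
  if_neg h.not_gt

theorem posWeight_nonneg (i : ι) : 0 ≤ F.posWeight i := by
  unfold posWeight
  split_ifs with h
  · exact h.le
  · exact le_rfl

theorem pw_append (l l' : List ι) : F.pw (l ++ l') = F.pw l + F.pw l' := by
  simp [pw]

theorem pw_nonneg (l : List ι) : 0 ≤ F.pw l :=
  List.sum_nonneg (by simpa using fun i _ => F.posWeight_nonneg i)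

theorem pw_of_nonpos {l : List ι} (h : ∀ i ∈ l, F.weight i ≤ 0) : F.pw l = 0 := by
  rw [pw, List.map_congr_left (g := fun _ => 0) fun i hi => F.posWeight_of_nonpos (h i hi)]
  simp

theorem pw_of_pos {l : List ι} (h : ∀ i ∈ l, 0 < F.weight i) : F.pw l = (l.map F.weight).sum := by
  rw [pw, List.map_congr_left fun i hi => F.posWeight_of_pos (h i hi)]

theorem exists_split {l : List ι} (hl : Valid F.par l) : ∃ l₁ l₂, l = l₁ ++ l₂ ∧
    (∀ i ∈ l₁, F.weight i ≤ 0) ∧ ∀ i ∈ l₂, 0 < F.weight i := by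
  induction l with
  | nil => exact ⟨[], [], rfl, by simp, by simp⟩
  | cons j l ih =>
    rcases F.pos_or j with h | h
    · refine ⟨[], j :: l, rfl, by simp, fun i hi => ?_⟩
      rcases List.mem_cons.1 hi with rfl | hi
      · exact h
      · refine (F.pos_or i).resolve_right fun h' => ?_
        exact absurd ((List.pairwise_cons.1 hl).1 i hi).le (not_le.2 (F.lt_of_pos i j h' h))
    · obtain ⟨l₁, l₂, rfl, h1, h2⟩ := ih hl.tail
      exact ⟨j :: l₁, l₂, rfl, by simpa using ⟨h, h1⟩, h2⟩

theorem valid_append {l₁ l₂ : List ι} (h₁ : Valid F.par l₁) (h₂ : Valid F.par l₂)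
    (hn : ∀ i ∈ l₁, F.weight i ≤ 0) (hp : ∀ i ∈ l₂, 0 < F.weight i) : Valid F.par (l₁ ++ l₂) :=
  List.pairwise_append.2 ⟨h₁, h₂, fun i hi j hj => Or.inl (F.lt_of_pos i j (hn i hi) (hp j hj))⟩

theorem word_mon {l : List ι} (h : ∀ i ∈ l, 0 < F.weight i) :
    D.Word ((l.map F.weight).sum) (mon L F.b l) := by
  induction l using List.reverseRecOn with
  | nil => exact Word.one
  | append_singleton l i ih =>
    rw [mon_append, List.map_append, List.sum_append]
    simp only [mon_cons, mon_nil, mul_one, List.map_cons, List.map_nil, List.sum_cons, List.sum_nil,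
      add_zero]
    exact Word.mul (ih fun j hj => h j (by simp [hj])) (F.b_mem_nPos i (h i (by simp)))
      ⟨_, F.b_mem i⟩ (F.b_weight i)

theorem word_mem_span {μ : I → ℤ} {w : Env L} (hw : D.Word μ w) :
    w ∈ Submodule.span ℂ (mon L F.b '' {l | (∀ i ∈ l, 0 < F.weight i) ∧
      (l.map F.weight).sum = μ}) := by
  induction hw with
  | one => exact Submodule.subset_span ⟨[], by simp⟩
  | @mul μ α w x hw hx hp hα ih =>
    have hx' : Env.ι L x ∈ Submodule.span ℂ (Env.ι L '' (F.b '' {i | 0 < F.weight i ∧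
        F.weight i = α})) := by
      rw [← Submodule.map_span]
      refine Submodule.mem_map_of_mem (F.b.mem_span_image.2 fun k hk => ?_)
      exact ⟨F.b.mem_span_image.1 (F.nPos_le_span hx) hk,
        F.repr_weight hα (Finsupp.mem_support_iff.1 hk)⟩
    have h := Submodule.mul_mem_mul ih hx'
    rw [Submodule.span_mul_span] at h
    refine Submodule.span_mono ?_ h
    rintro _ ⟨_, ⟨l, ⟨hl, rfl⟩, rfl⟩, _, ⟨_, ⟨i, ⟨hi, rfl⟩, rfl⟩, rfl⟩, rfl⟩
    refine ⟨l ++ [i], ⟨fun j hj => ?_, by simp⟩, by simp [mon_append]⟩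
    rcases List.mem_append.1 hj with hj | hj
    · exact hl j hj
    · rw [List.mem_singleton.1 hj]; exact hi

/-- The ideals `J(ν)` in terms of ordered monomials. -/
theorem mem_J_iff {ν : I → ℤ} {u : Env L} :
    u ∈ D.J ν ↔ ∀ l, coord F.b_mem u l ≠ 0 → ν ≤ F.pw l := by
  constructor
  · intro hu
    let K : Submodule ℂ (Env L) := (supported ℂ ℂ {l | ν ≤ F.pw l}).comap (coord F.b_mem)
    -- That `K` is a left ideal is part of what has to be shown, so the induction treats all left
    -- multiples at once.
    have key : ∀ v : Env L, v * u ∈ K := by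
      induction hu using Submodule.span_induction with
      | zero => intro v; rw [mul_zero]; exact zero_mem _
      | add x y _ _ hx hy => intro v; rw [mul_add]; exact add_mem (hx v) (hy v)
      | smul a x _ hx => intro v; rw [smul_eq_mul, ← mul_assoc]; exact hx _
      | mem x hx =>
        intro v
        obtain ⟨μ, hμ, hx⟩ := hx
        have hx' : x ∈ Submodule.span ℂ (mon L F.b '' {l | (∀ i ∈ l, 0 < F.weight i) ∧
            (l.map F.weight).sum = μ}) :=
          Submodule.span_le.2 (fun _ hw => F.word_mem_span hw) (D.uPos_le_words μ hx)
        have hv : v ∈ monSpan L F.b F.par fun _ => True := by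
          rw [monSpan_eq_top F.b_mem]; trivial
        have h := Submodule.mul_mem_mul hv hx'
        rw [monSpan, Submodule.span_mul_span] at h
        refine (Submodule.span_le.2 ?_) h
        rintro _ ⟨_, ⟨l', ⟨hl', -⟩, rfl⟩, _, ⟨l, ⟨hl, hlμ⟩, rfl⟩, rfl⟩
        -- Only the 𝔫⁺-part `l₂` of the multiplier has to be straightened together with `l`. This
        -- takes place among words in 𝔫⁺, preserves the total weight, and the part `l₁` may be put
        -- back in front.
        obtain ⟨l₁, l₂, rfl, h1, h2⟩ := F.exists_split hl'
        have hst := mon_mem_monSpan F.b_mem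
          (F.stable_pos.and (F.stable_weight ((l₂.map F.weight).sum + μ))) (w := l₂ ++ l)
          ⟨fun i hi => (List.mem_append.1 hi).elim (h2 i) (hl i), by simp [hlμ]⟩
        change mon L F.b (l₁ ++ l₂) * mon L F.b l ∈ K
        rw [mon_append, mul_assoc, ← mon_append]
        have hle : monSpan L F.b F.par (fun l' => (∀ i ∈ l', 0 < F.weight i) ∧
            (l'.map F.weight).sum = (l₂.map F.weight).sum + μ) ≤
            K.comap (LinearMap.mulLeft ℂ (mon L F.b l₁)) := by
          refine Submodule.span_le.2 ?_
          rintro _ ⟨m, ⟨hm, hm1, hm2⟩, rfl⟩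
          change coord F.b_mem (mon L F.b l₁ * mon L F.b m) ∈ supported ℂ ℂ {l | ν ≤ F.pw l}
          rw [← mon_append, coord_mon F.b_mem
            (F.valid_append (List.pairwise_append.1 hl').1 hm h1 hm1)]
          refine single_mem_supported ℂ _ ?_
          change ν ≤ F.pw (l₁ ++ m)
          rw [pw_append, F.pw_of_nonpos h1, F.pw_of_pos hm1, hm2, ← F.pw_of_pos h2, zero_add]
          exact hμ.trans (le_add_of_nonneg_left (F.pw_nonneg l₂))
        exact hle hst
    intro l hl
    have := key 1
    rw [one_mul] at this
    exact this (Finsupp.mem_support_iff.2 hl)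
  · intro h
    rw [← linearCombination_coord F.b_mem u, linearCombination_apply]
    refine Submodule.sum_mem _ fun l hl => D.smul_mem_J _ ?_
    have hl := Finsupp.mem_support_iff.1 hl
    refine D.J_anti (h l hl) ?_
    obtain ⟨l₁, l₂, rfl, h1, h2⟩ := F.exists_split (coord_valid F.b_mem u hl)
    rw [mon_append, pw_append, F.pw_of_nonpos h1, F.pw_of_pos h2, zero_add]
    exact Ideal.mul_mem_left _ _ (Ideal.subset_span ⟨_, le_rfl, (F.word_mon h2).mem_uPos⟩)

/-- Right multiplication by a vector of weight γ shifts the filtration by γ, also for negative γ;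
this controls how far supercommutators with 𝔫⁻ descend. -/
theorem mon_mul_mem_J {l : List ι} (hl : Valid F.par l) {γ : I → ℤ} {x : V}
    (hp : ∃ p, x ∈ L.part p) (hγ : ∀ t, L.mul (D.cartan t) x = wt D.root γ t • x) :
    mon L F.b l * Env.ι L x ∈ D.J (F.pw l + γ) := by
  obtain ⟨l₁, l₂, rfl, h1, h2⟩ := F.exists_split hl
  rw [mon_append, pw_append, F.pw_of_nonpos h1, F.pw_of_pos h2, zero_add, mul_assoc]
  exact Ideal.mul_mem_left _ _ ((F.word_mon h2).mul_ι_mem hp hγ)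

/-- The `ℤ/2`-grading of `U(𝔤)` in terms of ordered monomials. -/
theorem mem_part_iff {p : ZMod 2} {u : Env L} :
    u ∈ Env.part L p ↔ ∀ l, coord F.b_mem u l ≠ 0 → (l.map F.par).sum = p := by
  constructor
  · intro hu l hl
    have hmon : ∀ {p : ZMod 2} {w : Env L}, Env.IsMonomial L p w →
        w ∈ Submodule.span ℂ (mon L F.b '' {l | (l.map F.par).sum = p}) := by
      intro p w hw
      induction hw with
      | one => exact Submodule.subset_span ⟨[], by simp⟩
      | @mul i j x w hx hw ih =>
        refine ι_mul_mem (b := F.b) fun k hk => ?_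
        have hle : Submodule.span ℂ (mon L F.b '' {l | (l.map F.par).sum = j}) ≤
            (Submodule.span ℂ (mon L F.b '' {l | (l.map F.par).sum = i + j})).comap
              (LinearMap.mulLeft ℂ (Env.ι L (F.b k))) := by
          refine Submodule.span_le.2 ?_
          rintro _ ⟨l, hl, rfl⟩
          have hl : (l.map F.par).sum = j := hl
          refine Submodule.subset_span ⟨k :: l, ?_, by simp⟩
          change ((k :: l).map F.par).sum = i + j
          rw [List.map_cons, List.sum_cons, repr_par F.b_mem hx hk, hl]
        exact hle ih
    have hle : Submodule.span ℂ {w | Env.IsMonomial L p w} ≤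
        (supported ℂ ℂ {l | (l.map F.par).sum = p}).comap (coord F.b_mem) := by
      refine Submodule.span_le.2 fun w hw => ?_
      refine (Submodule.span_le (p := (supported ℂ ℂ {l | (l.map F.par).sum = p}).comap
        (coord F.b_mem))).2 ?_ (hmon hw)
      rintro _ ⟨l, hl, rfl⟩
      exact supported_mono (fun l h => h.2) (coord_mon_mem F.b_mem (F.stable_par p) hl)
    exact hle hu (Finsupp.mem_support_iff.2 hl)
  · intro h
    have hm : ∀ l : List ι, Env.IsMonomial L ((l.map F.par).sum) (mon L F.b l) := by
      intro l
      induction l with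
      | nil => exact Env.IsMonomial.one
      | cons i l ih =>
        rw [mon_cons, List.map_cons, List.sum_cons]
        exact Env.IsMonomial.mul (F.b_mem i) ih
    rw [← linearCombination_coord F.b_mem u, linearCombination_apply]
    refine Submodule.sum_mem (Submodule.span ℂ {w | Env.IsMonomial L p w}) fun l hl => ?_
    have h' := hm l
    rw [h l (Finsupp.mem_support_iff.1 hl)] at h'
    exact Submodule.smul_mem _ _ (Submodule.subset_span h')

end Frame

end TriangularData

end SuperLie

end

/-! ### Supercommutators with monomials and their leading coefficients -/

noncomputable section

namespace SuperLie

open Module Finsupp PBW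

namespace PBW

section Derivation

variable {V : Type*} [AddCommGroup V] [Module ℂ V] {L : LieSuperalgebra V} {ι : Type*}
  {b : Basis ι ℂ V} {par : ι → ZMod 2}

theorem lower_mono {m n : ℕ} (h : m ≤ n) : lower L b m ≤ lower L b n :=
  Submodule.span_mono (Set.image_mono fun _ hl => lt_of_lt_of_le hl h)

variable (L b par) in
/-- The sum of the words obtained from `l` by replacing a letter `x` by `g x`, with the signs of a
superderivation of parity `q` acting from the right. -/
def der (q : ZMod 2) (g : ι → V) : List ι → Env L
  | [] => 0
  | x :: l => Env.ι L (b x) * der q g l +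
      sgn ((l.map par).sum) q • (Env.ι L (g x) * mon L b l)

/-- The super Leibniz rule: moving `f` to the left through the word leaves one bracket at each
letter. -/
theorem mon_mul_ι (hb : ∀ i, b i ∈ L.part (par i)) {q : ZMod 2} {f : V} (hf : f ∈ L.part q)
    (l : List ι) : mon L b l * Env.ι L f =
      sgn ((l.map par).sum) q • (Env.ι L f * mon L b l) +
        der L b par q (fun x => L.mul (b x) f) l := by
  induction l with
  | nil => simp [der, sgn_zero_left]
  | cons x l ih =>
    rw [mon_cons, mul_assoc, ih, mul_add, mul_smul_comm, ← mul_assoc, Env.ι_mul (hb x) hf, der,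
      List.map_cons, List.sum_cons, sgn_add, add_mul, smul_add, smul_mul_assoc, smul_smul,
      mul_assoc, mul_comm (sgn (par x) q)]
    abel

theorem der_add (q : ZMod 2) (g g' : ι → V) (l : List ι) :
    der L b par q (fun x => g x + g' x) l = der L b par q g l + der L b par q g' l := by
  induction l with
  | nil => simp [der]
  | cons x l ih =>
    rw [der, der, der, ih, map_add, mul_add, add_mul, smul_add]
    abel

theorem der_mem_span (q : ZMod 2) (g : ι → V) (l : List ι) :
    der L b par q g l ∈ Submodule.span ℂ (mon L b '' {w | ∃ P x Q y, l = P ++ x :: Q ∧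
      b.repr (g x) y ≠ 0 ∧ w = P ++ y :: Q}) := by
  induction l with
  | nil => exact zero_mem _
  | cons x l ih =>
    refine add_mem ?_ (Submodule.smul_mem _ _ ?_)
    · have hle : Submodule.span ℂ (mon L b '' {w | ∃ P x Q y, l = P ++ x :: Q ∧
          b.repr (g x) y ≠ 0 ∧ w = P ++ y :: Q}) ≤
          (Submodule.span ℂ (mon L b '' {w | ∃ P x' Q y, x :: l = P ++ x' :: Q ∧
          b.repr (g x') y ≠ 0 ∧ w = P ++ y :: Q})).comap (LinearMap.mulLeft ℂ (Env.ι L (b x))) := by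
        refine Submodule.span_le.2 ?_
        rintro _ ⟨w, ⟨P, x', Q, y, rfl, hy, rfl⟩, rfl⟩
        exact Submodule.subset_span ⟨_, ⟨x :: P, x', Q, y, rfl, hy, rfl⟩, by simp⟩
      exact hle ih
    · refine ι_mul_mem (b := b) fun y hy => ?_
      exact Submodule.subset_span ⟨_, ⟨[], x, l, y, rfl, hy, rfl⟩, by simp⟩

theorem der_mem_lower (q : ZMod 2) (g : ι → V) (l : List ι) :
    der L b par q g l ∈ lower L b (l.length + 1) := by
  refine Submodule.span_mono (Set.image_mono ?_) (der_mem_span q g l)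
  rintro w ⟨P, x, Q, y, rfl, -, rfl⟩
  change (P ++ y :: Q).length < _
  simp

theorem der_single_of_notMem [DecidableEq ι] (q : ZMod 2) {e : ι} (v : V) {l : List ι}
    (h : e ∉ l) : der L b par q (fun x => if x = e then v else 0) l = 0 := by
  induction l with
  | nil => rfl
  | cons x l ih =>
    rw [List.mem_cons, not_or] at h
    rw [der, ih h.2, if_neg (Ne.symm h.1)]
    simp

/-- Meant for an odd letter `e`: it occurs once in an ordered monomial, so a single replacement
survives. -/
theorem der_single_of_split [DecidableEq ι] (q : ZMod 2) {e : ι} (v : V) {P Q : List ι}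
    (hP : e ∉ P) (hQ : e ∉ Q) : der L b par q (fun x => if x = e then v else 0) (P ++ e :: Q) =
      sgn ((Q.map par).sum) q • (mon L b P * (Env.ι L v * mon L b Q)) := by
  induction P with
  | nil => simp [der, der_single_of_notMem q v hQ]
  | cons x P ih =>
    rw [List.mem_cons, not_or] at hP
    rw [List.cons_append, der, ih hP.2, if_neg (Ne.symm hP.1)]
    simp [mul_assoc]

theorem mon_erase [DecidableEq ι] (hb : ∀ i, b i ∈ L.part (par i)) {e : ι} (he : par e = 0)
    {l : List ι} (h : e ∈ l) : mon L b l - mon L b (e :: l.erase e) ∈ lower L b l.length := by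
  obtain ⟨P, Q, hP, rfl, h'⟩ := List.exists_erase_eq h
  rw [h']
  have := mon_even hb he P Q
  convert this using 2
  simp; omega

/-- Even letters commute with everything up to shorter words, so all occurrences of `e` contribute
the same leading word with the same sign, and their number appears as a factor. -/
theorem der_single_even [DecidableEq ι] (hb : ∀ i, b i ∈ L.part (par i)) {e i : ι}
    (he : par e = 0) (hi : par i = 0) (l : List ι) :
    der L b par 0 (fun x => if x = e then b i else 0) l -
      (l.count e : ℂ) • mon L b (i :: l.erase e) ∈ lower L b l.length := by
  induction l with
  | nil => simp [der]
  | cons x l ih =>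
    have h1 := ι_mul_mem_lower (b x) ih
    rw [mul_sub, mul_smul_comm, ← mon_cons] at h1
    have hswap : ∀ m : List ι, m.length + 2 ≤ l.length + 1 →
        mon L b (x :: i :: m) - mon L b (i :: x :: m) ∈ lower L b (l.length + 1) := by
      intro m hm
      rw [mon_swap hb, hi, sgn_comm, sgn_zero_left, one_smul, add_sub_cancel_left]
      exact lower_mono hm (ι_mul_mon_mem_lower (L := L) (b := b) _ m)
    rw [der, sgn_comm, sgn_zero_left, one_smul, List.length_cons]
    by_cases hx : x = e
    · subst hx
      rw [if_pos rfl, List.count_cons_self, List.erase_cons_head, ← mon_cons]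
      by_cases hl : x ∈ l
      · have hlen := List.length_erase_of_mem hl
        have hpos := List.length_pos_of_mem hl
        have h2 := hswap (l.erase x) (by omega)
        have h3 := ι_mul_mem_lower (b i) (mon_erase hb he hl)
        rw [mul_sub, ← mon_cons, ← mon_cons] at h3
        have h4 := sub_mem (add_mem h1 (Submodule.smul_mem _ (l.count x : ℂ) h2))
          (Submodule.smul_mem _ (l.count x : ℂ) h3)
        convert h4 using 1
        push_cast
        module
      · rw [List.count_eq_zero_of_not_mem hl] at h1 ⊢
        simpa using h1
    · rw [if_neg hx, map_zero, zero_mul, add_zero, List.count_cons_of_ne hx,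
        List.erase_cons_tail (by simpa using hx)]
      by_cases hl : e ∈ l
      · have hlen := List.length_erase_of_mem hl
        have hpos := List.length_pos_of_mem hl
        have h2 := hswap (l.erase e) (by omega)
        have h4 := add_mem h1 (Submodule.smul_mem _ (l.count e : ℂ) h2)
        convert h4 using 1
        module
      · rw [List.count_eq_zero_of_not_mem hl] at h1 ⊢
        simpa using h1

end Derivation

section Coordinates

variable {V : Type*} [AddCommGroup V] [Module ℂ V] {L : LieSuperalgebra V} {ι : Type*}
  [LinearOrder ι] {b : Basis ι ℂ V} {par : ι → ZMod 2}

theorem coord_der_eq_zero (hb : ∀ i, b i ∈ L.part (par i)) {q : ZMod 2} {g : ι → V} {l T : List ι}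
    (hl : l.length = T.length) (h : ∀ P x Q y, l = P ++ x :: Q → b.repr (g x) y ≠ 0 →
      ¬ T.Perm (P ++ y :: Q)) : coord hb (der L b par q g l) T = 0 := by
  have hle : Submodule.span ℂ (mon L b '' {w | ∃ P x Q y, l = P ++ x :: Q ∧
      b.repr (g x) y ≠ 0 ∧ w = P ++ y :: Q}) ≤
      LinearMap.ker (Finsupp.lapply T ∘ₗ coord hb) := by
    refine Submodule.span_le.2 ?_
    rintro _ ⟨w, ⟨P, x, Q, y, rfl, hy, rfl⟩, rfl⟩
    exact coord_mon_not_perm hb (by rw [← hl]; simp) (h P x Q y rfl hy)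
  exact hle (der_mem_span q g l)

/-- There is no cancellation between the occurrences of `e`: for even `e` the coefficient is the
multiplicity times a nonzero number, and an odd `e` occurs only once. -/
theorem coord_der_single_ne_zero (hb : ∀ i, b i ∈ L.part (par i)) {e i : ι} (hi : par i = 0)
    {l T : List ι} (hl : Valid par l) (he : e ∈ l) (hT : Valid par T)
    (hp : T.Perm (i :: l.erase e)) :
    coord hb (der L b par (par e) (fun x => if x = e then b i else 0) l) T ≠ 0 := by
  have hlen : T.length = l.length := by
    rw [hp.length_eq, List.length_cons, List.length_erase_of_mem he]
    have := List.length_pos_of_mem he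
    omega
  rcases zmod_two_cases (par e) with h | h
  · rw [h]
    have h1 := coord_lower hb (der_single_even hb h hi l) hlen.ge
    rw [map_sub, map_smul, Finsupp.sub_apply, sub_eq_zero] at h1
    rw [h1, Finsupp.smul_apply, smul_eq_mul]
    exact mul_ne_zero (Nat.cast_ne_zero.2 (List.count_pos_iff.2 he).ne')
      (coord_mon_perm hb hT hp.symm)
  · obtain ⟨P, Q, hP, rfl, h'⟩ := List.exists_erase_eq he
    rw [h'] at hp
    -- An ordered monomial cannot repeat an odd letter.
    have hQ : e ∉ Q := fun hQ => by
      have := (List.pairwise_cons.1 (List.pairwise_append.1 hl).2.1).1 e hQ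
      rcases this with h0 | ⟨-, h0⟩
      · exact lt_irrefl _ h0
      · rw [h] at h0; exact absurd h0 (by decide)
    rw [der_single_of_split _ _ hP hQ, map_smul, Finsupp.smul_apply, smul_eq_mul, ← mon_cons,
      ← mon_append]
    refine mul_ne_zero ?_ (coord_mon_perm hb hT ((List.perm_middle).trans hp.symm))
    rcases sgn_eq ((Q.map par).sum) (par e) with h | h <;> rw [h] <;> norm_num

end Coordinates

end PBW

/-! ### Heights, and uniqueness of an extremal replacement -/

namespace TriangularData.Frame

variable {I H : Type*} [Fintype I] [AddCommGroup H] [Module ℂ H]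
  {V : Type*} [AddCommGroup V] [Module ℂ V] {L : LieSuperalgebra V}
  {D : TriangularData I H L} {ι : Type*} [LinearOrder ι] (F : D.Frame ι)

/-- The height of an element of the root lattice. -/
def height : (I → ℤ) →+ ℤ where
  toFun γ := ∑ i, γ i
  map_zero' := by simp
  map_add' := by simp [Finset.sum_add_distrib]

theorem height_mono {γ δ : I → ℤ} (h : γ ≤ δ) : height γ ≤ height δ :=
  Finset.sum_le_sum fun i _ => h i

theorem height_pos {γ : I → ℤ} (h : 0 < γ) : 0 < height γ := by
  obtain ⟨h0, i, hi⟩ := Pi.lt_def.1 h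
  exact Finset.sum_pos' (fun i _ => h0 i) ⟨i, Finset.mem_univ _, hi⟩

theorem eq_zero_of_height {γ : I → ℤ} (h : γ ≤ 0) (h' : height γ = 0) : γ = 0 := by
  funext i
  exact (Finset.sum_eq_zero_iff_of_nonpos fun i _ => h i).1 h' i (Finset.mem_univ _)

/-- The height of the part of a word that lies in `𝔫⁺`. -/
def ph (l : List ι) : ℤ := height (F.pw l)

theorem ph_eq (l : List ι) : F.ph l = (l.map fun i => height (F.posWeight i)).sum := by
  rw [ph, pw, map_list_sum, List.map_map]
  rfl

open Classical in
/-- The number of odd letters of weight zero of a word. -/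
def oddCount (l : List ι) : ℤ :=
  (l.map fun i => if F.weight i = 0 ∧ F.par i = 1 then (1 : ℤ) else 0).sum

/-- An additive statistic of words changes by what is removed and added. It is applied to the height
of the 𝔫⁺-part, to the number of odd letters of weight zero and to the multiplicity of `i`. -/
theorem sum_map_replace (φ : ι → ℤ) {P Q M : List ι} {x y e i : ι} (he : e ∈ M)
    (h : (i :: M.erase e).Perm (P ++ y :: Q)) :
    ((P ++ x :: Q).map φ).sum - φ x + φ y = (M.map φ).sum - φ e + φ i := by
  have h1 := (h.map φ).sum_eq
  have h2 := ((List.perm_cons_erase he).map φ).sum_eq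
  simp only [List.map_append, List.map_cons, List.sum_append, List.sum_cons] at *
  linarith

/-- The letter replaced in `M` and its replacement are determined by the resulting multiset of
letters, if `M` is chosen extremal. -/
theorem replace_unique {n : ℤ} {M₀ M : List ι} {e i : ι} (he : e ∈ M₀)
    (hepos : 0 < F.weight e) (hi0 : F.par i = 0)
    (hiw : F.weight i = 0) (hM₀v : Valid F.par M₀) (hMv : Valid F.par M) (hM₀n : F.ph M₀ = n)
    (hMn : F.ph M = n)
    (hk : ∀ x ∈ M, 0 < F.weight x → height (F.weight x) ≤ height (F.weight e))
    (hodd : ∀ x ∈ M, 0 < F.weight x → height (F.weight x) = height (F.weight e) →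
      F.oddCount M₀ ≤ F.oddCount M)
    (hcount : e ∈ M → F.oddCount M = F.oddCount M₀ → M.count i ≤ M₀.count i)
    {P Q : List ι} {x y : ι} (hM : M = P ++ x :: Q)
    (hy : F.b.repr (L.mul (F.b x) (F.dual e)) y ≠ 0)
    (hperm : (i :: M₀.erase e).Perm (P ++ y :: Q)) : M = M₀ ∧ x = e ∧ y = i := by
  have hyw : F.weight y = F.weight x + -F.weight e :=
    F.repr_bracket_weight x (F.dual_weight e hepos) hy
  have hxM : x ∈ M := by rw [hM]; simp
  have hstat := fun φ : ι → ℤ => sum_map_replace φ (x := x) he hperm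
  rw [← hM] at hstat
  have hiw0 : F.posWeight i = 0 := F.posWeight_of_nonpos hiw.le
  -- Both monomials have height `n`, so replacing `x` by `y` must lower the height by exactly the
  -- height of `e`.
  have hph := hstat fun i => height (F.posWeight i)
  rw [← ph_eq, ← ph_eq, hM₀n, hMn] at hph
  simp only [hiw0, map_zero, F.posWeight_of_pos hepos] at hph
  have hy0 : 0 ≤ height (F.posWeight y) := by
    simpa using height_mono (F.posWeight_nonneg y)
  have he1 := height_pos hepos
  have hxpos : 0 < F.weight x := by
    refine (F.pos_or x).resolve_right fun hx => ?_
    rw [F.posWeight_of_nonpos hx, map_zero] at hph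
    omega
  rw [F.posWeight_of_pos hxpos] at hph
  have hxk := hk x hxM hxpos
  have hhy : height (F.weight y) = height (F.weight x) - height (F.weight e) := by
    rw [hyw, map_add, map_neg]; ring
  -- By maximality of the height of `e`, the weight of `y` has height at most zero. The comparison
  -- then forces `x` to have the height of `e`, so that `y` has a nonpositive weight of height zero,
  -- that is, weight zero.
  have hynonpos : F.weight y ≤ 0 := by
    refine (F.pos_or y).resolve_left fun h => ?_
    have := height_pos h
    omega
  rw [F.posWeight_of_nonpos hynonpos, map_zero] at hph
  have hxe : height (F.weight x) = height (F.weight e) := by omega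
  have hyw0 : F.weight y = 0 := eq_zero_of_height hynonpos (by omega)
  have hweq : F.weight e = F.weight x := by
    rw [hyw0] at hyw
    exact (add_neg_eq_zero.1 hyw.symm).symm
  let φ : ι → ℤ := fun i => if F.weight i = 0 ∧ F.par i = 1 then 1 else 0
  have hne : (0 : ZMod 2) ≠ 1 := by decide
  have hφx : φ x = 0 := if_neg fun h => hxpos.ne' h.1
  have hφe : φ e = 0 := if_neg fun h => hepos.ne' h.1
  have hφi : φ i = 0 := if_neg fun h => hne (hi0.symm.trans h.2)
  have hoc : F.oddCount M - φ x + φ y = F.oddCount M₀ - φ e + φ i := hstat φ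
  rw [hφx, hφe, hφi] at hoc
  have hle := hodd x hxM hxpos hxe
  -- Otherwise `y` is an odd letter of weight zero, and `M` has one such letter fewer than `M₀`,
  -- against the minimality of `oddCount M₀`.
  have hxe' : x = e := by
    by_contra hne
    have hpar := repr_par F.b_mem (F.bracket_dual_odd e x hepos (Ne.symm hne) hweq) hy
    have hφy : φ y = 1 := if_pos ⟨hyw0, hpar⟩
    omega
  subst hxe'
  have hpar : F.par y = 0 := by
    rw [repr_par F.b_mem (L.mul_mem (F.b_mem x) (F.dual_mem x hepos)) hy]
    generalize F.par x = p
    revert p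
    decide
  have hφy : φ y = 0 := if_neg fun h => hne (hpar.symm.trans h.2)
  -- Otherwise `M` contains `i` once more than `M₀` does, against the maximality of that
  -- multiplicity.
  have hyi : y = i := by
    by_contra hne
    have hc := hstat fun z => if z = i then (1 : ℤ) else 0
    have hcnt : ∀ l : List ι, (l.map fun z => if z = i then (1 : ℤ) else 0).sum = l.count i := by
      intro l
      induction l with
      | nil => rfl
      | cons z l ih =>
        rw [List.map_cons, List.sum_cons, ih, List.count_cons]
        by_cases h : z = i
        · simp [h, add_comm]
        · simp [h]
    have hxi : x ≠ i := fun h => hepos.ne' (by rw [h]; exact hiw)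
    rw [hcnt, hcnt, if_neg hne, if_pos rfl, if_neg hxi] at hc
    have := hcount hxM (by omega)
    omega
  subst hyi
  refine ⟨hMv.eq_of_perm hM₀v ?_, rfl, rfl⟩
  have h1 : (M₀.erase x).Perm (P ++ Q) :=
    List.Perm.cons_inv (hperm.trans List.perm_middle)
  rw [hM]
  exact (List.perm_middle.trans (h1.symm.cons x)).trans (List.perm_cons_erase he).symm

end TriangularData.Frame

end SuperLie

end

/-! ### The bound on the degree -/

noncomputable section

namespace SuperLie

open Module Finsupp PBW

namespace TriangularData.Frame

variable {I H : Type*} [Fintype I] [AddCommGroup H] [Module ℂ H]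
  {V : Type*} [AddCommGroup V] [Module ℂ V] {L : LieSuperalgebra V}
  {D : TriangularData I H L} {ι : Type*} [LinearOrder ι] (F : D.Frame ι)

/-- The supercommutator of a homogeneous element with a vector dual to a basis vector of `𝔫⁺`. -/
def comm (p : ZMod 2) (e : ι) (u : Env L) : Env L :=
  u * Env.ι L (F.dual e) - sgn p (F.par e) • (Env.ι L (F.dual e) * u)

/-- All monomials of `u` have parity `p`, so the Leibniz rule produces the same sign for each and
the terms with the dual vector on the left cancel. -/
theorem comm_eq_sum {p : ZMod 2} {u : Env L} (hu : u ∈ Env.part L p) {e : ι}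
    (he : 0 < F.weight e) : F.comm p e u = (coord F.b_mem u).sum fun l c =>
      c • der L F.b F.par (F.par e) (fun x => L.mul (F.b x) (F.dual e)) l := by
  conv_lhs => rw [comm, ← linearCombination_coord F.b_mem u, linearCombination_apply]
  rw [Finsupp.sum, Finsupp.sum, Finset.sum_mul, Finset.mul_sum, Finset.smul_sum,
    ← Finset.sum_sub_distrib]
  refine Finset.sum_congr rfl fun l hl => ?_
  have hp := F.mem_part_iff.1 hu l (Finsupp.mem_support_iff.1 hl)
  rw [smul_mul_assoc, mon_mul_ι F.b_mem (F.dual_mem e he) l, hp, mul_smul_comm]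
  module

/-- A supercommutator with the vector dual to `e` lowers the weight of the 𝔫⁺-part by at most the
weight of `e`, by `mon_mul_mem_J`; monomials of too large a height therefore cannot reach `T`. -/
theorem coord_der_of_ph {e : ι} (he : 0 < F.weight e) {l T : List ι} (hl : Valid F.par l)
    (hT : F.ph T < F.ph l - height (F.weight e)) :
    coord F.b_mem (der L F.b F.par (F.par e) (fun x => L.mul (F.b x) (F.dual e)) l) T = 0 := by
  by_contra hne
  have h1 := F.mon_mul_mem_J hl ⟨_, F.dual_mem e he⟩ (F.dual_weight e he)
  have h2 : Env.ι L (F.dual e) * mon L F.b l ∈ D.J (F.pw l + -F.weight e) := by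
    refine Ideal.mul_mem_left _ _ (F.mem_J_iff.2 fun l' hl' => ?_)
    rw [coord_mon F.b_mem hl, Finsupp.single_apply_ne_zero] at hl'
    rw [hl'.1]
    exact add_le_of_nonpos_right (neg_nonpos.2 he.le)
  have h3 := sub_mem h1 (D.smul_mem_J (sgn ((l.map F.par).sum) (F.par e)) h2)
  rw [mon_mul_ι F.b_mem (F.dual_mem e he) l, add_sub_cancel_left] at h3
  have h4 := height_mono (F.mem_J_iff.1 h3 T hne)
  rw [map_add, map_neg] at h4
  change F.ph l + _ ≤ F.ph T at h4
  omega

theorem exists_pos_of_ph {l : List ι} (h : 1 ≤ F.ph l) : ∃ x ∈ l, 0 < F.weight x := by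
  by_contra! hne
  have : F.pw l = 0 := F.pw_of_nonpos fun i hi => (F.pos_or i).resolve_left (hne i hi)
  rw [ph, this, map_zero] at h
  omega

/-- The choices are nested: maximal length `N`; among the monomials of that length a positive letter
of maximal height; among those containing a positive letter of that height, the fewest odd letters
of weight zero, which fixes `e` and a letter `i` of its bracket with the dual vector; finally, among
those with `e` and that odd count, the largest multiplicity of `i`. These are the hypotheses of
`replace_unique`. -/
theorem exists_extremal {d : ℕ} {n : ℤ} (hn : 1 ≤ n) {B : Finset (List ι)} (hB : B.Nonempty)
    (hBn : ∀ l ∈ B, F.ph l = n ∧ d < l.length) :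
    ∃ N : ℕ, d < N ∧ (∀ l ∈ B, l.length ≤ N) ∧ ∃ M₀ ∈ B, ∃ e i : ι, M₀.length = N ∧ e ∈ M₀ ∧
      0 < F.weight e ∧ F.b.repr (L.mul (F.b e) (F.dual e)) i ≠ 0 ∧
      ∀ M ∈ B, M.length = N →
        (∀ x ∈ M, 0 < F.weight x → height (F.weight x) ≤ height (F.weight e)) ∧
        (∀ x ∈ M, 0 < F.weight x → height (F.weight x) = height (F.weight e) →
          F.oddCount M₀ ≤ F.oddCount M) ∧
        (e ∈ M → F.oddCount M = F.oddCount M₀ → M.count i ≤ M₀.count i) := by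
  classical
  obtain ⟨l₀, hl₀, hmax⟩ := Finset.exists_max_image B List.length hB
  let B₁ := B.filter fun l => l.length = l₀.length
  let E := B₁.biUnion fun l => l.toFinset.filter fun x => 0 < F.weight x
  have hmemE : ∀ x, x ∈ E ↔ ∃ l ∈ B, l.length = l₀.length ∧ x ∈ l ∧ 0 < F.weight x := by
    intro x
    simp [E, B₁, and_assoc]
  have hE : E.Nonempty := by
    obtain ⟨x, hx, hpos⟩ := F.exists_pos_of_ph (l := l₀) (by rw [(hBn l₀ hl₀).1]; exact hn)
    exact ⟨x, (hmemE x).2 ⟨l₀, hl₀, rfl, hx, hpos⟩⟩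
  obtain ⟨e₁, he₁, hmaxE⟩ := Finset.exists_max_image E (fun x => height (F.weight x)) hE
  let B₂ := B₁.filter fun l => ∃ x ∈ l, 0 < F.weight x ∧
    height (F.weight x) = height (F.weight e₁)
  have hmemB₂ : ∀ l, l ∈ B₂ ↔ l ∈ B ∧ l.length = l₀.length ∧ ∃ x ∈ l, 0 < F.weight x ∧
      height (F.weight x) = height (F.weight e₁) := by
    intro l
    simp [B₂, B₁, and_assoc]
  have hB₂ : B₂.Nonempty := by
    obtain ⟨l, h1, h2, h3, h4⟩ := (hmemE e₁).1 he₁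
    exact ⟨l, (hmemB₂ l).2 ⟨h1, h2, e₁, h3, h4, rfl⟩⟩
  obtain ⟨M₁, hM₁, hmin⟩ := Finset.exists_min_image B₂ F.oddCount hB₂
  obtain ⟨hM₁B, hM₁l, e, heM₁, hepos, heh⟩ := (hmemB₂ M₁).1 hM₁
  obtain ⟨i, hi⟩ : ∃ i, F.b.repr (L.mul (F.b e) (F.dual e)) i ≠ 0 := by
    by_contra! h
    exact F.bracket_dual_ne e hepos (F.b.repr.map_eq_zero_iff.1 (Finsupp.ext h))
  let B₃ := B₂.filter fun l => e ∈ l ∧ F.oddCount l = F.oddCount M₁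
  obtain ⟨M₀, hM₀, hmax₃⟩ := Finset.exists_max_image B₃ (List.count i)
    ⟨M₁, Finset.mem_filter.2 ⟨hM₁, heM₁, rfl⟩⟩
  obtain ⟨hM₀2, heM₀, hM₀o⟩ := Finset.mem_filter.1 hM₀
  obtain ⟨hM₀B, hM₀l, -⟩ := (hmemB₂ M₀).1 hM₀2
  refine ⟨l₀.length, (hBn l₀ hl₀).2, hmax, M₀, hM₀B, e, i, hM₀l, heM₀, hepos, hi, ?_⟩
  intro M hM hMl
  refine ⟨fun x hx hpos => ?_, fun x hx hpos hh => ?_, fun heM ho => ?_⟩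
  · rw [heh]
    exact hmaxE x ((hmemE x).2 ⟨M, hM, hMl, hx, hpos⟩)
  · rw [hM₀o]
    exact hmin M ((hmemB₂ M).2 ⟨hM, hMl, x, hx, hpos, hh.trans heh⟩)
  · exact hmax₃ M (Finset.mem_filter.2 ⟨(hmemB₂ M).2 ⟨hM, hMl, e, heM, hepos, heh⟩, heM,
      ho.trans hM₀o⟩)

/-- An element of `U(𝔤)` that commutes with `𝔫⁻` up to terms of large height and that has degree
at most `d` up to terms of height at least `n ≥ 1` has degree at most `d` up to terms of
height at least `n + 1`. -/
theorem length_le_or_succ_le_ph {p : ZMod 2} {u : Env L} (hu : u ∈ Env.part L p) {d : ℕ} {n : ℤ}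
    (hn : 1 ≤ n) (h : ∀ l, coord F.b_mem u l ≠ 0 → l.length ≤ d ∨ n ≤ F.ph l)
    (hcomm : ∀ e, 0 < F.weight e → ∀ l, coord F.b_mem (F.comm p e u) l ≠ 0 → n ≤ F.ph l) :
    ∀ l, coord F.b_mem u l ≠ 0 → l.length ≤ d ∨ n + 1 ≤ F.ph l := by
  classical
  by_contra! hne
  obtain ⟨l₁, hl₁, hl₁d, hl₁n⟩ := hne
  -- The offending terms. The assumptions force their height to be exactly `n`.
  let B := (coord F.b_mem u).support.filter fun l => d < l.length ∧ F.ph l < n + 1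
  have hmemB : ∀ l, l ∈ B ↔ coord F.b_mem u l ≠ 0 ∧ d < l.length ∧ F.ph l < n + 1 := fun l => by
    simp [B]
  have hBn : ∀ l ∈ B, F.ph l = n ∧ d < l.length := by
    intro l hl
    obtain ⟨h1, h2, h3⟩ := (hmemB l).1 hl
    have := (h l h1).resolve_left (by omega)
    exact ⟨by omega, h2⟩
  obtain ⟨N, hdN, hBN, M₀, hM₀B, e, i, hM₀l, heM₀, hepos, hi, hext⟩ :=
    F.exists_extremal hn ⟨l₁, (hmemB l₁).2 ⟨hl₁, hl₁d, hl₁n⟩⟩ hBn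
  have hiw : F.weight i = 0 := by
    rw [F.repr_bracket_weight e (F.dual_weight e hepos) hi, add_neg_cancel]
  have hip : F.par i = 0 := by
    rw [repr_par F.b_mem (L.mul_mem (F.b_mem e) (F.dual_mem e hepos)) hi]
    generalize F.par e = p
    revert p
    decide
  have hM₀v := coord_valid F.b_mem u ((hmemB M₀).1 hM₀B).1
  have hM₀n := (hBn M₀ hM₀B).1
  have hlen := List.length_erase_of_mem heM₀
  have hlpos := List.length_pos_of_mem heM₀
  -- `T` is the ordered form of `M₀` with one `e` replaced by `i`. It has the maximal length `N` but
  -- height less than `n`, so the supercommutator has no term `T`.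
  obtain ⟨T, hT, hTp⟩ := exists_valid_cons_perm
    (hM₀v.sublist List.erase_sublist : Valid F.par (M₀.erase e)) hip
  have hTl : T.length = N := by
    rw [hTp.length_eq, List.length_cons]
    omega
  have hTph : F.ph T = n - height (F.weight e) := by
    have h1 := (hTp.map fun i => height (F.posWeight i)).sum_eq
    have h2 := ((List.perm_cons_erase heM₀).map fun i => height (F.posWeight i)).sum_eq
    rw [← ph_eq, List.map_cons, List.sum_cons, F.posWeight_of_nonpos hiw.le, map_zero] at h1
    rw [← ph_eq, List.map_cons, List.sum_cons, F.posWeight_of_pos hepos] at h2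
    omega
  have hk1 := height_pos hepos
  have hzero : coord F.b_mem (F.comm p e u) T = 0 := by
    by_contra hne
    have := hcomm e hepos T hne
    omega
  have huniq : ∀ M ∈ B, M.length = N → ∀ P x Q y, M = P ++ x :: Q →
      F.b.repr (L.mul (F.b x) (F.dual e)) y ≠ 0 → T.Perm (P ++ y :: Q) →
      M = M₀ ∧ x = e ∧ y = i := by
    intro M hM hMl P x Q y hMs hy hp
    obtain ⟨h1, h2, h3⟩ := hext M hM hMl
    exact F.replace_unique heM₀ hepos hip hiw hM₀v (coord_valid F.b_mem u ((hmemB M).1 hM).1)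
      hM₀n (hBn M hM).1 h1 h2 h3 hMs hy (hTp.symm.trans hp)
  -- A term shorter than `N` gives only words shorter than `T`, a term of height above `n` gives
  -- only words of height above that of `T`, and the rest is excluded by the extremal choice.
  have hother : ∀ l, coord F.b_mem u l ≠ 0 → l ≠ M₀ →
      coord F.b_mem (der L F.b F.par (F.par e) (fun x => L.mul (F.b x) (F.dual e)) l) T = 0 := by
    intro l hl hlM
    rcases lt_or_ge l.length N with hlt | hge
    · exact coord_lower F.b_mem (der_mem_lower _ _ l) (by omega)
    · by_cases hph : n + 1 ≤ F.ph l
      · exact F.coord_der_of_ph hepos (coord_valid F.b_mem u hl) (by omega)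
      · have hlB : l ∈ B := (hmemB l).2 ⟨hl, by omega, by omega⟩
        have hlN : l.length = N := le_antisymm (hBN l hlB) hge
        refine coord_der_eq_zero F.b_mem (by omega) fun P x Q y hs hy hp => hlM ?_
        exact (huniq l hlB hlN P x Q y hs hy hp).1
  have hM₀ne : coord F.b_mem (der L F.b F.par (F.par e)
      (fun x => L.mul (F.b x) (F.dual e)) M₀) T ≠ 0 := by
    -- The derivation is split into the replacement of `e` by `c • b i` and a remainder; by
    -- uniqueness no replacement in the remainder arrives at `T`.
    set c := F.b.repr (L.mul (F.b e) (F.dual e)) i with hc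
    let g₁ : ι → V := fun x => if x = e then c • F.b i else 0
    let g₂ : ι → V := fun x => L.mul (F.b x) (F.dual e) - g₁ x
    have hg : (fun x => L.mul (F.b x) (F.dual e)) = fun x => g₂ x + g₁ x := by
      funext x
      simp [g₂]
    have hg₁ : der L F.b F.par (F.par e) g₁ M₀ =
        c • der L F.b F.par (F.par e) (fun x => if x = e then F.b i else 0) M₀ := by
      have hsm : ∀ l, der L F.b F.par (F.par e) g₁ l =
          c • der L F.b F.par (F.par e) (fun x => if x = e then F.b i else 0) l := by
        intro l
        induction l with
        | nil => simp [der]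
        | cons x l ih =>
          rw [der, der, ih]
          by_cases hx : x = e
          · simp only [g₁, if_pos hx, map_smul, smul_mul_assoc, mul_smul_comm, smul_add]
            rw [smul_comm c]
          · simp [g₁, if_neg hx]
      exact hsm M₀
    have hg₂ : coord F.b_mem (der L F.b F.par (F.par e) g₂ M₀) T = 0 := by
      refine coord_der_eq_zero F.b_mem (by omega) fun P x Q y hs hy hp => ?_
      by_cases hx : x = e
      · subst hx
        have hy' : F.b.repr (L.mul (F.b x) (F.dual x)) y ≠ 0 := by
          intro h0
          have hyi : y ≠ i := fun h => hi (by rw [hc, ← h, h0])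
          apply hy
          simp [g₂, g₁, h0, Finsupp.single_eq_of_ne hyi]
        obtain ⟨-, -, rfl⟩ := huniq M₀ hM₀B hM₀l P x Q y hs hy' hp
        apply hy
        simp [g₂, g₁, hc]
      · have hy' : F.b.repr (L.mul (F.b x) (F.dual e)) y ≠ 0 := by
          simpa [g₂, g₁, hx] using hy
        exact hx (huniq M₀ hM₀B hM₀l P x Q y hs hy' hp).2.1
    rw [hg, der_add, map_add, Finsupp.add_apply, hg₂, zero_add, hg₁, map_smul,
      Finsupp.smul_apply, smul_eq_mul]
    exact mul_ne_zero hi (coord_der_single_ne_zero F.b_mem hip hM₀v heM₀ hT hTp)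
  rw [F.comm_eq_sum hu hepos, Finsupp.sum, map_sum, Finsupp.finsetSum_apply,
    Finset.sum_eq_single_of_mem M₀ (Finsupp.mem_support_iff.2 ((hmemB M₀).1 hM₀B).1)] at hzero
  · rw [map_smul, Finsupp.smul_apply, smul_eq_mul] at hzero
    exact (mul_ne_zero ((hmemB M₀).1 hM₀B).1 hM₀ne) hzero
  · intro l hl hlM
    rw [map_smul, Finsupp.smul_apply, hother l (Finsupp.mem_support_iff.1 hl) hlM, smul_zero]

end TriangularData.Frame

end SuperLie

end

noncomputable section

namespace SuperLie

open Module Finsupp PBW Topology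

namespace TriangularData

variable {I H : Type*} [Fintype I] [AddCommGroup H] [Module ℂ H]
  {V : Type*} [AddCommGroup V] [Module ℂ V] {L : LieSuperalgebra V} (D : TriangularData I H L)

/-! ### Neighbourhoods of zero in the completion -/

/-- The closure in `Û` of the image of `J(ν)`. -/
def hatJ (ν : I → ℤ) : AddSubgroup D.UHat :=
  ((D.J ν).toAddSubgroup.map D.toHat.toAddMonoidHom).topologicalClosure

theorem hatJ_anti {ν ν' : I → ℤ} (h : ν ≤ ν') : D.hatJ ν' ≤ D.hatJ ν :=
  closure_mono (Set.image_mono (D.J_anti h))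

theorem J_mem_nhds (ν : I → ℤ) : (D.J ν : Set (Env L)) ∈ 𝓝 (0 : D.U) :=
  (D.subgroupsBasis.hasBasis_nhds_zero).mem_of_mem (i := ν) trivial

/-- An open subgroup is closed. -/
theorem isClosed_J (ν : I → ℤ) : IsClosed (X := D.U) (D.J ν : Set (Env L)) := by
  have h : ∀ S : AddSubgroup D.U, (S : Set D.U) ∈ 𝓝 0 → IsClosed (S : Set D.U) := fun S hS =>
    S.isClosed_of_isOpen (S.isOpen_of_mem_nhds hS)
  exact h (D.J ν).toAddSubgroup (D.J_mem_nhds ν)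

/-- Since U(𝔤) carries the topology induced from Û, the closure of the image of J(ν) pulls back to
the closure of J(ν), which is J(ν) itself. Membership can thus be tested in coordinates. -/
theorem toHat_mem_hatJ {ν : I → ℤ} {u : Env L} : D.toHat u ∈ D.hatJ ν ↔ u ∈ D.J ν := by
  have h := (UniformSpace.Completion.isDenseInducing_coe (α := D.U)).isInducing
    |>.closure_eq_preimage_closure_image (D.J ν : Set (Env L))
  rw [(D.isClosed_J ν).closure_eq] at h
  exact (Set.ext_iff.1 h u).symm

theorem hatJ_mem_nhds (ν : I → ℤ) : (D.hatJ ν : Set D.UHat) ∈ 𝓝 (0 : D.UHat) :=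
  (UniformSpace.Completion.isDenseInducing_coe (α := D.U)).closure_image_mem_nhds (D.J_mem_nhds ν)

/-- Û is a Hausdorff topological group, hence regular: a closed neighbourhood of zero avoiding `z`
contains the image of some J(ν) and therefore its closure. -/
theorem eq_zero_of_forall_mem_hatJ {z : D.UHat} (h : ∀ ν, z ∈ D.hatJ ν) : z = 0 := by
  by_contra hz
  obtain ⟨W, ⟨hW, hWc⟩, hWz⟩ := (closed_nhds_basis (0 : D.UHat)).mem_iff.1
    (isOpen_ne.mem_nhds (Ne.symm hz) : {w : D.UHat | w ≠ z} ∈ 𝓝 0)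
  have hpre : ((↑) : D.U → D.UHat) ⁻¹' W ∈ 𝓝 (0 : D.U) :=
    (UniformSpace.Completion.continuous_coe D.U).continuousAt.preimage_mem_nhds
      (by rw [UniformSpace.Completion.coe_zero]; exact hW)
  obtain ⟨ν, -, hν⟩ := D.subgroupsBasis.hasBasis_nhds_zero.mem_iff.1 hpre
  exact hWz (closure_minimal (Set.image_subset_iff.2 hν) hWc (h ν)) rfl

theorem mul_toHat_mem_hatJ {ν ν' : I → ℤ} {v : Env L} (h : ∀ u ∈ D.J ν', u * v ∈ D.J ν)
    {w : D.UHat} (hw : w ∈ D.hatJ ν') : w * D.toHat v ∈ D.hatJ ν := by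
  refine map_mem_closure (f := fun w => w * D.toHat v) (continuous_id.mul continuous_const) hw ?_
  rintro _ ⟨u, hu, rfl⟩
  exact ⟨u * v, h u hu, map_mul D.toHat u v⟩

theorem toHat_mul_mem_hatJ {ν : I → ℤ} (v : Env L) {w : D.UHat} (hw : w ∈ D.hatJ ν) :
    D.toHat v * w ∈ D.hatJ ν := by
  refine map_mem_closure (f := fun w => D.toHat v * w) (continuous_const.mul continuous_id) hw ?_
  rintro _ ⟨u, hu, rfl⟩
  exact ⟨v * u, Ideal.mul_mem_left _ _ hu, map_mul D.toHat v u⟩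

theorem toHat_mem_hatPart {p : ZMod 2} {u : Env L} (hu : u ∈ Env.part L p) :
    D.toHat u ∈ D.hatPart p :=
  subset_closure ⟨u, hu, rfl⟩

theorem exists_sub_mem_hatJ {p : ZMod 2} {z : D.UHat} (hz : z ∈ D.hatPart p) (ν : I → ℤ) :
    ∃ u ∈ Env.part L p, z - D.toHat u ∈ D.hatJ ν := by
  have h : (fun w => z - w) ⁻¹' (D.hatJ ν : Set D.UHat) ∈ 𝓝 z :=
    (continuous_const.sub continuous_id).continuousAt.preimage_mem_nhds
      (by simpa using D.hatJ_mem_nhds ν)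
  obtain ⟨_, hw, u, hu, rfl⟩ := mem_closure_iff_nhds.1 hz _ h
  exact ⟨u, hu, hw⟩

theorem ι_mem_part {q : ZMod 2} {x : V} (hx : x ∈ L.part q) : Env.ι L x ∈ Env.part L q := by
  have h := Env.IsMonomial.mul hx (Env.IsMonomial.one (L := L))
  rw [add_zero, mul_one] at h
  exact Submodule.subset_span h

/-! ### Supercentral elements of the completion come from U(𝔤) -/

namespace Frame

variable {D} {ι : Type*} [LinearOrder ι] (F : D.Frame ι)

theorem coord_eq_of_sub_mem_J {ν : I → ℤ} {u v : Env L} (h : u - v ∈ D.J ν) {l : List ι}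
    (hl : ¬ ν ≤ F.pw l) : coord F.b_mem u l = coord F.b_mem v l := by
  by_contra hne
  exact hl (F.mem_J_iff.1 h l (by rwa [map_sub, Finsupp.sub_apply, sub_ne_zero]))

theorem not_le_pw_add_one [Nonempty I] (l : List ι) : ¬ F.pw l + 1 ≤ F.pw l := by
  intro h
  have := h (Classical.arbitrary I)
  simp at this

/-- An element of the kernel lies in every J(ν), and a monomial `l` is excluded by J(`pw l` + 1).
With an empty index set the latter fails, as J(0) is everything. -/
theorem toHat_injective (F : D.Frame ι) [Nonempty I] : Function.Injective D.toHat := by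
  rw [injective_iff_map_eq_zero]
  intro u hu
  refine coord_injective F.b_mem (Finsupp.ext fun l => ?_)
  refine F.coord_eq_of_sub_mem_J (ν := F.pw l + 1) ?_ (F.not_le_pw_add_one l)
  rw [sub_zero, ← D.toHat_mem_hatJ, hu]
  exact zero_mem _

/-- The supercommutator of the approximation with a dual vector equals, up to sign, that of the
error `z - u`. It lies in the closure of J(ν), hence in J(ν), if the approximation is good enough.
-/
theorem exists_approx (F : D.Frame ι) [Finite ι] {p : ZMod 2} {z : D.UHat} (hz : z ∈ superCentrePart D.hatPart p)
    (ν : I → ℤ) : ∃ u ∈ Env.part L p, z - D.toHat u ∈ D.hatJ ν ∧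
      ∀ e, 0 < F.weight e → F.comm p e u ∈ D.J ν := by
  have := Fintype.ofFinite ι
  -- Right multiplication is continuous but not uniformly so; as there are finitely many dual
  -- vectors, one bound serves for all of them.
  choose ν' hν' using fun e => D.exists_J_mul (Env.ι L (F.dual e)) ν
  obtain ⟨M, hM⟩ := (Finset.univ.image ν').exists_le
  obtain ⟨u, hu, hzu⟩ := D.exists_sub_mem_hatJ hz.1 (M ⊔ ν)
  refine ⟨u, hu, D.hatJ_anti le_sup_right hzu, fun e he => ?_⟩
  rw [← D.toHat_mem_hatJ]
  have h1 := D.mul_toHat_mem_hatJ (hν' e) (D.hatJ_anti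
    ((hM _ (Finset.mem_image_of_mem _ (Finset.mem_univ e))).trans le_sup_left) hzu)
  have h2 := D.toHat_mul_mem_hatJ (Env.ι L (F.dual e)) (D.hatJ_anti le_sup_right hzu)
  have h3 := hz.2 _ _ (D.toHat_mem_hatPart (ι_mem_part (F.dual_mem e he)))
  rw [sub_mul, h3] at h1
  rw [mul_sub] at h2
  by_cases h : p = 1 ∧ F.par e = 1
  · rw [if_pos h] at h1
    rw [comm, sgn, if_pos h, neg_one_smul, map_sub, map_neg, map_mul, map_mul]
    convert neg_mem (add_mem h1 h2) using 1
    abel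
  · rw [if_neg h] at h1
    rw [comm, sgn, if_neg h, one_smul, map_sub, map_mul, map_mul]
    convert sub_mem h2 h1 using 1
    abel

/-- There are finitely many letters, so `d` of them have bounded total weight; the summand 1 makes
the bound strict in each coordinate. -/
theorem exists_forall_length_le [Finite ι] [Nonempty I] (d : ℕ) :
    ∃ ν : I → ℤ, ∀ l : List ι, l.length ≤ d → ¬ ν ≤ F.pw l := by
  have := Fintype.ofFinite ι
  obtain ⟨M, hM⟩ := (Finset.univ.image F.posWeight).exists_le
  have hM' : ∀ i, F.posWeight i ≤ M := fun i => hM _ (Finset.mem_image_of_mem _ (Finset.mem_univ i))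
  have hM0 : 0 ≤ M ⊔ 0 := le_sup_right
  refine ⟨d • (M ⊔ 0) + 1, fun l hl h => ?_⟩
  have h1 : F.pw l ≤ l.length • (M ⊔ 0) := by
    have := List.sum_le_card_nsmul (l.map F.posWeight) (M ⊔ 0) (by
      simpa using fun i _ => (hM' i).trans le_sup_left)
    rwa [List.length_map] at this
  have h2 := (h.trans h1).trans (nsmul_le_nsmul_left hM0 hl) (Classical.arbitrary I)
  simp at h2

/-- The degree bound for all approximations is independent of ν, so cutting them at that degree
gives elements of U(𝔤) that still approximate `z` and are eventually constant. -/
theorem exists_eq_toHat (F : D.Frame ι) [Finite ι] [Nonempty I] {p : ZMod 2} {z : D.UHat}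
    (hz : z ∈ superCentrePart D.hatPart p) : ∃ g ∈ Env.part L p, z = D.toHat g := by
  classical
  choose u hup hzu hcomm using F.exists_approx hz
  have hdiff : ∀ {ν ν'}, ν ≤ ν' → u ν' - u ν ∈ D.J ν := fun {ν ν'} h => by
    rw [← D.toHat_mem_hatJ, map_sub]
    convert sub_mem (hzu ν) (D.hatJ_anti h (hzu ν')) using 1
    abel
  have hht : ∀ {c : ℤ}, 0 ≤ c → c ≤ height (fun _ : I => c) := fun {c} hc => by
    have : height (fun _ : I => c) = Fintype.card I * c := by simp [height]
    rw [this]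
    exact le_mul_of_one_le_left hc (by exact_mod_cast Fintype.card_pos (α := I))
  -- The degree bound is read off from a single approximation. Terms in J(ν₁) have height at least
  -- one because `I` is nonempty, and the other terms are common to all finer approximations; this
  -- starts the induction on the height.
  let ν₁ : I → ℤ := fun _ => 1
  let d : ℕ := (coord F.b_mem (u ν₁)).support.sup List.length
  have hstep : ∀ ν, ν₁ ≤ ν → ∀ n : ℕ, (n : ℤ) ≤ height ν → ∀ l, coord F.b_mem (u ν) l ≠ 0 →
      l.length ≤ d ∨ (n : ℤ) + 1 ≤ F.ph l := by
    intro ν hν n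
    induction n with
    | zero =>
      intro _ l hl
      by_cases hle : ν₁ ≤ F.pw l
      · refine Or.inr (le_trans ?_ (height_mono hle))
        simpa using hht (c := 1) zero_le_one
      · rw [F.coord_eq_of_sub_mem_J (hdiff hν) hle] at hl
        exact Or.inl (Finset.le_sup (f := List.length) (Finsupp.mem_support_iff.2 hl))
    | succ n ih =>
      intro hn
      have hn' : (n : ℤ) + 1 ≤ height ν := by exact_mod_cast hn
      have := F.length_le_or_succ_le_ph (hup ν) (n := (n : ℤ) + 1) (by omega)
        (ih (by omega)) fun e he l hl =>
          hn'.trans (height_mono (F.mem_J_iff.1 (hcomm ν e he) l hl))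
      exact_mod_cast this
  have hlong : ∀ ν, ν₁ ≤ ν → ∀ l, coord F.b_mem (u ν) l ≠ 0 → l.length ≤ d ∨ ν ≤ F.pw l := by
    intro ν hν l hl
    by_contra! h
    -- The height of `ν` itself may be too small compared with that of `l`. A finer approximation
    -- has the same coefficient at `l`, since `l` is outside J(ν), and there `hstep` applies with
    -- the height of `l`.
    let ν₂ : I → ℤ := ν ⊔ fun _ => F.ph l
    have h0 : 0 ≤ F.ph l := (map_zero height).symm.le.trans (height_mono (F.pw_nonneg l))
    have hν₂ : F.ph l ≤ height ν₂ := (hht h0).trans (height_mono le_sup_right)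
    rw [← F.coord_eq_of_sub_mem_J (hdiff (le_sup_left : ν ≤ ν₂)) h.2] at hl
    have := hstep ν₂ (hν.trans le_sup_left) (F.ph l).toNat (by omega) l hl
    omega
  -- The discarded terms have degree above `d`, so by `hlong` they lie in J(ν) as soon as `ν₁ ≤ ν`.
  choose g hg hg' using fun ν => exists_truncation F.b_mem (u ν) fun l => l.length ≤ d
  have hgu : ∀ ν, ν₁ ≤ ν → u ν - g ν ∈ D.J ν := fun ν hν => F.mem_J_iff.2 fun l hl => by
    rw [map_sub, Finsupp.sub_apply] at hl
    by_cases h : l.length ≤ d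
    · rw [hg ν l h, sub_self] at hl
      exact absurd rfl hl
    · rw [hg' ν l h, sub_zero] at hl
      exact (hlong ν hν l hl).resolve_left h
  have hzg : ∀ ν, ν₁ ≤ ν → z - D.toHat (g ν) ∈ D.hatJ ν := fun ν hν => by
    have h := D.toHat_mem_hatJ.2 (hgu ν hν)
    rw [map_sub] at h
    convert add_mem (hzu ν) h using 1
    abel
  obtain ⟨ν₀, hν₀⟩ := F.exists_forall_length_le d
  -- No word of length at most `d` lies in J(ν₀), so the coefficients of the truncations are
  -- determined modulo J(ν₀).
  have hconst : ∀ ν, ν₁ ⊔ ν₀ ≤ ν → g ν = g (ν₁ ⊔ ν₀) := by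
    intro ν hν
    refine coord_injective F.b_mem (Finsupp.ext fun l => ?_)
    by_cases h : l.length ≤ d
    · refine F.coord_eq_of_sub_mem_J (ν := ν₁ ⊔ ν₀) ?_ fun h' => hν₀ l h (le_sup_right.trans h')
      rw [← D.toHat_mem_hatJ, map_sub]
      convert sub_mem (hzg _ le_sup_left)
        (D.hatJ_anti hν (hzg ν (le_sup_left.trans hν))) using 1
      abel
    · rw [hg' _ l h, hg' _ l h]
  refine ⟨g (ν₁ ⊔ ν₀), F.mem_part_iff.2 fun l hl => ?_, ?_⟩
  · by_cases h : l.length ≤ d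
    · rw [hg _ l h] at hl
      exact F.mem_part_iff.1 (hup _) l hl
    · exact absurd (hg' _ l h) hl
  · rw [← sub_eq_zero]
    refine D.eq_zero_of_forall_mem_hatJ fun ν => ?_
    have h1 : ν₁ ⊔ ν₀ ≤ ν ⊔ (ν₁ ⊔ ν₀) := le_sup_right
    rw [← hconst _ h1]
    exact D.hatJ_anti le_sup_left (hzg _ (le_sup_left.trans h1))

/-- Injectivity transfers the commutation relations back to U(𝔤). Conversely the relation with a
fixed `g` is a closed condition on the other factor, and it holds on the dense image of U(𝔤)_q in
Û_q. -/
theorem superCentrePart_hatPart (F : D.Frame ι) [Finite ι] [Nonempty I] (p : ZMod 2) :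
    superCentrePart D.hatPart p =
      (superCentrePart (Env.part L) p).map D.toHat.toAddMonoidHom := by
  ext z
  constructor
  · intro hz
    obtain ⟨g, hg, rfl⟩ := F.exists_eq_toHat hz
    refine ⟨g, ⟨hg, fun q v hv => F.toHat_injective ?_⟩, rfl⟩
    have h := hz.2 q _ (D.toHat_mem_hatPart hv)
    rw [map_mul, h]
    split_ifs <;> simp
  · rintro ⟨g, ⟨hg, hg'⟩, rfl⟩
    refine ⟨D.toHat_mem_hatPart hg, fun q w hw => ?_⟩
    have hcl : IsClosed {w : D.UHat | D.toHat g * w =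
        if p = 1 ∧ q = 1 then -(w * D.toHat g) else w * D.toHat g} := by
      refine isClosed_eq (continuous_const.mul continuous_id) ?_
      split_ifs
      · exact (continuous_id.mul continuous_const).neg
      · exact continuous_id.mul continuous_const
    refine closure_minimal ?_ hcl hw
    rintro _ ⟨v, hv, rfl⟩
    have h := congrArg D.toHat (hg' q v hv)
    change D.toHat g * D.toHat v = if p = 1 ∧ q = 1 then -(D.toHat v * D.toHat g)
      else D.toHat v * D.toHat g
    rw [← map_mul, h]
    split_ifs <;> simp

theorem centreHat_eq_centreImage (F : D.Frame ι) [Finite ι] [Nonempty I] : D.centreHat = D.centreImage := by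
  rw [centreHat, centreImage, superCentre, Env.centre, superCentre, AddSubgroup.map_sup,
    F.superCentrePart_hatPart, F.superCentrePart_hatPart]

end Frame

end TriangularData

end SuperLie

end

noncomputable section

namespace SuperLie

open Module

namespace TriangularData

variable {I H : Type*} [Fintype I] [AddCommGroup H] [Module ℂ H]
  {V : Type*} [AddCommGroup V] [Module ℂ V] {L : LieSuperalgebra V}

/-! ### Dual families in `𝔫⁺` and `𝔫⁻` -/

/-- A homogeneous basis `e` of `𝔫⁺` consisting of vectors of positive weight together with vectors
`f` of the opposite weights and the same parities, such that `[e_a, f_a] ≠ 0` and `[e_b, f_a]` is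
odd for all other `b` with `e_b` of the same weight as `e_a`. -/
structure Pairing (D : TriangularData I H L) (κ : Type*) where
  e : κ → V
  f : κ → V
  par : κ → ZMod 2
  weight : κ → I → ℤ
  weight_pos : ∀ a, 0 < weight a
  e_mem : ∀ a, e a ∈ L.part (par a)
  f_mem : ∀ a, f a ∈ L.part (par a)
  e_mem_nPos : ∀ a, e a ∈ D.nPos
  e_weight : ∀ a t, L.mul (D.cartan t) (e a) = wt D.root (weight a) t • e a
  f_weight : ∀ a t, L.mul (D.cartan t) (f a) = wt D.root (-weight a) t • f a
  e_indep : LinearIndependent ℂ e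
  nPos_le : D.nPos ≤ Submodule.span ℂ (Set.range e)
  bracket_ne : ∀ a, L.mul (e a) (f a) ≠ 0
  bracket_odd : ∀ a b, a ≠ b → weight a = weight b → L.mul (e b) (f a) ∈ L.part 1

/-- A well-order of the set breaks the ties in the lexicographic order by rank. -/
theorem exists_linearOrder_of_rank {B : Type*} (r : B → ℕ) :
    ∃ _ : LinearOrder B, ∀ x y, r x < r y → x < y := by
  let _ : LinearOrder B := IsWellOrder.linearOrder WellOrderingRel
  let φ : B → ℕ ×ₗ B := fun x => toLex (r x, x)
  have hφ : Function.Injective φ := fun x y h => congrArg (fun z => (ofLex z).2) h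
  exact ⟨LinearOrder.lift' φ hφ, fun x y h => Prod.Lex.lt_iff.2 (Or.inl h)⟩

namespace Pairing

variable {D : TriangularData I H L} {κ : Type*} (P : D.Pairing κ)

theorem span_range_e : Submodule.span ℂ (Set.range P.e) = D.nPos :=
  le_antisymm (Submodule.span_le.2 (by rintro _ ⟨a, rfl⟩; exact P.e_mem_nPos a)) P.nPos_le

theorem top_le_span : ⊤ ≤ Submodule.span ℂ (Set.range P.e ∪ {x | (∃ p, x ∈ L.part p) ∧
    ∃ γ : I → ℤ, (∀ t, L.mul (D.cartan t) x = wt D.root γ t • x) ∧ γ ≤ 0}) := by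
  refine D.top_le.trans (Submodule.span_le.2 ?_)
  rintro x ⟨hp, γ, hγ, h | h⟩
  · exact Submodule.span_mono Set.subset_union_left (P.nPos_le h)
  · exact Submodule.subset_span (Or.inr ⟨hp, γ, hγ, h⟩)

/-- A dual family extends to a frame. -/
theorem exists_frame (P : D.Pairing κ) :
    ∃ (B : Set V) (_ : LinearOrder B), Nonempty (D.Frame B) := by
  classical
  have hs : LinearIndepOn ℂ id (Set.range P.e) := P.e_indep.linearIndepOn_id
  let b := Basis.extendLe hs Set.subset_union_left P.top_le_span
  have hb : ∀ x, b x = x := fun x => Basis.extendLe_apply_self _ _ _ x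
  let B := hs.extend (Set.subset_union_left : Set.range P.e ⊆ Set.range P.e ∪
    {x | (∃ p, x ∈ L.part p) ∧ ∃ γ : I → ℤ, (∀ t, L.mul (D.cartan t) x = wt D.root γ t • x) ∧
      γ ≤ 0})
  have hdata : ∀ x : B, ∃ (p : ZMod 2) (γ : I → ℤ) (y : V), (x : V) ∈ L.part p ∧
      (∀ t, L.mul (D.cartan t) (x : V) = wt D.root γ t • (x : V)) ∧
      ((∃ a, (x : V) = P.e a ∧ p = P.par a ∧ γ = P.weight a ∧ y = P.f a) ∨
        ((x : V) ∉ Set.range P.e ∧ γ ≤ 0)) := by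
    intro x
    by_cases hx : (x : V) ∈ Set.range P.e
    · obtain ⟨a, ha⟩ := hx
      exact ⟨P.par a, P.weight a, P.f a, by rw [← ha]; exact P.e_mem a,
        by rw [← ha]; exact P.e_weight a, Or.inl ⟨a, ha.symm, rfl, rfl, rfl⟩⟩
    · obtain ⟨⟨p, hp⟩, γ, hγ, h0⟩ := (hs.extend_subset _ x.2).resolve_left hx
      exact ⟨p, γ, 0, hp, hγ, Or.inr ⟨hx, h0⟩⟩
  choose p γ y hp hγ h using hdata
  have hpos : ∀ x : B, 0 < γ x → ∃ a, (x : V) = P.e a ∧ p x = P.par a ∧ γ x = P.weight a ∧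
      y x = P.f a := fun x hx => (h x).resolve_right fun h' => h'.2.not_gt hx
  -- With this rank the vectors of 𝔫⁺ come last, as a frame demands.
  let r : B → ℕ := fun x => if (x : V) ∈ Set.range P.e then 1 else 0
  obtain ⟨_, hlt⟩ := exists_linearOrder_of_rank r
  refine ⟨B, inferInstance, ⟨?_⟩⟩
  exact
    { b := b
      par := p
      weight := γ
      b_mem := fun x => by rw [hb]; exact hp x
      b_weight := fun x t => by rw [hb]; exact hγ x t
      pos_or := fun x => by
        rcases h x with ⟨a, -, -, ha, -⟩ | ⟨-, h0⟩
        · exact Or.inl (by rw [ha]; exact P.weight_pos a)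
        · exact Or.inr h0
      b_mem_nPos := fun x hx => by
        obtain ⟨a, ha, -⟩ := hpos x hx
        rw [hb, ha]
        exact P.e_mem_nPos a
      nPos_le_span := by
        refine P.nPos_le.trans (Submodule.span_mono ?_)
        rintro _ ⟨a, rfl⟩
        refine ⟨⟨P.e a, hs.subset_extend _ ⟨a, rfl⟩⟩, ?_, hb _⟩
        rcases h ⟨P.e a, hs.subset_extend _ ⟨a, rfl⟩⟩ with ⟨a', -, -, ha, -⟩ | ⟨h0, -⟩
        · change 0 < γ _
          rw [ha]
          exact P.weight_pos a'
        · exact absurd ⟨a, rfl⟩ h0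
      lt_of_pos := fun x x' hx hx' => by
        refine hlt x x' ?_
        have h1 : (x : V) ∉ Set.range P.e := by
          rcases h x with ⟨a, -, -, ha, -⟩ | ⟨h0, -⟩
          · exact absurd (P.weight_pos a) (by rw [← ha]; exact hx.not_gt)
          · exact h0
        obtain ⟨a, ha, -⟩ := hpos x' hx'
        have h2 : (x' : V) ∈ Set.range P.e := ⟨a, ha.symm⟩
        simp only [r, if_neg h1, if_pos h2, zero_lt_one]
      dual := y
      dual_mem := fun x hx => by
        obtain ⟨a, -, h1, -, h2⟩ := hpos x hx
        rw [h1, h2]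
        exact P.f_mem a
      dual_weight := fun x hx t => by
        obtain ⟨a, -, -, h1, h2⟩ := hpos x hx
        rw [h1, h2]
        exact P.f_weight a t
      bracket_dual_ne := fun x hx => by
        obtain ⟨a, h1, -, -, h2⟩ := hpos x hx
        rw [hb, h1, h2]
        exact P.bracket_ne a
      bracket_dual_odd := fun x x' hx hne heq => by
        obtain ⟨a, h1, -, h3, h2⟩ := hpos x hx
        obtain ⟨a', h1', -, h3', -⟩ := hpos x' (by rw [← heq]; exact hx)
        rw [hb, h1', h2]
        refine P.bracket_odd a a' ?_ (by rw [← h3, ← h3', heq])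
        rintro rfl
        exact hne (Subtype.ext (h1.trans h1'.symm)) }

/-- Finite dimension of 𝔤 enters here: the basis of the frame is finite. -/
theorem toHat_injective_and_centre [FiniteDimensional ℂ V] [Nonempty I] (P : D.Pairing κ) :
    Function.Injective D.toHat ∧ D.centreHat = D.centreImage := by
  obtain ⟨B, _, ⟨F⟩⟩ := P.exists_frame
  have : Finite B := Module.Finite.finite_basis F.b
  exact ⟨F.toHat_injective, F.centreHat_eq_centreImage⟩

/-- The image of a dual family in a quotient. -/
def quotient (N : Submodule ℂ V) (hN : L.IsGradedIdeal N) (hdisj : Disjoint D.nPos N)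
    (hne : ∀ a, L.mul (P.e a) (P.f a) ∉ N) : (D.quotient N hN).Pairing κ where
  e a := N.mkQ (P.e a)
  f a := N.mkQ (P.f a)
  par := P.par
  weight := P.weight
  weight_pos := P.weight_pos
  e_mem a := ⟨_, P.e_mem a, rfl⟩
  f_mem a := ⟨_, P.f_mem a, rfl⟩
  e_mem_nPos a := ⟨_, P.e_mem_nPos a, rfl⟩
  e_weight a t := congrArg N.mkQ (P.e_weight a t)
  f_weight a t := congrArg N.mkQ (P.f_weight a t)
  e_indep := P.e_indep.map (by rwa [P.span_range_e, Submodule.ker_mkQ])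
  nPos_le := by
    change D.nPos.map N.mkQ ≤ _
    rw [← P.span_range_e, Submodule.map_span, ← Set.range_comp]
    rfl
  bracket_ne a h := hne a ((Submodule.Quotient.mk_eq_zero N).1 h)
  bracket_odd a b hab h := ⟨_, P.bracket_odd a b hab h, rfl⟩

end Pairing

end TriangularData

end SuperLie

end

noncomputable section

namespace SuperLie

open Module

/-! ### The `Q`-type Lie superalgebras -/

/-- The matrix units of `𝔮(n)`. -/
def qUnit (n : ℕ) (i j : Fin n) (p : ZMod 2) :
    Matrix (Fin n) (Fin n) ℂ × Matrix (Fin n) (Fin n) ℂ :=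
  if p = 0 then (Matrix.single i j 1, 0) else (0, Matrix.single i j 1)

theorem qUnit_zero (n : ℕ) (i j : Fin n) : qUnit n i j 0 = (Matrix.single i j 1, 0) := rfl

theorem qUnit_one (n : ℕ) (i j : Fin n) : qUnit n i j 1 = (0, Matrix.single i j 1) := rfl

theorem qUnit_mem (n : ℕ) (i j : Fin n) (p : ZMod 2) : qUnit n i j p ∈ (q n).part p := by
  rcases zmod_two_cases p with rfl | rfl
  · exact mem_qPart_zero.2 rfl
  · exact mem_qPart_one.2 rfl

theorem qUnit_weight (n : ℕ) (i j : Fin n) (p : ZMod 2) (t : Fin n → ℂ) :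
    (q n).mul ((qData n).cartan t) (qUnit n i j p) =
      wt (qData n).root (qWt n i j) t • qUnit n i j p := by
  rcases zmod_two_cases p with rfl | rfl
  · exact q_weight_fst n i j 1 t
  · exact q_weight_snd n i j 1 t

theorem qUnit_mem_qPos {n : ℕ} {i j : Fin n} (h : i < j) (p : ZMod 2) :
    qUnit n i j p ∈ qPos n := by
  rcases zmod_two_cases p with rfl | rfl
  · exact single_fst_mem_qPos h 1
  · exact single_snd_mem_qPos h 1

theorem trace_qUnit {n : ℕ} {i j : Fin n} (h : i ≠ j) (p : ZMod 2) :
    (qUnit n i j p).2.trace = 0 := by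
  rcases zmod_two_cases p with rfl | rfl
  · exact Matrix.trace_zero _ _
  · exact Matrix.trace_single_eq_of_ne _ _ _ h

theorem qWt_pos {n : ℕ} {i j : Fin n} (h : i < j) : 0 < qWt n i j := by
  have h' : i.1 < j.1 := h
  refine Pi.lt_def.2 ⟨fun k => ?_, ⟨i.1, by omega⟩, ?_⟩
  · simp only [qWt, Pi.zero_apply]
    split_ifs <;> omega
  · simp [qWt, not_le.2 h]

theorem qWt_neg (n : ℕ) (i j : Fin n) : -qWt n i j = qWt n j i := by
  funext k
  simp [qWt]

/-- For `i < j` the coordinates of the root form the indicator function of the interval from `i` to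
`j - 1`, which determines its end points. -/
theorem qWt_injective {n : ℕ} {i j i' j' : Fin n} (h : i < j) (h' : i' < j')
    (heq : qWt n i j = qWt n i' j') : i = i' ∧ j = j' := by
  have h1 : i.1 < j.1 := h
  have h2 : i'.1 < j'.1 := h'
  have key : ∀ k : ℕ, k < n - 1 → (i.1 ≤ k ∧ k < j.1 ↔ i'.1 ≤ k ∧ k < j'.1) := by
    intro k hk
    have := congrFun heq ⟨k, hk⟩
    simp only [qWt] at this
    split_ifs at this <;> omega
  have a1 := key i.1 (by omega)
  have a2 := key i'.1 (by omega)
  have a3 := key (j.1 - 1) (by omega)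
  have a4 := key (j'.1 - 1) (by omega)
  exact ⟨Fin.ext (by omega), Fin.ext (by omega)⟩

/-- The bracket of opposite matrix units of the same parity. -/
theorem qUnit_mul_diag {n : ℕ} {i j : Fin n} (h : i ≠ j) (p : ZMod 2) (k : Fin n) :
    (qMul n (qUnit n i j p) (qUnit n j i p)).1 k k =
      (if k = i then 1 else 0) + if k = j then (if p = 0 then -1 else 1) else 0 := by
  rcases zmod_two_cases p with rfl | rfl
  · simp only [qUnit_zero, qMul_apply, Matrix.single_mul_single_same, Matrix.single_apply,
      Matrix.sub_apply, mul_zero, add_zero, mul_one, if_true]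
    grind
  · simp only [qUnit_one, qMul_apply, Matrix.single_mul_single_same, Matrix.single_apply,
      Matrix.add_apply, Matrix.sub_apply, mul_zero, mul_one, Matrix.zero_apply]
    grind

theorem qPos_le_span (n : ℕ) : qPos n ≤ Submodule.span ℂ
    (Set.range fun a : {x : Fin n × Fin n // x.1 < x.2} × ZMod 2 =>
      qUnit n a.1.1.1 a.1.1.2 a.2) := by
  intro X hX
  have hfst : ∀ i j c, (Matrix.single i j c, (0 : Matrix (Fin n) (Fin n) ℂ)) =
      c • qUnit n i j 0 := fun i j c => by simp [qUnit_zero]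
  have hsnd : ∀ i j c, ((0 : Matrix (Fin n) (Fin n) ℂ), Matrix.single i j c) =
      c • qUnit n i j 1 := fun i j c => by simp [qUnit_one]
  rw [q_decomp X]
  refine add_mem (sum_mem fun i _ => sum_mem fun j _ => ?_)
    (add_mem (sum_mem fun i _ => sum_mem fun j _ => ?_) ?_)
  · rcases lt_or_ge i j with h | h
    · rw [hfst]
      exact Submodule.smul_mem _ _ (Submodule.subset_span ⟨(⟨(i, j), h⟩, 0), rfl⟩)
    · rw [(hX i j h).1, Matrix.single_zero]
      exact zero_mem _
  · rcases lt_or_ge i j with h | h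
    · rw [hsnd]
      exact Submodule.smul_mem _ _ (Submodule.subset_span ⟨(⟨(i, j), h⟩, 1), rfl⟩)
    · rw [(hX i j h).2, ite_self, Matrix.single_zero]
      exact zero_mem _
  · have : (fun i => X.2 i i) = 0 := funext fun i => (hX i i le_rfl).2
    rw [this, Matrix.diagonal_zero']
    exact zero_mem _

theorem qUnit_indep (n : ℕ) : LinearIndependent ℂ
    (fun a : {x : Fin n × Fin n // x.1 < x.2} × ZMod 2 => qUnit n a.1.1.1 a.1.1.2 a.2) := by
  let φ : (Matrix (Fin n) (Fin n) ℂ × Matrix (Fin n) (Fin n) ℂ) →ₗ[ℂ]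
      ({x : Fin n × Fin n // x.1 < x.2} × ZMod 2 → ℂ) :=
    { toFun := fun X a => if a.2 = 0 then X.1 a.1.1.1 a.1.1.2 else X.2 a.1.1.1 a.1.1.2
      map_add' := by
        intro X Y
        funext a
        simp only [Prod.fst_add, Prod.snd_add, Matrix.add_apply, Pi.add_apply]
        split_ifs <;> rfl
      map_smul' := by
        intro c X
        funext a
        simp only [Prod.smul_fst, Prod.smul_snd, Matrix.smul_apply, Pi.smul_apply, RingHom.id_apply]
        split_ifs <;> rfl }
  refine LinearIndependent.of_comp φ ?_
  convert Pi.linearIndependent_single_one ({x : Fin n × Fin n // x.1 < x.2} × ZMod 2) ℂ using 1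
  funext ⟨⟨⟨i, j⟩, h⟩, p⟩ ⟨⟨⟨i', j'⟩, h'⟩, p'⟩
  rcases zmod_two_cases p with rfl | rfl <;> rcases zmod_two_cases p' with rfl | rfl <;>
    simp [φ, qUnit_zero, qUnit_one, Matrix.single_apply, Pi.single_apply, eq_comm]

/-- A positive root space of 𝔮(n) is spanned by one even and one odd matrix unit, so distinct units
of equal weight have opposite parities. -/
theorem qUnit_bracket_odd {n : ℕ} {a b : {x : Fin n × Fin n // x.1 < x.2} × ZMod 2} (hab : a ≠ b)
    (h : qWt n a.1.1.1 a.1.1.2 = qWt n b.1.1.1 b.1.1.2) :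
    (q n).mul (qUnit n b.1.1.1 b.1.1.2 b.2) (qUnit n a.1.1.2 a.1.1.1 a.2) ∈ (q n).part 1 := by
  obtain ⟨⟨⟨i, j⟩, hij⟩, p⟩ := a
  obtain ⟨⟨⟨i', j'⟩, hij'⟩, p'⟩ := b
  obtain ⟨rfl, rfl⟩ := qWt_injective hij hij' h
  have hp : p' + p = 1 := by
    have : p ≠ p' := by rintro rfl; exact hab rfl
    clear hab h
    revert p p'
    decide
  rw [← hp]
  exact (q n).mul_mem (qUnit_mem _ _ _ _) (qUnit_mem _ _ _ _)

/-- The dual families of matrix units in `𝔮(n)`. -/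
def qPairing (n : ℕ) : (qData n).Pairing ({x : Fin n × Fin n // x.1 < x.2} × ZMod 2) where
  e a := qUnit n a.1.1.1 a.1.1.2 a.2
  f a := qUnit n a.1.1.2 a.1.1.1 a.2
  par a := a.2
  weight a := qWt n a.1.1.1 a.1.1.2
  weight_pos a := qWt_pos a.1.2
  e_mem a := qUnit_mem _ _ _ _
  f_mem a := qUnit_mem _ _ _ _
  e_mem_nPos a := qUnit_mem_qPos a.1.2 _
  e_weight a t := qUnit_weight _ _ _ _ t
  f_weight a t := by rw [qWt_neg]; exact qUnit_weight _ _ _ _ t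
  e_indep := qUnit_indep n
  nPos_le := qPos_le_span n
  bracket_ne a h := by
    have h1 := qUnit_mul_diag a.1.2.ne a.2 a.1.1.1
    have h2 : qMul n (qUnit n a.1.1.1 a.1.1.2 a.2) (qUnit n a.1.1.2 a.1.1.1 a.2) = 0 := h
    rw [if_pos rfl, if_neg a.1.2.ne, h2] at h1
    simp at h1
  bracket_odd a b hab h := qUnit_bracket_odd hab h

/-- The dual families of matrix units in `𝔰𝔮(n)`. -/
def sqPairing (n : ℕ) : (sqData n).Pairing ({x : Fin n × Fin n // x.1 < x.2} × ZMod 2) where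
  e a := ⟨(qPairing n).e a, trace_qUnit a.1.2.ne _⟩
  f a := ⟨(qPairing n).f a, trace_qUnit a.1.2.ne' _⟩
  par := (qPairing n).par
  weight := (qPairing n).weight
  weight_pos := (qPairing n).weight_pos
  e_mem a := (qPairing n).e_mem a
  f_mem a := (qPairing n).f_mem a
  e_mem_nPos a := (qPairing n).e_mem_nPos a
  e_weight a t := Subtype.ext ((qPairing n).e_weight a t)
  f_weight a t := Subtype.ext ((qPairing n).f_weight a t)
  e_indep := LinearIndependent.of_comp (sqSubmodule n).subtype (qPairing n).e_indep
  nPos_le := by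
    intro X hX
    have h := (qPairing n).nPos_le hX
    have hr : Set.range (qPairing n).e = (sqSubmodule n).subtype ''
        Set.range (fun a => (⟨(qPairing n).e a, trace_qUnit a.1.2.ne _⟩ : sqSubmodule n)) := by
      rw [← Set.range_comp]
      rfl
    rw [hr, ← Submodule.map_span] at h
    obtain ⟨Y, hY, hYX⟩ := h
    rwa [Subtype.ext hYX] at hY
  bracket_ne a h := (qPairing n).bracket_ne a (congrArg Subtype.val h)
  bracket_odd a b hab h := (qPairing n).bracket_odd a b hab h

theorem eq_zero_of_smul_qId_mem_qPos {n : ℕ} (hn : 0 < n) {c : ℂ} (h : c • qId n ∈ qPos n) :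
    c = 0 := by
  have := (h ⟨0, hn⟩ ⟨0, hn⟩ le_rfl).1
  simpa [qId] using this

/-- The bracket has entry 1 at `i` and entry 0 at a third index. For `n = 2` there is no third
index, and the bracket of the two odd off-diagonal units is the identity. -/
theorem qUnit_mul_ne_smul_qId {n : ℕ} (hn : 3 ≤ n) {i j : Fin n} (h : i ≠ j) (p : ZMod 2) (c : ℂ) :
    c • qId n ≠ qMul n (qUnit n i j p) (qUnit n j i p) := by
  intro hc
  have hdiag : ∀ k, c = (qMul n (qUnit n i j p) (qUnit n j i p)).1 k k := fun k => by
    rw [← hc]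
    simp [qId]
  obtain ⟨k, hk⟩ := Finset.exists_mem_notMem_of_card_lt_card (s := {i, j}) (t := Finset.univ)
    (Finset.card_le_two.trans_lt (by rw [Finset.card_univ, Fintype.card_fin]; exact hn))
  have hk : k ≠ i ∧ k ≠ j := by simpa using hk
  have h1 := hdiag k
  have h2 := hdiag i
  rw [qUnit_mul_diag h, if_neg hk.1, if_neg hk.2] at h1
  rw [qUnit_mul_diag h, if_pos rfl, if_neg h, h1] at h2
  simp at h2

/-- The dual families of matrix units in `𝔭𝔮(n)`. -/
def pqPairing (n : ℕ) (hn : 3 ≤ n) :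
    (pqData n).Pairing ({x : Fin n × Fin n // x.1 < x.2} × ZMod 2) :=
  (qPairing n).quotient _ (isGradedIdeal_qId n)
    (by
      rw [Submodule.disjoint_def]
      intro x hx hxc
      obtain ⟨c, rfl⟩ := Submodule.mem_span_singleton.1 hxc
      rw [eq_zero_of_smul_qId_mem_qPos (by omega) hx, zero_smul])
    (by
      intro a ha
      obtain ⟨c, hc⟩ := Submodule.mem_span_singleton.1 ha
      exact qUnit_mul_ne_smul_qId hn a.1.2.ne _ c hc)

/-- The dual families of matrix units in `𝔭𝔰𝔮(n)`. -/
def psqPairing (n : ℕ) (hn : 3 ≤ n) :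
    (psqData n).Pairing ({x : Fin n × Fin n // x.1 < x.2} × ZMod 2) :=
  (sqPairing n).quotient _ (isGradedIdeal_sqId n)
    (by
      rw [Submodule.disjoint_def]
      intro x hx hxc
      obtain ⟨c, rfl⟩ := Submodule.mem_span_singleton.1 hxc
      rw [eq_zero_of_smul_qId_mem_qPos (by omega) hx, zero_smul])
    (by
      intro a ha
      obtain ⟨c, hc⟩ := Submodule.mem_span_singleton.1 ha
      exact qUnit_mul_ne_smul_qId hn a.1.2.ne _ c (congrArg Subtype.val hc))

theorem nonempty_fin_sub_one {n : ℕ} (hn : 2 ≤ n) : Nonempty (Fin (n - 1)) := ⟨⟨0, by omega⟩⟩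

end SuperLie

end

noncomputable section

namespace SuperLie

open Module PBW

/-! ### Homomorphisms from `𝔤̃(A, τ)` -/

section SuperPair

variable (A : Type*) [Ring A] [Algebra ℂ A]

/-- The supercommutator of pairs `(a₀, a₁)` with even part `a₀` and odd part `a₁`. -/
def superPairMul : (A × A) →ₗ[ℂ] (A × A) →ₗ[ℂ] (A × A) :=
  LinearMap.mk₂ ℂ
    (fun X Y => ((X.1 * Y.1 - Y.1 * X.1) + (X.2 * Y.2 + Y.2 * X.2),
      (X.1 * Y.2 - Y.2 * X.1) + (X.2 * Y.1 - Y.1 * X.2)))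
    (by intro X X' Y; ext1 <;> simp only [Prod.fst_add, Prod.snd_add] <;> noncomm_ring)
    (by
      intro c X Y
      ext1 <;> simp only [Prod.smul_fst, Prod.smul_snd, smul_mul_assoc, mul_smul_comm, smul_add,
        smul_sub])
    (by intro X Y Y'; ext1 <;> simp only [Prod.fst_add, Prod.snd_add] <;> noncomm_ring)
    (by
      intro c X Y
      ext1 <;> simp only [Prod.smul_fst, Prod.smul_snd, smul_mul_assoc, mul_smul_comm, smul_add,
        smul_sub])

theorem superPairMul_apply (X Y : A × A) : superPairMul A X Y =
    ((X.1 * Y.1 - Y.1 * X.1) + (X.2 * Y.2 + Y.2 * X.2),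
      (X.1 * Y.2 - Y.2 * X.1) + (X.2 * Y.1 - Y.1 * X.2)) := rfl

variable {A} in
/-- An element of `A`, placed in the component of parity `p`. -/
def superPairOf (p : ZMod 2) : A →ₗ[ℂ] A × A :=
  if p = 0 then LinearMap.inl ℂ A A else LinearMap.inr ℂ A A

variable {A}

theorem superPairOf_zero (a : A) : superPairOf 0 a = (a, 0) := rfl

theorem superPairOf_one (a : A) : superPairOf 1 a = (0, a) := rfl

theorem superPairOf_injective (p : ZMod 2) : Function.Injective (superPairOf p : A →ₗ[ℂ] A × A) := by
  rcases zmod_two_cases p with rfl | rfl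
  · exact LinearMap.inl_injective
  · exact LinearMap.inr_injective

theorem superPairOf_neg_smul (p : ZMod 2) (c : ℂ) (a : A) :
    superPairOf p (-(c • a)) = -(c • superPairOf p a) := by
  rw [map_neg, map_smul]

/-- The pair stands for `a₀ + ε a₁` with an odd `ε` that commutes with `A` and has square one. Any
associative algebra thus receives a grading, and the Verma module below need not be graded itself.
-/
theorem superPairMul_of (p p' : ZMod 2) (a b : A) :
    superPairMul A (superPairOf p a) (superPairOf p' b) =
      superPairOf (p + p') (a * b - sgn p p' • (b * a)) := by
  have h11 : (1 : ZMod 2) + 1 = 0 := rfl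
  rcases zmod_two_cases p with rfl | rfl <;> rcases zmod_two_cases p' with rfl | rfl <;>
    simp [superPairMul_apply, superPairOf_zero, superPairOf_one, h11, sgn]

variable (A)

/-- The Lie superalgebra `A ⊕ A` with the supercommutator. -/
def superPair : LieSuperalgebra (A × A) where
  mul := superPairMul A
  part p := LinearMap.range (superPairOf p)
  isCompl := by
    constructor
    · rw [Submodule.disjoint_def]
      rintro _ ⟨a, rfl⟩ ⟨b, hb⟩
      rw [superPairOf_zero, superPairOf_one] at hb
      have ha : 0 = a := (Prod.ext_iff.1 hb).1
      rw [← ha, map_zero]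
    · rw [codisjoint_iff, eq_top_iff]
      intro X _
      exact Submodule.mem_sup.2 ⟨_, ⟨X.1, rfl⟩, _, ⟨X.2, rfl⟩,
        by simp [superPairOf_zero, superPairOf_one]⟩
  mul_mem := by
    rintro p p' _ _ ⟨a, rfl⟩ ⟨b, rfl⟩
    rw [superPairMul_of]
    exact ⟨_, rfl⟩
  skew := by
    rintro p p' _ _ ⟨a, rfl⟩ ⟨b, rfl⟩
    rw [superPairMul_of, superPairMul_of, add_comm p', sgn_comm p', ← map_smul, ← map_neg, smul_sub,
      smul_smul, sgn_mul_self, one_smul, neg_sub]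
  jacobi := by
    rintro p p' _ _ ⟨a, rfl⟩ ⟨b, rfl⟩ Z
    rcases zmod_two_cases p with rfl | rfl <;> rcases zmod_two_cases p' with rfl | rfl <;>
      ext1 <;> simp [superPairMul_apply, superPairOf_zero, superPairOf_one, sgn] <;> noncomm_ring

end SuperPair

section Lift

variable {I H : Type*} (τ : I → ZMod 2) {V : Type*} [AddCommGroup V] [Module ℂ V]
  (L : LieSuperalgebra V) (φ : Gen I H → V)

/-- The values of a homomorphism on words in the generators. -/
def liftWord : FreeMagma (Gen I H) → V
  | FreeMagma.of x => φ x
  | FreeMagma.mul a b => L.mul (liftWord a) (liftWord b)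

/-- The homomorphism from the free superalgebra with given values on the generators. -/
def freeLift : (FreeMagma (Gen I H) →₀ ℂ) →ₗ[ℂ] V := Finsupp.linearCombination ℂ (liftWord L φ)

theorem freeLift_gen (x : Gen I H) : freeLift L φ (gen x) = φ x := by
  rw [freeLift, gen, Finsupp.linearCombination_single, one_smul]
  rfl

theorem freeLift_mul (x y : FreeMagma (Gen I H) →₀ ℂ) :
    freeLift L φ (freeMul _ x y) = L.mul (freeLift L φ x) (freeLift L φ y) := by
  have h : (freeMul (Gen I H)).compr₂ (freeLift L φ) = L.mul.compl₁₂ (freeLift L φ) (freeLift L φ) := by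
    ext a b
    simp only [LinearMap.comp_apply, LinearMap.compr₂_apply, LinearMap.compl₁₂_apply,
      Finsupp.lsingle_apply, freeMul_single, freeLift, Finsupp.linearCombination_single, one_smul,
      mul_one]
    rfl
  exact LinearMap.congr_fun₂ h x y

variable {φ}

theorem freeLift_mem (hφ : ∀ x, φ x ∈ L.part (genParity τ x)) {p : ZMod 2}
    {x : FreeMagma (Gen I H) →₀ ℂ} (hx : x ∈ (freeSuperalgebra τ).part p) :
    freeLift L φ x ∈ L.part p := by
  have hw : ∀ w, liftWord L φ w ∈ L.part (wordParity τ w) := by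
    intro w
    induction w with
    | ih1 x => exact hφ x
    | ih2 a b ha hb => exact L.mul_mem ha hb
  rw [freeLift, Finsupp.linearCombination_apply]
  refine Submodule.sum_mem _ fun w hw' => Submodule.smul_mem _ _ ?_
  have : wordParity τ w = p := hx hw'
  rw [← this]
  exact hw w

theorem isGradedIdeal_ker_freeLift (hφ : ∀ x, φ x ∈ L.part (genParity τ x)) :
    (freeSuperalgebra τ).IsGradedIdeal (LinearMap.ker (freeLift L φ)) where
  mul_left x y hy := by
    have h : freeLift L φ (freeMul _ x y) = 0 := by
      rw [freeLift_mul, LinearMap.mem_ker.1 hy, map_zero]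
    exact h
  mul_right {x} y hx := by
    have h : freeLift L φ (freeMul _ x y) = 0 := by
      rw [freeLift_mul, LinearMap.mem_ker.1 hx, map_zero, LinearMap.zero_apply]
    exact h
  graded {x y} hx hy h := by
    rw [LinearMap.mem_ker, map_add] at h
    refine (Submodule.disjoint_def.1 L.isCompl.disjoint) _ (freeLift_mem τ L hφ hx) ?_
    rw [eq_neg_of_add_eq_zero_left h]
    exact neg_mem (freeLift_mem τ L hφ hy)

variable [Fintype I] [AddCommGroup H] [Module ℂ H] {A : Matrix I I ℂ} (R : Realization A H)

/-- The universal property of 𝔤̃(A, τ): the Lie identities hold in the target, so only the relations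
between generators remain to be checked. -/
theorem relIdeal_le_ker_freeLift (hφ : ∀ x, φ x ∈ L.part (genParity τ x))
    (hadd : ∀ s t, φ (Gen.h (s + t)) = φ (Gen.h s) + φ (Gen.h t))
    (hsmul : ∀ (c : ℂ) t, φ (Gen.h (c • t)) = c • φ (Gen.h t))
    (hh : ∀ s t, L.mul (φ (Gen.h s)) (φ (Gen.h t)) = 0)
    (he : ∀ t i, L.mul (φ (Gen.h t)) (φ (Gen.e i)) = R.root i t • φ (Gen.e i))
    (hf : ∀ t i, L.mul (φ (Gen.h t)) (φ (Gen.f i)) = -(R.root i t • φ (Gen.f i)))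
    (hef : ∀ i, L.mul (φ (Gen.e i)) (φ (Gen.f i)) = φ (Gen.h (R.coroot i)))
    (hef_ne : ∀ i j, i ≠ j → L.mul (φ (Gen.e i)) (φ (Gen.f j)) = 0) :
    relIdeal τ R ≤ LinearMap.ker (freeLift L φ) := by
  refine sInf_le ⟨isGradedIdeal_ker_freeLift τ L hφ, fun x hx => ?_⟩
  rw [LinearMap.mem_ker]
  cases hx with
  | skew hx hy =>
    rw [map_add, map_smul, freeLift_mul, freeLift_mul,
      L.skew (freeLift_mem τ L hφ hx) (freeLift_mem τ L hφ hy), neg_add_cancel]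
  | jacobi hx hy z =>
    rw [map_sub, map_add, map_smul]
    simp only [freeLift_mul]
    rw [L.jacobi (freeLift_mem τ L hφ hx) (freeLift_mem τ L hφ hy), sub_self]
  | h_add s t => rw [map_sub, map_add, freeLift_gen, freeLift_gen, freeLift_gen, hadd, sub_self]
  | h_smul c t => rw [map_sub, map_smul, freeLift_gen, freeLift_gen, hsmul, sub_self]
  | hh s t => rw [freeLift_mul, freeLift_gen, freeLift_gen, hh]
  | he t i => rw [map_sub, map_smul, freeLift_mul, freeLift_gen, freeLift_gen, he, sub_self]
  | hf t i => rw [map_add, map_smul, freeLift_mul, freeLift_gen, freeLift_gen, hf, neg_add_cancel]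
  | ef i => rw [map_sub, freeLift_mul, freeLift_gen, freeLift_gen, freeLift_gen, hef, sub_self]
  | ef_ne i j hij => rw [freeLift_mul, freeLift_gen, freeLift_gen, hef_ne i j hij]

end Lift

/-! ### A Verma module of `𝔤̃(A, τ)` -/

section Verma

variable {I H : Type*}

/-- The action of `f_i`. -/
def vermaF (i : I) : Module.End ℂ (List I →₀ ℂ) := Finsupp.lmapDomain ℂ ℂ (List.cons i)

theorem vermaF_single (i : I) (w : List I) (c : ℂ) :
    vermaF i (Finsupp.single w c) = Finsupp.single (i :: w) c := by
  simp [vermaF]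

theorem verma_ext {f g : Module.End ℂ (List I →₀ ℂ)}
    (h : ∀ w, f (Finsupp.single w 1) = g (Finsupp.single w 1)) : f = g := by
  ext1 w
  ext1
  exact h w

variable [Fintype I] [AddCommGroup H] [Module ℂ H]
  {A : Matrix I I ℂ} (τ : I → ZMod 2) (R : Realization A H) (lam : Module.Dual ℂ H)

/-- The weight of a word in the `f_i` applied to a vector of weight `lam`. -/
def vermaWeight (w : List I) : Module.Dual ℂ H := lam - (w.map R.root).sum

/-- The action of `𝔥`. -/
def vermaH (t : H) : Module.End ℂ (List I →₀ ℂ) :=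
  Finsupp.linearCombination ℂ fun w => Finsupp.single w (vermaWeight R lam w t)

open Classical in
/-- The action of `e_i` on a word. -/
def vermaEWord (i : I) : List I → List I →₀ ℂ
  | [] => 0
  -- The formula is forced by `e_i f_j = δ_{ij} α_i^∨ ± f_j e_i` and by `e_i` killing the highest
  -- weight vector.
  | j :: w => (if i = j then Finsupp.single w (vermaWeight R lam w (R.coroot i)) else 0) +
      sgn (τ i) (τ j) • vermaF j (vermaEWord i w)

/-- The action of `e_i`. -/
def vermaE (i : I) : Module.End ℂ (List I →₀ ℂ) :=
  Finsupp.linearCombination ℂ (vermaEWord τ R lam i)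

theorem vermaH_single (t : H) (w : List I) (c : ℂ) :
    vermaH R lam t (Finsupp.single w c) = Finsupp.single w (c * vermaWeight R lam w t) := by
  simp [vermaH]

theorem vermaE_single (i : I) (w : List I) :
    vermaE τ R lam i (Finsupp.single w 1) = vermaEWord τ R lam i w := by
  simp [vermaE]

theorem vermaWeight_cons (i : I) (w : List I) (t : H) :
    vermaWeight R lam (i :: w) t = vermaWeight R lam w t - R.root i t := by
  simp only [vermaWeight, List.map_cons, List.sum_cons, LinearMap.sub_apply, LinearMap.add_apply]
  ring

theorem verma_hf (t : H) (i : I) : vermaH R lam t * vermaF i - vermaF i * vermaH R lam t =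
    -(R.root i t • vermaF i) := by
  refine verma_ext fun w => ?_
  simp only [LinearMap.sub_apply, Module.End.mul_apply, LinearMap.neg_apply, LinearMap.smul_apply,
    vermaF_single, vermaH_single, vermaWeight_cons, ← Finsupp.single_sub, Finsupp.smul_single,
    ← Finsupp.single_neg, smul_eq_mul]
  congr 1
  ring

theorem verma_hh (s t : H) : vermaH R lam s * vermaH R lam t = vermaH R lam t * vermaH R lam s := by
  refine verma_ext fun w => ?_
  simp only [Module.End.mul_apply, vermaH_single]
  congr 1
  ring

theorem vermaH_add (s t : H) : vermaH R lam (s + t) = vermaH R lam s + vermaH R lam t := by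
  refine verma_ext fun w => ?_
  simp [vermaH_single]

theorem vermaH_smul (c : ℂ) (t : H) : vermaH R lam (c • t) = c • vermaH R lam t := by
  refine verma_ext fun w => ?_
  simp [vermaH_single]

theorem verma_ef (i j : I) [Decidable (i = j)] :
    vermaE τ R lam i * vermaF j - sgn (τ i) (τ j) • (vermaF j * vermaE τ R lam i) =
      if i = j then vermaH R lam (R.coroot i) else 0 := by
  refine verma_ext fun w => ?_
  simp only [LinearMap.sub_apply, Module.End.mul_apply, LinearMap.smul_apply, vermaF_single,
    vermaE_single, vermaEWord, add_sub_cancel_right]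
  split_ifs
  · rw [vermaH_single, one_mul]
  · rfl

/-- By induction on the word, `e_i` sends a vector of weight χ to one of weight χ + α_i; removing
the letter `i` restores the root that this letter had subtracted. -/
theorem verma_he (t : H) (i : I) :
    vermaH R lam t * vermaE τ R lam i - vermaE τ R lam i * vermaH R lam t =
      R.root i t • vermaE τ R lam i := by
  classical
  have hw : ∀ w, vermaH R lam t (vermaEWord τ R lam i w) =
      (vermaWeight R lam w t + R.root i t) • vermaEWord τ R lam i w := by
    intro w
    induction w with
    | nil => simp [vermaEWord]
    | cons j w ih =>
      have h := LinearMap.congr_fun (verma_hf R lam t j) (vermaEWord τ R lam i w)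
      simp only [LinearMap.sub_apply, Module.End.mul_apply, LinearMap.neg_apply,
        LinearMap.smul_apply, ih, map_smul] at h
      rw [sub_eq_iff_eq_add] at h
      simp only [vermaEWord, map_add, map_smul, h, vermaWeight_cons]
      split_ifs with hij
      · subst hij
        have hs : ∀ c d : ℂ, (Finsupp.single w (c * d) : List I →₀ ℂ) = d • Finsupp.single w c :=
          fun c d => by simp [mul_comm]
        rw [vermaH_single, hs]
        module
      · rw [map_zero]
        module
  refine verma_ext fun w => ?_
  simp only [LinearMap.sub_apply, Module.End.mul_apply, LinearMap.smul_apply, vermaE_single, hw,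
    vermaH_single, one_mul]
  have h1 : (Finsupp.single w (vermaWeight R lam w t) : List I →₀ ℂ) =
      vermaWeight R lam w t • Finsupp.single w 1 := by simp
  rw [h1, map_smul, vermaE_single]
  module

/-- The images of the generators in the endomorphisms of the Verma module. -/
def vermaGen : Gen I H → Module.End ℂ (List I →₀ ℂ) × Module.End ℂ (List I →₀ ℂ)
  | Gen.e i => superPairOf (τ i) (vermaE τ R lam i)
  | Gen.f i => superPairOf (τ i) (vermaF i)
  | Gen.h t => superPairOf 0 (vermaH R lam t)

theorem relIdeal_le_ker_verma : relIdeal τ R ≤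
    LinearMap.ker (freeLift (superPair (Module.End ℂ (List I →₀ ℂ))) (vermaGen τ R lam)) := by
  classical
  refine relIdeal_le_ker_freeLift τ _ R ?_ ?_ ?_ ?_ ?_ ?_ ?_ ?_
  · rintro (i | i | t) <;> exact ⟨_, rfl⟩
  · intro s t
    simp only [vermaGen, vermaH_add, map_add]
  · intro c t
    simp only [vermaGen, vermaH_smul, map_smul]
  · intro s t
    change superPairMul _ (superPairOf 0 _) (superPairOf 0 _) = 0
    rw [superPairMul_of, sgn_zero_left, one_smul, verma_hh, sub_self, map_zero]
  · intro t i
    change superPairMul _ (superPairOf 0 _) (superPairOf _ _) = _ • superPairOf _ _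
    rw [superPairMul_of, sgn_zero_left, one_smul, verma_he, zero_add, map_smul]
  · intro t i
    change superPairMul _ (superPairOf 0 _) (superPairOf _ _) = -(_ • superPairOf _ _)
    rw [superPairMul_of, sgn_zero_left, one_smul, verma_hf, zero_add]
    exact superPairOf_neg_smul _ _ _
  · intro i
    change superPairMul _ (superPairOf _ _) (superPairOf _ _) = superPairOf 0 _
    rw [superPairMul_of, verma_ef, if_pos rfl, CharTwo.add_self_eq_zero]
  · intro i j hij
    change superPairMul _ (superPairOf _ _) (superPairOf _ _) = 0
    rw [superPairMul_of, verma_ef, if_neg hij, map_zero]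

/-- The Cartan subalgebra `𝔥` embeds in `𝔤̃(A, τ)`. -/
theorem tildeCartan_injective : Function.Injective (tildeCartan τ R) := by
  rw [injective_iff_map_eq_zero]
  intro t ht
  have hmem : gen (Gen.h t) ∈ relIdeal τ R := (Submodule.Quotient.mk_eq_zero _).1 ht
  rw [← Module.forall_dual_apply_eq_zero_iff ℂ]
  intro lam
  have h := relIdeal_le_ker_verma τ R lam hmem
  rw [LinearMap.mem_ker, freeLift_gen] at h
  have h0 : vermaH R lam t = 0 := superPairOf_injective 0 (h.trans (map_zero _).symm)
  -- On the highest weight vector `t` acts by the scalar `lam t`, and `lam` is arbitrary.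
  have h1 := congrArg (fun x => x []) (LinearMap.congr_fun h0 (Finsupp.single [] 1))
  simpa [vermaH_single, vermaWeight] using h1

end Verma

end SuperLie

end

noncomputable section

namespace SuperLie

open Module PBW TriangularData.Frame

/-! ### Invariant forms -/

section RightAction

variable {V : Type*} [AddCommGroup V] [Module ℂ V] (L : LieSuperalgebra V)

theorem exists_add_of_parts (x : V) : ∃ a ∈ L.part 0, ∃ b ∈ L.part 1, a + b = x :=
  Submodule.mem_sup.1 (by rw [L.isCompl.sup_eq_top]; trivial)

theorem mul_skew_of_even {x : V} (hx : x ∈ L.part 0) (y : V) : L.mul y x = -L.mul x y := by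
  obtain ⟨a, ha, b, hb, rfl⟩ := exists_add_of_parts L y
  rw [map_add, map_add, LinearMap.add_apply, L.skew ha hx, L.skew hb hx, sgn_comm, sgn_zero_left,
    sgn_comm, sgn_zero_left, one_smul, one_smul, neg_add]

/-- The right action of `y` on `𝔤 ⊕ 𝔤^*`, which sends `(x, ψ)` to `([x, y], ψ ∘ ad y)`. -/
def rightAct : V →ₗ[ℂ] Module.End ℂ (V × Dual ℂ V) where
  toFun y := (L.mul.flip y).prodMap (Dual.transpose (L.mul y))
  map_add' y z := by ext <;> simp
  map_smul' c y := by ext <;> simp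

theorem rightAct_apply (y : V) (w : V × Dual ℂ V) :
    rightAct L y w = (L.mul w.1 y, w.2 ∘ₗ L.mul y) := rfl

theorem mul_mul_of_mem {p q : ZMod 2} {y z : V} (hy : y ∈ L.part p) (hz : z ∈ L.part q) (x : V) :
    L.mul x (L.mul y z) = L.mul (L.mul x y) z - sgn p q • L.mul (L.mul x z) y := by
  have key : ∀ r : ZMod 2, ∀ x ∈ L.part r, L.mul x (L.mul y z) =
      L.mul (L.mul x y) z - sgn p q • L.mul (L.mul x z) y := by
    intro r x hx
    rw [L.jacobi hx hy, L.skew hy (L.mul_mem hx hz), smul_neg, smul_smul, sgn_comm p,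
      sgn_add, sgn_comm q, ← mul_assoc, sgn_mul_self, one_mul, sub_eq_add_neg]
  obtain ⟨a, ha, b, hb, rfl⟩ := exists_add_of_parts L x
  simp only [map_add, LinearMap.add_apply]
  rw [key 0 a ha, key 1 b hb]
  module

/-- A linear map θ from 𝔤 to its dual is an invariant form exactly when its graph is stable under
this action. By the present identity, stability may be tested on generators of 𝔤. -/
theorem rightAct_mul {p q : ZMod 2} {y z : V} (hy : y ∈ L.part p) (hz : z ∈ L.part q)
    (w : V × Dual ℂ V) : rightAct L (L.mul y z) w =
      rightAct L z (rightAct L y w) - sgn p q • rightAct L y (rightAct L z w) := by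
  ext1
  · exact mul_mul_of_mem L hy hz w.1
  · ext v
    simp only [rightAct_apply, Prod.snd_sub, Prod.smul_snd, LinearMap.sub_apply,
      LinearMap.smul_apply, LinearMap.comp_apply]
    rw [L.jacobi hy hz, map_add, map_smul, add_sub_cancel_right]

end RightAction

/-- Chevalley generators of a Lie superalgebra: an even commutative subalgebra with weight vectors
`e_i`, `f_i` of opposite linearly independent weights such that `[e_i, f_j] = δ_{ij} κ_i α_i^∨`, with
`𝔤` the sum of this subalgebra and of the subalgebras generated by the `e_i` and by the `f_i`, and
the projection onto the Cartan subalgebra along the other weight spaces. -/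
structure Chevalley (I H : Type*) [Fintype I] [AddCommGroup H] [Module ℂ H] {V : Type*}
    [AddCommGroup V] [Module ℂ V] (L : LieSuperalgebra V) where
  cartan : H →ₗ[ℂ] V
  root : I → Dual ℂ H
  coroot : I → H
  root_indep : LinearIndependent ℂ root
  coroot_indep : LinearIndependent ℂ coroot
  par : I → ZMod 2
  e : I → V
  f : I → V
  scale : I → ℂ
  cartan_even : ∀ t, cartan t ∈ L.part 0
  cartan_comm : ∀ s t, L.mul (cartan s) (cartan t) = 0
  e_mem : ∀ i, e i ∈ L.part (par i)
  f_mem : ∀ i, f i ∈ L.part (par i)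
  cartan_e : ∀ t i, L.mul (cartan t) (e i) = root i t • e i
  cartan_f : ∀ t i, L.mul (cartan t) (f i) = -(root i t • f i)
  e_f : ∀ i, L.mul (e i) (f i) = scale i • cartan (coroot i)
  e_f_ne : ∀ i j, i ≠ j → L.mul (e i) (f j) = 0
  top_le : ⊤ ≤ L.generated (Set.range f) ⊔ LinearMap.range cartan ⊔ L.generated (Set.range e)
  proj : V →ₗ[ℂ] H
  proj_cartan : ∀ t, proj (cartan t) = t
  proj_weight : ∀ γ ≠ 0, ∀ x, (∀ t, L.mul (cartan t) x = wt root γ t • x) → proj x = 0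

namespace Chevalley

variable {I H : Type*} [Fintype I] [AddCommGroup H] [Module ℂ H] {V : Type*}
  [AddCommGroup V] [Module ℂ V] {L : LieSuperalgebra V} (C : Chevalley I H L)

theorem wt_neg (root : I → Dual ℂ H) (γ : I → ℤ) : wt (fun i => -root i) γ = wt root (-γ) := by
  simp [wt]

/-- The roles of the `e_i` and of the `f_i` exchanged. -/
def swap : Chevalley I H L where
  cartan := C.cartan
  root i := -C.root i
  coroot := C.coroot
  root_indep := C.root_indep.neg
  coroot_indep := C.coroot_indep
  par := C.par
  e := C.f
  f := C.e
  -- Super-skew-symmetry of `[f_i, e_i]` produces this factor; the field `scale` is there so that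
  -- the structure survives the exchange.
  scale i := -(sgn (C.par i) (C.par i) * C.scale i)
  cartan_even := C.cartan_even
  cartan_comm := C.cartan_comm
  e_mem := C.f_mem
  f_mem := C.e_mem
  cartan_e t i := by rw [C.cartan_f, LinearMap.neg_apply, neg_smul]
  cartan_f t i := by rw [C.cartan_e, LinearMap.neg_apply, neg_smul, neg_neg]
  e_f i := by rw [L.skew (C.f_mem i) (C.e_mem i), C.e_f, smul_smul, neg_smul]
  e_f_ne i j hij := by
    rw [L.skew (C.f_mem i) (C.e_mem j), C.e_f_ne j i hij.symm, smul_zero, neg_zero]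
  top_le := C.top_le.trans (by rw [sup_assoc, sup_comm, sup_comm (LinearMap.range _)])
  proj := C.proj
  proj_cartan := C.proj_cartan
  proj_weight γ hγ x hx := C.proj_weight (-γ) (neg_ne_zero.2 hγ) x fun t => by
    rw [hx, wt_neg]

/-- The vector `x` has weight `γ`. -/
def IsWeight (γ : I → ℤ) (x : V) : Prop := ∀ t, L.mul (C.cartan t) x = wt C.root γ t • x

variable {C}

theorem IsWeight.mul {p : ZMod 2} {γ δ : I → ℤ} {x y : V} (hp : x ∈ L.part p)
    (hx : C.IsWeight γ x) (hy : C.IsWeight δ y) : C.IsWeight (γ + δ) (L.mul x y) := fun t => by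
  rw [L.jacobi (C.cartan_even t) hp, hx t, hy t, wt_add, sgn_zero_left]
  simp [add_smul]

theorem IsWeight.proj {γ : I → ℤ} {x : V} (hx : C.IsWeight γ x) (hγ : height γ ≠ 0) :
    C.proj x = 0 :=
  C.proj_weight γ (by rintro rfl; exact hγ (map_zero _)) x hx

variable (C)

theorem height_single [DecidableEq I] (i : I) (c : ℤ) : height (Pi.single i c) = c := by
  change ∑ j, (Pi.single i c : I → ℤ) j = c
  simp

theorem isWeight_e [DecidableEq I] (i : I) : C.IsWeight (Pi.single i 1) (C.e i) := fun t => by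
  rw [C.cartan_e, wt_single]
  simp

theorem isWeight_f [DecidableEq I] (i : I) : C.IsWeight (Pi.single i (-1)) (C.f i) := fun t => by
  rw [C.cartan_f, wt_single]
  simp

theorem mul_cartan (x : V) (t : H) : L.mul x (C.cartan t) = -L.mul (C.cartan t) x :=
  mul_skew_of_even L (C.cartan_even t) x

theorem generated_e_le : L.generated (Set.range C.e) ≤ Submodule.span ℂ
    {y | (∃ p, y ∈ L.part p) ∧ ∃ γ, 0 < height γ ∧ C.IsWeight γ y} := by
  classical
  refine L.generated_le_span ?_ ?_
  · rintro _ ⟨i, rfl⟩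
    exact ⟨⟨_, C.e_mem i⟩, _, by rw [height_single]; exact one_pos, C.isWeight_e i⟩
  · rintro x ⟨⟨p, hp⟩, γ, hγ, hx⟩ y ⟨⟨q, hq⟩, δ, hδ, hy⟩
    exact ⟨⟨_, L.mul_mem hp hq⟩, γ + δ, by rw [map_add]; exact add_pos hγ hδ, hx.mul hp hy⟩

/-- Only the generators themselves can be brought back to the Cartan subalgebra by an `e_i`: longer
brackets have height at most -2 and stay at negative height. -/
theorem generated_f_le : L.generated (Set.range C.f) ≤ Submodule.span ℂ
    {y | (∃ p, y ∈ L.part p) ∧ ∃ γ, height γ < 0 ∧ C.IsWeight γ y ∧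
      ∀ i, C.proj (L.mul (C.e i) y) ∈ Submodule.span ℂ {C.coroot i}} := by
  classical
  refine L.generated_le_span ?_ ?_
  · rintro _ ⟨i, rfl⟩
    refine ⟨⟨_, C.f_mem i⟩, _, ?_, C.isWeight_f i, fun j => ?_⟩
    · rw [height_single]
      exact neg_one_lt_zero
    · by_cases hij : j = i
      · subst hij
        rw [C.e_f, map_smul, C.proj_cartan]
        exact Submodule.smul_mem _ _ (Submodule.mem_span_singleton_self _)
      · rw [C.e_f_ne j i hij, map_zero]
        exact zero_mem _
  · rintro x ⟨⟨p, hp⟩, γ, hγ, hx, -⟩ y ⟨⟨q, hq⟩, δ, hδ, hy, -⟩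
    refine ⟨⟨_, L.mul_mem hp hq⟩, γ + δ, by rw [map_add]; exact add_neg hγ hδ, hx.mul hp hy,
      fun i => ?_⟩
    rw [((C.isWeight_e i).mul (C.e_mem i) (hx.mul hp hy)).proj]
    · exact zero_mem _
    · rw [map_add, map_add, height_single]
      omega

theorem top_le_cartan_sup : ⊤ ≤ LinearMap.range C.cartan ⊔ Submodule.span ℂ
    {y | (∃ p, y ∈ L.part p) ∧ ∃ γ, height γ ≠ 0 ∧ C.IsWeight γ y} := by
  refine C.top_le.trans (sup_le (sup_le ?_ le_sup_left) ?_)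
  · refine (C.generated_f_le.trans (Submodule.span_mono ?_)).trans le_sup_right
    rintro y ⟨hp, γ, hγ, hy, -⟩
    exact ⟨hp, γ, hγ.ne, hy⟩
  · refine (C.generated_e_le.trans (Submodule.span_mono ?_)).trans le_sup_right
    rintro y ⟨hp, γ, hγ, hy⟩
    exact ⟨hp, γ, hγ.ne', hy⟩

theorem proj_e_mul_mem (i : I) (v : V) :
    C.proj (L.mul (C.e i) v) ∈ Submodule.span ℂ {C.coroot i} := by
  classical
  have hle : (⊤ : Submodule ℂ V) ≤
      (Submodule.span ℂ {C.coroot i}).comap (C.proj ∘ₗ L.mul (C.e i)) := by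
    refine C.top_le.trans (sup_le (sup_le ?_ ?_) ?_)
    · refine C.generated_f_le.trans (Submodule.span_le.2 ?_)
      rintro y ⟨-, γ, -, -, hy⟩
      exact hy i
    · rintro _ ⟨t, rfl⟩
      rw [Submodule.mem_comap, LinearMap.comp_apply, C.mul_cartan, C.cartan_e, map_neg, map_smul,
        (C.isWeight_e i).proj (by rw [height_single]; exact one_ne_zero), smul_zero, neg_zero]
      exact zero_mem _
    · refine C.generated_e_le.trans (Submodule.span_le.2 ?_)
      rintro y ⟨-, γ, hγ, hy⟩
      change C.proj (L.mul (C.e i) y) ∈ Submodule.span ℂ {C.coroot i}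
      rw [((C.isWeight_e i).mul (C.e_mem i) hy).proj]
      · exact zero_mem _
      · rw [map_add, height_single]
        omega
  exact hle trivial

theorem proj_f_mul_mem (i : I) (v : V) :
    C.proj (L.mul (C.f i) v) ∈ Submodule.span ℂ {C.coroot i} :=
  C.swap.proj_e_mul_mem i v

theorem proj_cartan_mul (t : H) (v : V) : C.proj (L.mul (C.cartan t) v) = 0 := by
  have hle : (⊤ : Submodule ℂ V) ≤ LinearMap.ker (C.proj ∘ₗ L.mul (C.cartan t)) := by
    refine C.top_le_cartan_sup.trans (sup_le ?_ (Submodule.span_le.2 ?_))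
    · rintro _ ⟨s, rfl⟩
      rw [LinearMap.mem_ker, LinearMap.comp_apply, C.cartan_comm, map_zero]
    · rintro y ⟨-, γ, hγ, hy⟩
      rw [SetLike.mem_coe, LinearMap.mem_ker, LinearMap.comp_apply, hy t, map_smul, hy.proj hγ,
        smul_zero]
  exact hle (Submodule.mem_top (x := v))

/-- A subspace that contains the generators and the brackets of its homogeneous elements is
everything. -/
theorem eq_top_of_mul_mem {S : Submodule ℂ V} (hc : ∀ t, C.cartan t ∈ S) (he : ∀ i, C.e i ∈ S)
    (hf : ∀ i, C.f i ∈ S) (hmul : ∀ p q, ∀ x ∈ L.part p, ∀ y ∈ L.part q, x ∈ S → y ∈ S →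
      L.mul x y ∈ S) : S = ⊤ := by
  have key : ∀ g : I → V, (∀ i, g i ∈ S) → (∀ i, g i ∈ L.part (C.par i)) →
      L.generated (Set.range g) ≤ S := by
    intro g hg hgp
    refine (L.generated_le_span (E := {x | x ∈ S ∧ ∃ p, x ∈ L.part p}) ?_ ?_).trans
      (Submodule.span_le.2 fun x hx => hx.1)
    · rintro _ ⟨i, rfl⟩
      exact ⟨hg i, _, hgp i⟩
    · rintro x ⟨hx, p, hp⟩ y ⟨hy, q, hq⟩
      exact ⟨hmul p q x hp y hq hx hy, _, L.mul_mem hp hq⟩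
  refine eq_top_iff.2 (C.top_le.trans (sup_le (sup_le (key _ hf C.f_mem) ?_) (key _ he C.e_mem)))
  rintro _ ⟨t, rfl⟩
  exact hc t

end Chevalley

end SuperLie

end

/-! ### Extension of a form from the Cartan subalgebra through its graph -/

noncomputable section

namespace SuperLie

open Module PBW TriangularData.Frame

namespace Chevalley

variable {I H : Type*} [Fintype I] [AddCommGroup H] [Module ℂ H] {V : Type*}
  [AddCommGroup V] [Module ℂ V] {L : LieSuperalgebra V} (C : Chevalley I H L)
  (B : H →ₗ[ℂ] Dual ℂ H)

/-- The pairs `(t, B(t, ·))`, with `B(t, ·)` extended by zero to the nonzero weight spaces. -/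
def basePair : H →ₗ[ℂ] V × Dual ℂ V :=
  C.cartan.prod (Dual.transpose C.proj ∘ₗ B)

theorem basePair_apply (t : H) : C.basePair B t = (C.cartan t, B t ∘ₗ C.proj) := rfl

theorem rightAct_cartan_basePair (s t : H) : rightAct L (C.cartan s) (C.basePair B t) = 0 := by
  refine Prod.ext (C.cartan_comm t s) (LinearMap.ext fun v => ?_)
  change B t (C.proj (L.mul (C.cartan s) v)) = 0
  rw [C.proj_cartan_mul, map_zero]

theorem rightAct_cartan_e {w : V × Dual ℂ V} {s : H} {a : ℂ}
    (hw : rightAct L (C.cartan s) w = a • w) (i : I) :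
    rightAct L (C.cartan s) (rightAct L (C.e i) w) = (a - C.root i s) • rightAct L (C.e i) w := by
  have h := rightAct_mul L (C.e_mem i) (C.cartan_even s) w
  rw [hw, sgn_comm, sgn_zero_left, one_smul, C.mul_cartan, C.cartan_e, map_neg, map_smul,
    LinearMap.neg_apply, LinearMap.smul_apply, eq_sub_iff_add_eq, map_smul] at h
  rw [← h]
  module

/-- The pairs obtained from the pairs `(t, B(t, ·))` by the right action of the `e_i`. -/
inductive PosPair : V × Dual ℂ V → Prop
  | base (i : I) (t : H) : PosPair (rightAct L (C.e i) (C.basePair B t))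
  | step (i : I) {w : V × Dual ℂ V} (hw : PosPair w) : PosPair (rightAct L (C.e i) w)

/-- The span of the pairs of positive weight. -/
def posPairs : Submodule ℂ (V × Dual ℂ V) := Submodule.span ℂ {w | C.PosPair B w}

variable {C B} in
theorem PosPair.weight {w : V × Dual ℂ V} (hw : C.PosPair B w) : ∃ γ : I → ℤ, 0 < height γ ∧
    ∀ s, rightAct L (C.cartan s) w = -wt C.root γ s • w := by
  classical
  induction hw with
  | base i t =>
    refine ⟨Pi.single i 1, by rw [height_single]; exact one_pos, fun s => ?_⟩
    rw [C.rightAct_cartan_e (a := 0) (by rw [C.rightAct_cartan_basePair, zero_smul]), wt_single]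
    simp
  | @step i w hw ih =>
    obtain ⟨γ, hγ, h⟩ := ih
    refine ⟨γ + Pi.single i 1, by rw [map_add, height_single]; omega, fun s => ?_⟩
    rw [C.rightAct_cartan_e (h s), wt_add, wt_single]
    congr 1
    simp
    ring

/-- The pairs `(x, ψ)` such that `ψ` restricts to `B(t, ·)` on the Cartan subalgebra, where `t` is
the projection of `x`. -/
def compatible : Submodule ℂ (V × Dual ℂ V) where
  carrier := {w | ∀ s, w.2 (C.cartan s) = B (C.proj w.1) s}
  zero_mem' := by simp
  add_mem' := by
    intro a b ha hb s
    simp [ha s, hb s]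
  smul_mem' := by
    intro c a ha s
    simp [ha s]

theorem basePair_mem_compatible (t : H) : C.basePair B t ∈ C.compatible B := fun s => by
  rw [basePair_apply, LinearMap.comp_apply, C.proj_cartan, C.proj_cartan]

/-- On a pair of nonzero weight both sides vanish: choose `t` on which the weight is nonzero, and
use that `ad t` kills the Cartan subalgebra and that `proj` kills the image of `ad t`. -/
theorem posPairs_le_compatible : C.posPairs B ≤ C.compatible B := by
  refine Submodule.span_le.2 fun w hw s => ?_
  obtain ⟨γ, hγ, h⟩ := hw.weight
  have hne : wt C.root γ ≠ 0 := by
    rw [← wt_zero C.root]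
    refine (wt_injective C.root_indep).ne ?_
    rintro rfl
    exact hγ.ne' (map_zero _)
  obtain ⟨t, ht⟩ := DFunLike.ne_iff.1 hne
  have ht : -wt C.root γ t ≠ 0 := neg_ne_zero.2 ht
  have h1 : C.proj (L.mul w.1 (C.cartan t)) = -wt C.root γ t • C.proj w.1 := by
    rw [← map_smul]
    exact congrArg (fun w => C.proj (Prod.fst w)) (h t)
  have h2 : w.2 (L.mul (C.cartan t) (C.cartan s)) = -wt C.root γ t • w.2 (C.cartan s) :=
    LinearMap.congr_fun (congrArg Prod.snd (h t)) (C.cartan s)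
  rw [C.mul_cartan, map_neg, C.proj_cartan_mul, neg_zero, eq_comm, smul_eq_zero] at h1
  rw [C.cartan_comm, map_zero, eq_comm, smul_eq_zero] at h2
  rw [h1.resolve_left ht, h2.resolve_left ht, map_zero, LinearMap.zero_apply]

theorem rightAct_e_mem_posPairs (i : I) {w : V × Dual ℂ V}
    (hw : w ∈ C.posPairs B ⊔ LinearMap.range (C.basePair B)) :
    rightAct L (C.e i) w ∈ C.posPairs B := by
  have hle : C.posPairs B ⊔ LinearMap.range (C.basePair B) ≤
      (C.posPairs B).comap (rightAct L (C.e i)) := by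
    refine sup_le (Submodule.span_le.2 fun w hw => Submodule.subset_span (PosPair.step i hw)) ?_
    rintro _ ⟨t, rfl⟩
    exact Submodule.subset_span (PosPair.base i t)
  exact hle hw

theorem rightAct_cartan_mem_posPairs (s : H) {w : V × Dual ℂ V} (hw : w ∈ C.posPairs B) :
    rightAct L (C.cartan s) w ∈ C.posPairs B := by
  have hle : C.posPairs B ≤ (C.posPairs B).comap (rightAct L (C.cartan s)) := by
    refine Submodule.span_le.2 fun w hw => ?_
    obtain ⟨γ, -, h⟩ := hw.weight
    change rightAct L (C.cartan s) w ∈ C.posPairs B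
    rw [h s]
    exact Submodule.smul_mem _ _ (Submodule.subset_span hw)
  exact hle hw

/-- The left side is a multiple of the coroot of `i`, and, after `e_i` and `f_j` have been exchanged
by the Jacobi identity, also of that of `j`; the coroots are independent. -/
theorem proj_e_mul_f_mul {i j : I} (hij : i ≠ j) (v : V) :
    C.proj (L.mul (C.e i) (L.mul (C.f j) v)) = 0 := by
  have h1 := C.proj_e_mul_mem i (L.mul (C.f j) v)
  have h2 : C.proj (L.mul (C.e i) (L.mul (C.f j) v)) ∈ Submodule.span ℂ {C.coroot j} := by
    rw [L.jacobi (C.e_mem i) (C.f_mem j), C.e_f_ne i j hij, map_zero, LinearMap.zero_apply,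
      zero_add, map_smul]
    exact Submodule.smul_mem _ _ (C.proj_f_mul_mem j _)
  have hd := C.coroot_indep.disjoint_span_image (s := {i}) (t := {j}) (by simpa using hij)
  rw [Set.image_singleton, Set.image_singleton] at hd
  exact Submodule.disjoint_def.1 hd _ h1 h2

theorem proj_e_mul_f_mul_self (i : I) (v : V) : C.proj (L.mul (C.e i) (L.mul (C.f i) v)) =
    (C.scale i * C.root i (C.proj v)) • C.coroot i := by
  classical
  have hle : (⊤ : Submodule ℂ V) ≤ LinearMap.ker (C.proj ∘ₗ L.mul (C.e i) ∘ₗ L.mul (C.f i) -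
      (LinearMap.toSpanSingleton ℂ H (C.coroot i)) ∘ₗ (C.scale i • C.root i) ∘ₗ C.proj) := by
    refine C.top_le_cartan_sup.trans (sup_le ?_ (Submodule.span_le.2 ?_))
    · rintro _ ⟨s, rfl⟩
      rw [LinearMap.mem_ker, LinearMap.sub_apply, sub_eq_zero]
      simp only [LinearMap.comp_apply, LinearMap.smul_apply, LinearMap.toSpanSingleton_apply]
      rw [C.mul_cartan, C.cartan_f, neg_neg, map_smul, map_smul, C.e_f, map_smul, C.proj_cartan,
        C.proj_cartan, smul_smul, smul_eq_mul, mul_comm]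
    · rintro y ⟨-, γ, hγ, hy⟩
      rw [SetLike.mem_coe, LinearMap.mem_ker, LinearMap.sub_apply, sub_eq_zero]
      simp only [LinearMap.comp_apply]
      rw [((C.isWeight_e i).mul (C.e_mem i) ((C.isWeight_f i).mul (C.f_mem i) hy)).proj,
        hy.proj hγ, map_zero, map_zero]
      rw [map_add, map_add, height_single, height_single]
      omega
  have h := hle (Submodule.mem_top (x := v))
  rw [LinearMap.mem_ker, LinearMap.sub_apply, sub_eq_zero] at h
  exact h

/-- Moving `f_j` past the outermost `e_i` leaves an element of the Cartan subalgebra, which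
preserves the positive pairs. The start of the induction, `e_i` and then `f_i` on a base pair,
returns a base pair exactly because `B` pairs coroots symmetrically with multiples of roots. -/
theorem rightAct_f_mem {η : I → ℂ} (hB : ∀ i t, B t (C.coroot i) = η i * C.root i t)
    (hB' : ∀ i t, B (C.coroot i) t = η i * C.root i t)
    {w : V × Dual ℂ V}
    (hw : w ∈ C.posPairs B) (j : I) :
    rightAct L (C.f j) w ∈ C.posPairs B ⊔ LinearMap.range (C.basePair B) := by
  have hle : C.posPairs B ≤ (C.posPairs B ⊔ LinearMap.range (C.basePair B)).comap
      (rightAct L (C.f j)) := by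
    refine Submodule.span_le.2 fun w hw => ?_
    change rightAct L (C.f j) w ∈ C.posPairs B ⊔ LinearMap.range (C.basePair B)
    induction hw with
    | base i t =>
      by_cases hij : i = j
      · subst hij
        refine Submodule.mem_sup_right ⟨(C.scale i * C.root i t) • C.coroot i, ?_⟩
        refine Prod.ext ?_ (LinearMap.ext fun v => ?_)
        · change C.cartan _ = L.mul (L.mul (C.cartan t) (C.e i)) (C.f i)
          rw [C.cartan_e, map_smul, map_smul, LinearMap.smul_apply, C.e_f, smul_smul, mul_comm]
        · change B _ (C.proj v) = B t (C.proj (L.mul (C.e i) (L.mul (C.f i) v)))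
          rw [C.proj_e_mul_f_mul_self, map_smul, map_smul, LinearMap.smul_apply, hB, hB',
            smul_eq_mul, smul_eq_mul]
          ring
      · have h0 : rightAct L (C.f j) (rightAct L (C.e i) (C.basePair B t)) = 0 := by
          refine Prod.ext ?_ (LinearMap.ext fun v => ?_)
          · change L.mul (L.mul (C.cartan t) (C.e i)) (C.f j) = 0
            rw [C.cartan_e, map_smul, LinearMap.smul_apply, C.e_f_ne i j hij, smul_zero]
          · change B t (C.proj (L.mul (C.e i) (L.mul (C.f j) v))) = 0
            rw [C.proj_e_mul_f_mul hij, map_zero]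
        rw [h0]
        exact zero_mem _
    | @step i w hw ih =>
      have h := rightAct_mul L (C.e_mem i) (C.f_mem j) w
      rw [eq_sub_iff_add_eq] at h
      rw [← h]
      refine Submodule.mem_sup_left (add_mem ?_
        (Submodule.smul_mem _ _ (C.rightAct_e_mem_posPairs B i ih)))
      by_cases hij : i = j
      · subst hij
        rw [C.e_f, map_smul]
        exact Submodule.smul_mem _ _
          (C.rightAct_cartan_mem_posPairs B _ (Submodule.subset_span hw))
      · rw [C.e_f_ne i j hij, map_zero]
        exact zero_mem _
  exact hle hw

/-- The span of the pairs of positive, zero and negative weight is stable under the right action. -/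
theorem rightAct_mem_sup {η : I → ℂ} (hB : ∀ i t, B t (C.coroot i) = η i * C.root i t)
    (hB' : ∀ i t, B (C.coroot i) t = η i * C.root i t)
    (y : V) {w : V × Dual ℂ V}
    (hw : w ∈ C.posPairs B ⊔ LinearMap.range (C.basePair B) ⊔ C.swap.posPairs B) :
    rightAct L y w ∈ C.posPairs B ⊔ LinearMap.range (C.basePair B) ⊔ C.swap.posPairs B := by
  let S : Submodule ℂ V :=
    { carrier := {y | ∀ w ∈ C.posPairs B ⊔ LinearMap.range (C.basePair B) ⊔ C.swap.posPairs B,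
        rightAct L y w ∈ C.posPairs B ⊔ LinearMap.range (C.basePair B) ⊔ C.swap.posPairs B}
      zero_mem' := fun w _ => by rw [map_zero]; exact zero_mem _
      add_mem' := fun ha hb w hw => by rw [map_add]; exact add_mem (ha w hw) (hb w hw)
      smul_mem' := fun c a ha w hw => by
        rw [map_smul]
        exact Submodule.smul_mem _ _ (ha w hw) }
  have hS : S = ⊤ := by
    refine C.eq_top_of_mul_mem ?_ ?_ ?_ ?_
    · intro t w hw
      obtain ⟨d, hd, b, hb, rfl⟩ := Submodule.mem_sup.1 hw
      obtain ⟨a, ha, _, ⟨s, rfl⟩, rfl⟩ := Submodule.mem_sup.1 hd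
      rw [map_add, map_add, C.rightAct_cartan_basePair, add_zero]
      exact add_mem (Submodule.mem_sup_left (Submodule.mem_sup_left
        (C.rightAct_cartan_mem_posPairs B t ha)))
        (Submodule.mem_sup_right (C.swap.rightAct_cartan_mem_posPairs B t hb))
    · intro i w hw
      obtain ⟨a, ha, b, hb, rfl⟩ := Submodule.mem_sup.1 hw
      rw [map_add]
      refine add_mem (Submodule.mem_sup_left (Submodule.mem_sup_left
        (C.rightAct_e_mem_posPairs B i ha))) ?_
      have h : rightAct L (C.e i) b ∈ C.swap.posPairs B ⊔ LinearMap.range (C.basePair B) :=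
        -- The exchange negates the roots, so `η` is negated to keep the hypotheses on `B`.
        C.swap.rightAct_f_mem B (η := fun i => -η i)
          (fun i t => (hB i t).trans (neg_mul_neg _ _).symm)
          (fun i t => (hB' i t).trans (neg_mul_neg _ _).symm) hb i
      exact (sup_le le_sup_right (le_sup_right.trans le_sup_left) :
        C.swap.posPairs B ⊔ LinearMap.range (C.basePair B) ≤ _) h
    · intro i w hw
      obtain ⟨d, hd, b, hb, rfl⟩ := Submodule.mem_sup.1 hw
      obtain ⟨a, ha, c, hc, rfl⟩ := Submodule.mem_sup.1 hd
      rw [add_assoc, map_add]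
      exact add_mem (Submodule.mem_sup_left (C.rightAct_f_mem B hB hB' ha i))
        (Submodule.mem_sup_right (C.swap.rightAct_e_mem_posPairs B i
          (add_mem (Submodule.mem_sup_right hc) (Submodule.mem_sup_left hb))))
    · intro p q x hx y hy hxS hyS w hw
      rw [rightAct_mul L hx hy]
      exact sub_mem (hyS _ (hxS _ hw)) (Submodule.smul_mem _ _ (hxS _ (hyS _ hw)))
  have hy : y ∈ S := by rw [hS]; trivial
  exact hy w hw

theorem mem_of_mem_part {S : ZMod 2 → Submodule ℂ V} (hS : ∀ p, S p ≤ L.part p)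
    (htop : ⊤ ≤ S 0 ⊔ S 1) {p : ZMod 2} {x : V} (hx : x ∈ L.part p) : x ∈ S p := by
  obtain ⟨a, ha, b, hb, rfl⟩ := Submodule.mem_sup.1 (htop (Submodule.mem_top (x := x)))
  have hd := Submodule.disjoint_def.1 L.isCompl.disjoint
  rcases zmod_two_cases p with rfl | rfl
  · have h := sub_mem hx (hS 0 ha)
    rw [add_sub_cancel_left] at h
    rwa [hd b h (hS 1 hb), add_zero]
  · have h := sub_mem hx (hS 1 hb)
    rw [add_sub_cancel_right] at h
    rwa [hd a (hS 0 ha) h, zero_add]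

/-- The Cartan subalgebra is even and the complementary weight spaces are spanned by homogeneous
vectors killed by `proj`. -/
theorem proj_eq_zero_of_odd {v : V} (hv : v ∈ L.part 1) : C.proj v = 0 := by
  let S : ZMod 2 → Submodule ℂ V := fun p => L.part p ⊓ if p = 0 then ⊤ else LinearMap.ker C.proj
  have h0 : S 0 = L.part 0 := by simp [S]
  have h1 : S 1 = L.part 1 ⊓ LinearMap.ker C.proj := by simp [S]
  have hv' : v ∈ S 1 := by
    refine mem_of_mem_part (S := S) (fun p => inf_le_left) ?_ hv
    rw [h0, h1]
    refine C.top_le_cartan_sup.trans (sup_le ?_ (Submodule.span_le.2 ?_))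
    · rintro _ ⟨t, rfl⟩
      exact Submodule.mem_sup_left (C.cartan_even t)
    · rintro y ⟨⟨p, hp⟩, γ, hγ, hy⟩
      rcases zmod_two_cases p with rfl | rfl
      · exact Submodule.mem_sup_left hp
      · exact Submodule.mem_sup_right ⟨hp, hy.proj hγ⟩
  rw [h1] at hv'
  exact hv'.2

/-- The homogeneous pairs obtained from the pairs `(t, B(t, ·))` by the right action of `𝔤`. -/
inductive FormPair : ZMod 2 → V × Dual ℂ V → Prop
  | base (t : H) : FormPair 0 (C.basePair B t)
  | step {p q : ZMod 2} {w : V × Dual ℂ V} {y : V} (hw : FormPair p w) (hy : y ∈ L.part q) :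
      FormPair (p + q) (rightAct L y w)

/-- The graph of the invariant form. -/
def formGraph : Submodule ℂ (V × Dual ℂ V) := Submodule.span ℂ {w | ∃ p, C.FormPair B p w}

variable {B} in
theorem FormPair.mem {p : ZMod 2} {w : V × Dual ℂ V} (hw : C.FormPair B p w) :
    w.1 ∈ L.part p ∧ ∀ q ≠ p, ∀ v ∈ L.part q, w.2 v = 0 := by
  induction hw with
  | base t =>
    refine ⟨C.cartan_even t, fun q hq v hv => ?_⟩
    rw [(zmod_two_cases q).resolve_left hq] at hv
    rw [basePair_apply, LinearMap.comp_apply, C.proj_eq_zero_of_odd hv, map_zero]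
  | @step p q w y hw hy ih =>
    refine ⟨L.mul_mem ih.1 hy, fun r hr v hv => ih.2 _ ?_ _ (L.mul_mem hy hv)⟩
    rintro rfl
    refine hr ?_
    have : q + q = 0 := CharTwo.add_self_eq_zero q
    rw [add_right_comm, this, zero_add]

theorem rightAct_mem_formGraph (y : V) {w : V × Dual ℂ V} (hw : w ∈ C.formGraph B) :
    rightAct L y w ∈ C.formGraph B := by
  have hle : C.formGraph B ≤ (C.formGraph B).comap (rightAct L y) := by
    refine Submodule.span_le.2 ?_
    rintro w ⟨p, hw⟩
    obtain ⟨a, ha, b, hb, rfl⟩ := exists_add_of_parts L y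
    change rightAct L (a + b) w ∈ C.formGraph B
    rw [map_add]
    exact add_mem (Submodule.subset_span ⟨_, hw.step ha⟩) (Submodule.subset_span ⟨_, hw.step hb⟩)
  exact hle hw

/-- The image is stable under brackets from the right and contains the Cartan subalgebra; the roots
being nonzero, it contains all `e_i` and `f_i`. -/
theorem map_fst_formGraph : (C.formGraph B).map (LinearMap.fst ℂ V (Dual ℂ V)) = ⊤ := by
  have hright : ∀ x ∈ (C.formGraph B).map (LinearMap.fst ℂ V (Dual ℂ V)), ∀ y,
      L.mul x y ∈ (C.formGraph B).map (LinearMap.fst ℂ V (Dual ℂ V)) := by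
    rintro _ ⟨w, hw, rfl⟩ y
    exact ⟨_, C.rightAct_mem_formGraph B y hw, rfl⟩
  have hc : ∀ t, C.cartan t ∈ (C.formGraph B).map (LinearMap.fst ℂ V (Dual ℂ V)) := fun t =>
    ⟨_, Submodule.subset_span ⟨0, FormPair.base t⟩, rfl⟩
  refine C.eq_top_of_mul_mem hc ?_ ?_ fun p q x hx y hy hxS _ => hright x hxS y
  · intro i
    obtain ⟨t, ht⟩ := DFunLike.ne_iff.1 (C.root_indep.ne_zero i)
    have h := hright _ (hc t) (C.e i)
    rw [C.cartan_e] at h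
    exact (Submodule.smul_mem_iff _ ht).1 h
  · intro i
    obtain ⟨t, ht⟩ := DFunLike.ne_iff.1 (C.root_indep.ne_zero i)
    have h := hright _ (hc t) (C.f i)
    rw [C.cartan_f, ← neg_smul] at h
    exact (Submodule.smul_mem_iff _ (neg_ne_zero.2 ht)).1 h

theorem formGraph_le_compatible {η : I → ℂ} (hB : ∀ i t, B t (C.coroot i) = η i * C.root i t)
    (hB' : ∀ i t, B (C.coroot i) t = η i * C.root i t) : C.formGraph B ≤ C.compatible B := by
  have h1 : C.formGraph B ≤
      C.posPairs B ⊔ LinearMap.range (C.basePair B) ⊔ C.swap.posPairs B := by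
    refine Submodule.span_le.2 ?_
    rintro w ⟨p, hw⟩
    induction hw with
    | base t => exact Submodule.mem_sup_left (Submodule.mem_sup_right ⟨t, rfl⟩)
    | step hw hy ih => exact C.rightAct_mem_sup B hB hB' _ ih
  refine h1.trans (sup_le (sup_le (C.posPairs_le_compatible B) ?_)
    (C.swap.posPairs_le_compatible B))
  rintro _ ⟨t, rfl⟩
  exact C.basePair_mem_compatible B t

/-- The graph is single-valued: if `(0, ψ)` belongs to it, ψ vanishes on the Cartan subalgebra by
compatibility. The common zeros of all such ψ are stable under left brackets, so they contain all
`e_i` and `f_i` and are everything. -/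
theorem snd_eq_zero_of_mem_formGraph {η : I → ℂ}
    (hB : ∀ i t, B t (C.coroot i) = η i * C.root i t)
    (hB' : ∀ i t, B (C.coroot i) t = η i * C.root i t) {w : V × Dual ℂ V}
    (hw : w ∈ C.formGraph B) (h0 : w.1 = 0) : w.2 = 0 := by
  let S : Submodule ℂ V :=
    { carrier := {v | ∀ w ∈ C.formGraph B, w.1 = 0 → w.2 v = 0}
      zero_mem' := fun w _ _ => map_zero _
      add_mem' := fun ha hb w hw h => by rw [map_add, ha w hw h, hb w hw h, add_zero]
      smul_mem' := fun c a ha w hw h => by rw [map_smul, ha w hw h, smul_zero] }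
  have hleft : ∀ v ∈ S, ∀ y, L.mul y v ∈ S := fun v hv y w hw h => by
    refine hv _ (C.rightAct_mem_formGraph B y hw) ?_
    rw [rightAct_apply, h, map_zero, LinearMap.zero_apply]
  have hc : ∀ t, C.cartan t ∈ S := fun t w hw h => by
    rw [C.formGraph_le_compatible B hB hB' hw t, h, map_zero, map_zero, LinearMap.zero_apply]
  have hS : S = ⊤ := by
    refine C.eq_top_of_mul_mem hc ?_ ?_ fun p q x hx y hy _ hyS => hleft y hyS x
    · intro i
      obtain ⟨t, ht⟩ := DFunLike.ne_iff.1 (C.root_indep.ne_zero i)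
      have h := hleft _ (hc t) (C.e i)
      rw [C.mul_cartan, C.cartan_e, ← neg_smul] at h
      exact (Submodule.smul_mem_iff _ (neg_ne_zero.2 ht)).1 h
    · intro i
      obtain ⟨t, ht⟩ := DFunLike.ne_iff.1 (C.root_indep.ne_zero i)
      have h := hleft _ (hc t) (C.f i)
      rw [C.mul_cartan, C.cartan_f, neg_neg] at h
      exact (Submodule.smul_mem_iff _ ht).1 h
  refine LinearMap.ext fun v => ?_
  have hv : v ∈ S := by rw [hS]; trivial
  exact hv w hw h0

/-- A form on the Cartan subalgebra that pairs the coroots with multiples of the corresponding roots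
extends to an even invariant form. -/
theorem exists_form {η : I → ℂ} (hB : ∀ i t, B t (C.coroot i) = η i * C.root i t)
    (hB' : ∀ i t, B (C.coroot i) t = η i * C.root i t) : ∃ θ : V →ₗ[ℂ] Dual ℂ V,
      (∀ x y z, θ (L.mul x y) z = θ x (L.mul y z)) ∧ (∀ t v, θ (C.cartan t) v = B t (C.proj v)) ∧
      ∀ p q, p ≠ q → ∀ x ∈ L.part p, ∀ y ∈ L.part q, θ x y = 0 := by
  -- The first projection is bijective on `G`, so `G` is the graph of a linear map θ, and the
  -- invariance of θ is the stability of `G` under the right action.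
  let G := C.formGraph B
  have hinj : Function.Injective (LinearMap.fst ℂ V (Dual ℂ V) ∘ₗ G.subtype) := by
    rw [← LinearMap.ker_eq_bot, LinearMap.ker_eq_bot']
    rintro ⟨w, hw⟩ h0
    exact Subtype.ext (Prod.ext h0 (C.snd_eq_zero_of_mem_formGraph B hB hB' hw h0))
  have hsurj : Function.Surjective (LinearMap.fst ℂ V (Dual ℂ V) ∘ₗ G.subtype) := by
    intro x
    have hx : x ∈ G.map (LinearMap.fst ℂ V (Dual ℂ V)) := by rw [C.map_fst_formGraph B]; trivial
    obtain ⟨w, hw, rfl⟩ := hx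
    exact ⟨⟨w, hw⟩, rfl⟩
  let E := LinearEquiv.ofBijective _ ⟨hinj, hsurj⟩
  let θ : V →ₗ[ℂ] Dual ℂ V := LinearMap.snd ℂ V (Dual ℂ V) ∘ₗ G.subtype ∘ₗ E.symm.toLinearMap
  have hθ : ∀ w ∈ G, θ w.1 = w.2 := by
    intro w hw
    have h : E.symm w.1 = ⟨w, hw⟩ := by
      rw [LinearEquiv.symm_apply_eq]
      rfl
    change (E.symm w.1 : V × Dual ℂ V).2 = w.2
    rw [h]
  have hex : ∀ x, ∃ w ∈ G, w.1 = x := fun x => by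
    obtain ⟨w, hw⟩ := hsurj x
    exact ⟨w, w.2, hw⟩
  refine ⟨θ, fun x y z => ?_, fun t v => ?_, fun p q hpq x hx y hy => ?_⟩
  · obtain ⟨w, hw, rfl⟩ := hex x
    have h := hθ _ (C.rightAct_mem_formGraph B y hw)
    rw [hθ w hw]
    exact LinearMap.congr_fun h z
  · exact LinearMap.congr_fun (hθ _ (Submodule.subset_span ⟨0, FormPair.base t⟩)) v
  · let S : ZMod 2 → Submodule ℂ V := fun p =>
      { carrier := {x | x ∈ L.part p ∧ ∀ q ≠ p, ∀ v ∈ L.part q, θ x v = 0}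
        zero_mem' := ⟨zero_mem _, fun q _ v _ => by rw [map_zero, LinearMap.zero_apply]⟩
        add_mem' := fun ha hb => ⟨add_mem ha.1 hb.1, fun q hq v hv => by
          rw [map_add, LinearMap.add_apply, ha.2 q hq v hv, hb.2 q hq v hv, add_zero]⟩
        smul_mem' := fun c a ha => ⟨Submodule.smul_mem _ _ ha.1, fun q hq v hv => by
          rw [map_smul, LinearMap.smul_apply, ha.2 q hq v hv, smul_zero]⟩ }
    have hx' : x ∈ S p := by
      refine mem_of_mem_part (S := S) (fun p x hx => hx.1) ?_ hx
      rw [← C.map_fst_formGraph B, Submodule.map_le_iff_le_comap]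
      refine Submodule.span_le.2 ?_
      rintro w ⟨r, hw⟩
      have hwS : w.1 ∈ S r := by
        refine ⟨hw.mem.1, fun q hq v hv => ?_⟩
        rw [hθ w (Submodule.subset_span ⟨r, hw⟩)]
        exact hw.mem.2 q hq v hv
      rcases zmod_two_cases r with rfl | rfl
      · exact Submodule.mem_sup_left hwS
      · exact Submodule.mem_sup_right hwS
    exact hx'.2 q hpq.symm y hy

end Chevalley

end SuperLie

end

noncomputable section

namespace SuperLie

open Module PBW TriangularData.Frame

namespace TriangularData

variable {I H : Type*} [Fintype I] [AddCommGroup H] [Module ℂ H]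
  {V : Type*} [AddCommGroup V] [Module ℂ V] {L : LieSuperalgebra V} (D : TriangularData I H L)

/-! ### Dual families from invariant forms -/

/-- The span of the weight vectors of nonzero weight. -/
def nonzeroWeights : Submodule ℂ V := Submodule.span ℂ {x | ∃ γ : I → ℤ, γ ≠ 0 ∧
  ∀ t, L.mul (D.cartan t) x = wt D.root γ t • x}

/-- An element of the Cartan subalgebra has weight zero, and weight spaces are independent. -/
theorem cartan_eq_zero_of_mem {t : H} (ht : D.cartan t ∈ D.nonzeroWeights) : D.cartan t = 0 := by
  let S : (I → ℤ) → Submodule ℂ V := fun γ => Submodule.span ℂ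
    {x | γ ≠ 0 ∧ ∀ t, L.mul (D.cartan t) x = wt D.root γ t • x}
  have h : D.cartan t ∈ S 0 := by
    refine mem_of_mem_iSup_of_weight D.root_indep (fun t => L.mul (D.cartan t)) ?_ S ?_ ?_ ?_
    · intro s t
      ext y
      have h := L.jacobi (D.cartan_even s) (D.cartan_even t) y
      rw [D.cartan_comm] at h
      simpa [sgn] using h
    · intro γ y hy t
      have hle : S γ ≤ LinearMap.ker (L.mul (D.cartan t) - wt D.root γ t • LinearMap.id) := by
        refine Submodule.span_le.2 fun y hy => ?_
        simp [hy.2 t]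
      have := hle hy
      rw [LinearMap.mem_ker, LinearMap.sub_apply, sub_eq_zero] at this
      exact this
    · simp only [S]
      rw [← Submodule.span_iUnion]
      refine Submodule.span_mono ?_ ht
      rintro y ⟨γ, h1, h2⟩
      exact Set.mem_iUnion.2 ⟨γ, h1, h2⟩
    · intro s
      rw [D.cartan_comm, wt_zero, LinearMap.zero_apply, zero_smul]
  have h0 : S 0 = ⊥ := by
    simp [S]
  rw [h0] at h
  exact h

theorem map_mkQ_nonzeroWeights_le {N : Submodule ℂ V} (hN : L.IsGradedIdeal N) :
    D.nonzeroWeights.map N.mkQ ≤ (D.quotient N hN).nonzeroWeights := by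
  rw [nonzeroWeights, Submodule.map_span]
  refine Submodule.span_mono ?_
  rintro _ ⟨z, ⟨γ, hγ, hz⟩, rfl⟩
  exact ⟨γ, hγ, fun s => congrArg N.mkQ (hz s)⟩

/-- If `t + y` lies in `N` with `t` in the Cartan subalgebra and `y` of nonzero weights, then modulo
`N` the element `t` is both of weight zero and a sum of nonzero weights. Hence `t` lies in `N`, and
`t = 0`. -/
theorem le_nonzeroWeights {N : Submodule ℂ V} (hN : L.IsGradedIdeal N)
    (hd : Disjoint N (LinearMap.range D.cartan))
    (htop : ⊤ ≤ LinearMap.range D.cartan ⊔ D.nonzeroWeights) : N ≤ D.nonzeroWeights := by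
  intro x hx
  obtain ⟨_, ⟨t, rfl⟩, y, hy, rfl⟩ := Submodule.mem_sup.1 (htop (Submodule.mem_top (x := x)))
  have hmap : N.mkQ y ∈ (D.quotient N hN).nonzeroWeights :=
    D.map_mkQ_nonzeroWeights_le hN ⟨y, hy, rfl⟩
  have h1 : (D.quotient N hN).cartan t = -N.mkQ y := by
    rw [eq_neg_iff_add_eq_zero]
    exact (Submodule.Quotient.mk_eq_zero N).2 hx
  have h2 := (D.quotient N hN).cartan_eq_zero_of_mem (t := t) (by rw [h1]; exact neg_mem hmap)
  have h3 : D.cartan t ∈ N := (Submodule.Quotient.mk_eq_zero N).1 h2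
  rw [Submodule.disjoint_def.1 hd _ h3 ⟨t, rfl⟩, zero_add]
  exact hy

theorem exists_proj (hinj : Function.Injective D.cartan) : ∃ π : V →ₗ[ℂ] H,
    (∀ t, π (D.cartan t) = t) ∧ ∀ γ ≠ 0, ∀ x,
      (∀ t, L.mul (D.cartan t) x = wt D.root γ t • x) → π x = 0 := by
  have h : LinearMap.ker (D.nonzeroWeights.mkQ ∘ₗ D.cartan) = ⊥ := by
    rw [LinearMap.ker_eq_bot']
    intro t ht
    refine (injective_iff_map_eq_zero D.cartan).1 hinj t (D.cartan_eq_zero_of_mem ?_)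
    exact (Submodule.Quotient.mk_eq_zero _).1 ht
  obtain ⟨g, hg⟩ := LinearMap.exists_leftInverse_of_injective _ h
  refine ⟨g ∘ₗ D.nonzeroWeights.mkQ, LinearMap.congr_fun hg, fun γ hγ x hx => ?_⟩
  have hx' : D.nonzeroWeights.mkQ x = 0 :=
    (Submodule.Quotient.mk_eq_zero _).2 (Submodule.subset_span ⟨γ, hγ, hx⟩)
  rw [LinearMap.comp_apply, hx', map_zero]

/-- A nondegenerate even invariant form gives rise to dual families. -/
theorem exists_pairing [FiniteDimensional ℂ V] {θ : V →ₗ[ℂ] Dual ℂ V}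
    (hinv : ∀ x y z, θ (L.mul x y) z = θ x (L.mul y z))
    (heven : ∀ p q, p ≠ q → ∀ x ∈ L.part p, ∀ y ∈ L.part q, θ x y = 0)
    (hinj : Function.Injective θ) (htop : ⊤ ≤ LinearMap.range D.cartan ⊔ D.nonzeroWeights)
    (hpos : D.nPos ≤ Submodule.span ℂ {x | x ∈ D.nPos ∧ (∃ p, x ∈ L.part p) ∧
      ∃ γ : I → ℤ, 0 < γ ∧ ∀ t, L.mul (D.cartan t) x = wt D.root γ t • x}) :
    ∃ κ : Set V, Nonempty (D.Pairing κ) := by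
  classical
  obtain ⟨κ, hκ, hκs, hκi⟩ := exists_linearIndependent ℂ {x | x ∈ D.nPos ∧ (∃ p, x ∈ L.part p) ∧
      ∃ γ : I → ℤ, 0 < γ ∧ ∀ t, L.mul (D.cartan t) x = wt D.root γ t • x}
  let E : Set V := {x | (∃ p, x ∈ L.part p) ∧
    ∃ γ : I → ℤ, ∀ t, L.mul (D.cartan t) x = wt D.root γ t • x}
  have hκE : κ ⊆ E := fun x hx => by
    obtain ⟨-, hp, γ, -, hγ⟩ := hκ hx
    exact ⟨hp, γ, hγ⟩
  have hE : ⊤ ≤ Submodule.span ℂ E := by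
    refine D.top_le.trans (Submodule.span_mono ?_)
    rintro x ⟨hp, γ, hγ, -⟩
    exact ⟨hp, γ, hγ⟩
  have hs : LinearIndepOn ℂ id κ := hκi
  let b := Basis.extendLe hs hκE hE
  have hb : ∀ x, b x = x := fun x => Basis.extendLe_apply_self _ _ _ x
  have hbE : ∀ x, ∃ (p : ZMod 2) (γ : I → ℤ), b x ∈ L.part p ∧
      ∀ t, L.mul (D.cartan t) (b x) = wt D.root γ t • b x := fun x => by
    obtain ⟨⟨p, hp⟩, γ, hγ⟩ := hs.extend_subset hκE x.2
    rw [hb]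
    exact ⟨p, γ, hp, hγ⟩
  choose p γ hp hγ using hbE
  let θe := LinearEquiv.ofInjectiveOfFinrankEq θ hinj Subspace.dual_finrank_eq.symm
  have hθe : ∀ x, θe x = θ x := fun x => rfl
  let c := b.map θe
  -- The basis of `V` dual to `b` under the form, read through the identification of `V` with its
  -- bidual.
  let f : _ → V := fun j => (evalEquiv ℂ V).symm (c.coord j)
  have hf : ∀ i j, θ (b j) (f i) = if j = i then 1 else 0 := by
    intro i j
    have h : θ (b j) = c j := by rw [← hθe]; exact (b.map_apply θe j).symm
    rw [h, apply_evalEquiv_symm_apply, Basis.coord_apply, Basis.repr_self, Finsupp.single_apply]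
  have hsep : ∀ v, (∀ x, θ x v = 0) → v = 0 := fun v hv => by
    rw [← forall_dual_apply_eq_zero_iff ℂ]
    intro φ
    rw [← θe.apply_symm_apply φ, hθe]
    exact hv _
  have hsepb : ∀ v, (∀ j, θ (b j) v = 0) → v = 0 := fun v hv => hsep v fun x =>
    LinearMap.congr_fun (b.ext (f₁ := θ.flip v) (f₂ := 0) hv) x
  have hskew : ∀ x t, L.mul x (D.cartan t) = -L.mul (D.cartan t) x := fun x t =>
    mul_skew_of_even L (D.cartan_even t) x
  have hfw : ∀ i t, L.mul (D.cartan t) (f i) = wt D.root (-γ i) t • f i := by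
    intro i t
    rw [← sub_eq_zero]
    refine hsepb _ fun j => ?_
    have hn : wt D.root (-γ i) t = -wt D.root (γ i) t := by simp [wt]
    rw [map_sub, ← hinv, hskew, hγ, map_neg, map_smul, map_smul, LinearMap.neg_apply,
      LinearMap.smul_apply, hf, hn, smul_eq_mul, smul_eq_mul]
    split_ifs with h
    · rw [h]
      ring
    · ring
  have hfp : ∀ i, f i ∈ L.part (p i) := by
    intro i
    obtain ⟨u, hu, v, hv, huv⟩ := exists_add_of_parts L (f i)
    have key : ∀ q q' : ZMod 2, q ≠ q' → ∀ x ∈ L.part q, ∀ y ∈ L.part q', x + y = f i →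
        p i = q → f i ∈ L.part q := by
      intro q q' hq x hx y hy hxy hpi
      have h0 : y = 0 := by
        refine hsepb _ fun j => ?_
        by_cases hj : p j = q'
        · have h1 : θ (b j) x = 0 := heven _ _ (by rw [hj]; exact hq.symm) _ (hp j) _ hx
          have h2 := hf i j
          rw [← hxy, map_add, h1, zero_add, if_neg] at h2
          · exact h2
          · rintro rfl
            exact hq (hpi.symm.trans hj)
        · exact heven _ _ hj _ (hp j) _ hy
      rw [← hxy, h0, add_zero]
      exact hx
    rcases zmod_two_cases (p i) with h | h
    · rw [h]
      exact key 0 1 (by decide) u hu v hv huv h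
    · rw [h]
      exact key 1 0 (by decide) v hv u hu (by rw [add_comm, huv]) h
  -- Invariance gives the pairings of the bracket with the Cartan subalgebra: zero for `j ≠ i`, and
  -- the nonzero root itself for equal positive indices.
  have hbr : ∀ i j t, θ (D.cartan t) (L.mul (b j) (f i)) =
      wt D.root (γ j) t * if j = i then 1 else 0 := by
    intro i j t
    rw [← hinv, hγ, map_smul, LinearMap.smul_apply, hf, smul_eq_mul]
  let m : κ → hs.extend hκE := fun a => ⟨a, hs.subset_extend _ a.2⟩
  have hm : ∀ a, b (m a) = a := fun a => hb _
  have hmpos : ∀ a, 0 < γ (m a) := by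
    intro a
    obtain ⟨-, -, δ, hδ, h⟩ := hκ a.2
    have hne : (a : V) ≠ 0 := by rw [← hm]; exact b.ne_zero _
    have : δ = γ (m a) := by
      refine wt_injective D.root_indep (LinearMap.ext fun t => ?_)
      have h1 := hγ (m a) t
      rw [hm, h t] at h1
      exact smul_left_injective ℂ hne h1
    rwa [← this]
  refine ⟨κ, ⟨?_⟩⟩
  exact
    { e := fun a => a
      f := fun a => f (m a)
      par := fun a => p (m a)
      weight := fun a => γ (m a)
      weight_pos := hmpos
      e_mem := fun a => by rw [← hm]; exact hp (m a)
      f_mem := fun a => hfp (m a)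
      e_mem_nPos := fun a => (hκ a.2).1
      e_weight := fun a => by rw [← hm]; exact hγ (m a)
      f_weight := fun a => hfw (m a)
      e_indep := hκi
      nPos_le := by
        rw [Subtype.range_coe, hκs]
        exact hpos
      bracket_ne := fun a h0 => by
        have hne : wt D.root (γ (m a)) ≠ 0 := by
          rw [← wt_zero D.root]
          exact (wt_injective D.root_indep).ne (hmpos a).ne'
        obtain ⟨t, ht⟩ := DFunLike.ne_iff.1 hne
        have h1 := hbr (m a) (m a) t
        rw [hm, h0, map_zero, if_pos rfl, mul_one] at h1
        exact ht h1.symm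
      bracket_odd := fun a a' hne hw => by
        have hmne : m a' ≠ m a := fun h => hne (Subtype.ext (congrArg Subtype.val h).symm)
        -- The bracket has weight zero, so by invariance it is orthogonal to all nonzero weights; by
        -- `hbr` it is orthogonal to the Cartan subalgebra as well. The form is nondegenerate.
        have h0 : L.mul (b (m a')) (f (m a)) = 0 := by
          have hwt0 : ∀ t, L.mul (D.cartan t) (L.mul (b (m a')) (f (m a))) = 0 := fun t => by
            rw [D.mul_weight (hp _) (hγ _) (hfw _), hw, add_neg_cancel, wt_zero,
              LinearMap.zero_apply, zero_smul]
          refine hsep _ fun x => ?_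
          have hle : (⊤ : Submodule ℂ V) ≤
              LinearMap.ker (θ.flip (L.mul (b (m a')) (f (m a)))) := by
            refine htop.trans (sup_le ?_ (Submodule.span_le.2 ?_))
            · rintro _ ⟨t, rfl⟩
              rw [LinearMap.mem_ker, LinearMap.flip_apply, hbr, if_neg hmne, mul_zero]
            · rintro y ⟨δ, hδ, hy⟩
              have hne : wt D.root δ ≠ 0 := by
                rw [← wt_zero D.root]
                exact (wt_injective D.root_indep).ne hδ
              obtain ⟨t, ht⟩ := DFunLike.ne_iff.1 hne
              have h1 := hinv y (D.cartan t) (L.mul (b (m a')) (f (m a)))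
              rw [hwt0, map_zero, hskew, hy, map_neg, map_smul, LinearMap.neg_apply,
                LinearMap.smul_apply, neg_eq_zero, smul_eq_zero] at h1
              exact h1.resolve_left ht
          exact hle (Submodule.mem_top (x := x))
        rw [← hm a', h0]
        exact zero_mem _ }

end TriangularData

end SuperLie

end

noncomputable section

namespace SuperLie

open Module PBW

/-! ### The form on the Cartan subalgebra of a symmetrizable Cartan matrix -/

/-- A functional vanishing on the range is a linear relation between the `a i`. -/
theorem pi_surjective_of_linearIndependent {I H : Type*} [Fintype I] [AddCommGroup H] [Module ℂ H]
    {a : I → Dual ℂ H} (ha : LinearIndependent ℂ a) : Function.Surjective (LinearMap.pi a) := by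
  classical
  rw [← LinearMap.range_eq_top]
  by_contra hne
  obtain ⟨f, hf, hle⟩ := Submodule.exists_le_ker_of_lt_top _ (lt_top_iff_ne_top.2 hne)
  refine hf (LinearMap.pi_ext' fun i => LinearMap.ext_ring ?_)
  have hsum : ∑ i, f (Pi.single i 1) • a i = 0 := by
    refine LinearMap.ext fun t => ?_
    have h : f (LinearMap.pi a t) = 0 := hle ⟨t, rfl⟩
    rw [← LinearMap.sum_single_apply (fun _ : I => ℂ) (LinearMap.pi a t), map_sum] at h
    rw [LinearMap.sum_apply, LinearMap.zero_apply, ← h]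
    refine Finset.sum_congr rfl fun i _ => ?_
    have hs : (LinearMap.single ℂ (fun _ : I => ℂ) i) (LinearMap.pi a t i) =
        a i t • (Pi.single i 1 : I → ℂ) := by
      funext j
      simp [Pi.single_apply]
    change f (Pi.single i 1) • a i t = f ((LinearMap.single ℂ (fun _ : I => ℂ) i) _)
    rw [hs, map_smul, smul_eq_mul, smul_eq_mul, mul_comm]
  have := Fintype.linearIndependent_iff.1 ha _ hsum i
  simpa using this

variable {I H : Type*} [Fintype I] [AddCommGroup H] [Module ℂ H] {A : Matrix I I ℂ}

/-- The pairing with coroots is prescribed and consistent because diag(η) Aᵀ is symmetric for η the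
inverse of the symmetrizing vector. On a complement of the span of the coroots the form is set to
zero, and the minimal dimension of 𝔥 makes the result nondegenerate. -/
theorem Realization.exists_form (R : Realization A H) (hA : IsSymmetrizable A) :
    ∃ (B : H →ₗ[ℂ] Dual ℂ H) (η : I → ℂ), (∀ i t, B t (R.coroot i) = η i * R.root i t) ∧
      (∀ i t, B (R.coroot i) t = η i * R.root i t) ∧ Function.Injective B := by
  classical
  have := R.finite
  obtain ⟨d, hd, hdA⟩ := hA
  let η : I → ℂ := fun i => (d i)⁻¹
  have hη : ∀ i, η i ≠ 0 := fun i => inv_ne_zero (hd i)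
  have hηA : ∀ i j, η j * A i j = η i * A j i := fun i j => by
    have h1 := hdA i j
    have h2 := hd i
    have h3 := hd j
    simp only [η]
    field_simp
    linear_combination h1
  let C : (I → ℂ) →ₗ[ℂ] H := Fintype.linearCombination ℂ R.coroot
  have hC : ∀ i, C (Pi.single i 1) = R.coroot i := fun i => by
    simp [C, Fintype.linearCombination_apply_single]
  obtain ⟨q, hq⟩ := C.exists_leftInverse_of_injective
    (LinearMap.ker_eq_bot.2 (linearIndependent_iff_injective_fintypeLinearCombination.1 R.coroot_indep))
  have hqC : ∀ x, q (C x) = x := LinearMap.congr_fun hq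
  let a : H →ₗ[ℂ] (I → ℂ) := LinearMap.pi fun i => η i • R.root i
  have ha : ∀ t i, a t i = η i * R.root i t := fun t i => rfl
  let G : (I → ℂ) →ₗ[ℂ] (I → ℂ) := a ∘ₗ C
  have hG : G = (Matrix.diagonal η * A.transpose).mulVecLin := by
    refine LinearMap.pi_ext' fun i => LinearMap.ext_ring (funext fun j => ?_)
    change a (C (Pi.single i 1)) j = (Matrix.diagonal η * A.transpose).mulVec (Pi.single i 1) j
    rw [hC, ha, R.root_coroot, Matrix.mulVec_single_one, Matrix.col_apply,
      Matrix.diagonal_mul, Matrix.transpose_apply]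
  have hrank : finrank ℂ (LinearMap.range G) = A.rank := by
    rw [hG]
    change (Matrix.diagonal η * A.transpose).rank = A.rank
    rw [Matrix.rank_mul_eq_right_of_isUnit_det, Matrix.rank_transpose]
    rw [Matrix.det_diagonal, isUnit_iff_ne_zero]
    exact Finset.prod_ne_zero_iff.2 fun i _ => hη i
  have hsym : ∀ x y, x ⬝ᵥ G y = y ⬝ᵥ G x := by
    have hT : (Matrix.diagonal η * A.transpose).transpose = Matrix.diagonal η * A.transpose := by
      ext i j
      rw [Matrix.transpose_apply, Matrix.diagonal_mul, Matrix.diagonal_mul, Matrix.transpose_apply,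
        Matrix.transpose_apply]
      exact hηA i j
    intro x y
    rw [hG, Matrix.mulVecLin_apply, Matrix.mulVecLin_apply, Matrix.dotProduct_mulVec,
      ← Matrix.mulVec_transpose, hT, dotProduct_comm]
  -- The complement is `ker q`, where `q` gives the coordinates along the coroots. The last term
  -- corrects the double count when both arguments are combinations of coroots.
  let B : H →ₗ[ℂ] Dual ℂ H := LinearMap.mk₂ ℂ
    (fun t s => q t ⬝ᵥ a s + q s ⬝ᵥ a t - q s ⬝ᵥ G (q t))
    (fun t t' s => by
      simp only [map_add, add_dotProduct, dotProduct_add]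
      ring)
    (fun c t s => by
      simp only [map_smul, smul_dotProduct, dotProduct_smul, smul_eq_mul]
      ring)
    (fun t s s' => by
      simp only [map_add, add_dotProduct, dotProduct_add]
      ring)
    (fun c t s => by
      simp only [map_smul, smul_dotProduct, dotProduct_smul, smul_eq_mul]
      ring)
  have hB : ∀ t s, B t s = q t ⬝ᵥ a s + q s ⬝ᵥ a t - q s ⬝ᵥ G (q t) := fun t s => rfl
  have hB1 : ∀ i t, B t (R.coroot i) = η i * R.root i t := fun i t => by
    have h : q t ⬝ᵥ a (C (Pi.single i 1)) = Pi.single i 1 ⬝ᵥ G (q t) := hsym _ _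
    rw [← hC, hB, hqC, h, add_sub_cancel_left, single_one_dotProduct, ha]
  have hB2 : ∀ i t, B (R.coroot i) t = η i * R.root i t := fun i t => by
    rw [← hC, hB, hqC, single_one_dotProduct, ha]
    exact add_sub_cancel_right _ _
  refine ⟨B, η, hB1, hB2, (injective_iff_map_eq_zero B).2 fun t ht => ?_⟩
  have hasurj : Function.Surjective a :=
    pi_surjective_of_linearIndependent (R.root_indep.units_smul fun i => Units.mk0 _ (hη i))
  let Φ : (LinearMap.ker q × LinearMap.range G) →ₗ[ℂ] (I → ℂ) :=
    (a ∘ₗ (LinearMap.ker q).subtype).coprod (LinearMap.range G).subtype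
  have hΦsurj : Function.Surjective Φ := fun y => by
    obtain ⟨s, rfl⟩ := hasurj y
    refine ⟨(⟨s - C (q s), ?_⟩, ⟨G (q s), ⟨_, rfl⟩⟩), ?_⟩
    · rw [LinearMap.mem_ker, map_sub, hqC, sub_self]
    · change a (s - C (q s)) + a (C (q s)) = a s
      rw [map_sub, sub_add_cancel]
  have hqsurj : LinearMap.range q = ⊤ := LinearMap.range_eq_top.2 fun x => ⟨C x, hqC x⟩
  -- `ker q` has dimension `|I| - rank A` by the dimension condition on a realization, and the range
  -- of `G` has dimension `rank A`; the surjection `Φ` is therefore injective.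
  have hdim : finrank ℂ (LinearMap.ker q × LinearMap.range G) = finrank ℂ (I → ℂ) := by
    have h1 := q.finrank_range_add_finrank_ker
    have h2 := R.finrank_eq
    rw [hqsurj, finrank_top, finrank_fintype_fun_eq_card] at h1
    rw [finrank_prod, hrank, finrank_fintype_fun_eq_card]
    omega
  have hΦinj := (LinearMap.injective_iff_surjective_of_finrank_eq_finrank hdim).2 hΦsurj
  have hat : a t = 0 := funext fun i => by
    rw [ha, ← hB1, ht]
    rfl
  have h0 : Φ (⟨t - C (q t), by rw [LinearMap.mem_ker, map_sub, hqC, sub_self]⟩,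
      ⟨G (q t), ⟨_, rfl⟩⟩) = 0 := by
    change a (t - C (q t)) + a (C (q t)) = 0
    rw [map_sub, sub_add_cancel, hat]
  have h1 := Prod.ext_iff.1 ((injective_iff_map_eq_zero Φ).1 hΦinj _ h0)
  have ht' : t - C (q t) = 0 := congrArg Subtype.val h1.1
  have hGt : G (q t) = 0 := congrArg Subtype.val h1.2
  -- `q t` is orthogonal to `a (ker q)` because `B t = 0`, and to the range of `G` because `G` is
  -- symmetric and kills `q t`; together these fill ℂ^I.
  have hqt : q t = 0 := by
    refine dotProduct_eq_zero _ fun y => ?_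
    obtain ⟨⟨⟨s, hs⟩, ⟨_, z, rfl⟩⟩, rfl⟩ := hΦsurj y
    change q t ⬝ᵥ (a s + G z) = 0
    rw [LinearMap.mem_ker] at hs
    have h2 : B t s = 0 := by rw [ht]; rfl
    rw [hB, hs, zero_dotProduct, zero_dotProduct, add_zero, sub_zero] at h2
    rw [dotProduct_add, h2, hsym, hGt, dotProduct_zero, add_zero]
  rw [hqt, map_zero, sub_zero] at ht'
  exact ht'

end SuperLie

end

noncomputable section

namespace SuperLie

open Module PBW

/-! ### The invariant form of a contragredient Lie superalgebra -/

theorem map_mkQ_generated_le {V : Type*} [AddCommGroup V] [Module ℂ V] (L : LieSuperalgebra V)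
    {N : Submodule ℂ V} (hN : L.IsGradedIdeal N) (s : Set V) :
    (L.generated s).map N.mkQ ≤ (L.quotient N hN).generated (N.mkQ '' s) := by
  rw [Submodule.map_le_iff_le_comap]
  refine sInf_le ⟨fun x hx => ?_, fun x hx y hy => ?_⟩
  · exact (L.quotient N hN).subset_generated _ ⟨x, hx, rfl⟩
  · exact (L.quotient N hN).mul_mem_generated _ hx hy

/-- The kernel of an even invariant form is a graded ideal. -/
theorem isGradedIdeal_ker {V : Type*} [AddCommGroup V] [Module ℂ V] (L : LieSuperalgebra V)
    {θ : V →ₗ[ℂ] Dual ℂ V} (hinv : ∀ x y z, θ (L.mul x y) z = θ x (L.mul y z))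
    (heven : ∀ p q, p ≠ q → ∀ x ∈ L.part p, ∀ y ∈ L.part q, θ x y = 0) :
    L.IsGradedIdeal (LinearMap.ker θ) := by
  have hright : ∀ {x : V} (y : V), x ∈ LinearMap.ker θ → L.mul x y ∈ LinearMap.ker θ := by
    intro x y hx
    rw [LinearMap.mem_ker] at hx ⊢
    ext z
    rw [hinv, hx, LinearMap.zero_apply, LinearMap.zero_apply]
  have hgr : ∀ {x y : V}, x ∈ L.part 0 → y ∈ L.part 1 → x + y ∈ LinearMap.ker θ →
      x ∈ LinearMap.ker θ := by
    intro x y hx hy hxy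
    rw [LinearMap.mem_ker] at hxy ⊢
    ext z
    obtain ⟨a, ha, b, hb, rfl⟩ := exists_add_of_parts L z
    have h := LinearMap.congr_fun hxy a
    rw [map_add, LinearMap.add_apply, heven 1 0 (by decide) y hy a ha, add_zero] at h
    rw [map_add, heven 0 1 (by decide) x hx b hb, h, add_zero]
    rfl
  refine ⟨fun x y hy => ?_, hright, hgr⟩
  obtain ⟨c, hc, d, hd, rfl⟩ := exists_add_of_parts L x
  obtain ⟨a, ha, b, hb, rfl⟩ := exists_add_of_parts L y
  have haK := hgr ha hb hy
  have hbK : b ∈ LinearMap.ker θ := by simpa using sub_mem hy haK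
  have hhom : ∀ {p q : ZMod 2} {u v : V}, u ∈ L.part p → v ∈ L.part q → v ∈ LinearMap.ker θ →
      L.mul u v ∈ LinearMap.ker θ := by
    intro p q u v hu hv hvK
    rw [L.skew hu hv]
    exact neg_mem (Submodule.smul_mem _ _ (hright _ hvK))
  rw [map_add, map_add, LinearMap.add_apply, LinearMap.add_apply]
  exact add_mem (add_mem (hhom hc ha haK) (hhom hd ha haK))
    (add_mem (hhom hc hb hbK) (hhom hd hb hbK))

section KacMoody

variable {I H : Type*} [Fintype I] [AddCommGroup H] [Module ℂ H] {A : Matrix I I ℂ}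
  (τ : I → ZMod 2) (R : Realization A H)

theorem tildePos_le_span_pos : tildePos τ R ≤ Submodule.span ℂ {x | x ∈ tildePos τ R ∧
    (∃ p, x ∈ (tilde τ R).part p) ∧ ∃ γ : I → ℤ, 0 < γ ∧ ∀ t,
      (tilde τ R).mul (tildeCartan τ R t) x = wt R.root γ t • x} := by
  classical
  refine (generated_le_span_weight (tilde τ R) (tildeCartan τ R) R.root
    (fun t => tildeGen_mem τ R (Gen.h t)) _ (fun γ => 0 < γ) (fun _ _ => add_pos) ?_ ∅
    (fun _ h => h.elim) (fun _ h => h.elim)).trans (Submodule.span_mono ?_)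
  · intro j
    refine ⟨⟨_, tildeGen_mem τ R _⟩, Pi.single j 1, Pi.single_pos.2 zero_lt_one, fun t => ?_⟩
    rw [tilde_he, wt_single]
    simp
  · rintro y ⟨h1, h2, h3, -⟩
    exact ⟨h1, h2, h3⟩

theorem tildeNeg_le_nonzeroWeights : tildeNeg τ R ≤ (tildeData τ R).nonzeroWeights := by
  classical
  refine (generated_le_span_weight (tilde τ R) (tildeCartan τ R) R.root
    (fun t => tildeGen_mem τ R (Gen.h t)) _ (fun γ => γ < 0) (fun _ _ => add_neg) ?_ ∅
    (fun _ h => h.elim) (fun _ h => h.elim)).trans (Submodule.span_mono ?_)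
  · intro j
    refine ⟨⟨_, tildeGen_mem τ R _⟩, Pi.single j (-1), ?_, fun t => ?_⟩
    · rw [Pi.single_neg, neg_lt_zero]
      exact Pi.single_pos.2 zero_lt_one
    · rw [tilde_hf, wt_single]
      simp
  · rintro y ⟨-, -, ⟨γ, h, hγ⟩, -⟩
    exact ⟨γ, h.ne, hγ⟩

theorem tildeData_top_le : ⊤ ≤ LinearMap.range (tildeData τ R).cartan ⊔
    (tildeData τ R).nonzeroWeights := by
  rw [← tildeSum_eq_top τ R]
  refine sup_le (sup_le ((tildeNeg_le_nonzeroWeights τ R).trans le_sup_right) le_sup_left) ?_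
  refine ((tildePos_le_span_pos τ R).trans (Submodule.span_mono ?_)).trans le_sup_right
  rintro y ⟨-, -, γ, h, hγ⟩
  exact ⟨γ, h.ne', hγ⟩

/-- Lying in the sum of the nonzero weight spaces, unlike meeting 𝔥 trivially, is a property that
passes to sums of ideals. It follows that the sum itself meets 𝔥 trivially. -/
theorem maxIdeal_le_nonzeroWeights : maxIdeal τ R ≤ (tildeData τ R).nonzeroWeights :=
  sSup_le fun _ hN => (tildeData τ R).le_nonzeroWeights hN.1 hN.2 (tildeData_top_le τ R)

theorem kmData_cartan_injective : Function.Injective (kmData τ R).cartan := by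
  rw [injective_iff_map_eq_zero]
  intro t ht
  have h : tildeCartan τ R t ∈ maxIdeal τ R := (Submodule.Quotient.mk_eq_zero _).1 ht
  have h0 := (tildeData τ R).cartan_eq_zero_of_mem (maxIdeal_le_nonzeroWeights τ R h)
  exact (injective_iff_map_eq_zero _).1 (tildeCartan_injective τ R) t h0

/-- The preimage of `N` is one of the ideals whose sum has been divided out, since 𝔥 embeds in the
quotient. -/
theorem km_eq_bot_of_disjoint {N : Submodule ℂ (KMSpace τ R)} (hN : (km τ R).IsGradedIdeal N)
    (hd : Disjoint N (LinearMap.range (kmData τ R).cartan)) : N = ⊥ := by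
  have hle : N.comap (maxIdeal τ R).mkQ ≤ maxIdeal τ R := by
    refine le_sSup ⟨⟨fun x y hy => hN.mul_left ((maxIdeal τ R).mkQ x) hy,
      fun y hx => hN.mul_right ((maxIdeal τ R).mkQ y) hx,
      fun hx hy h => hN.graded ⟨_, hx, rfl⟩ ⟨_, hy, rfl⟩ h⟩, ?_⟩
    rw [Submodule.disjoint_def]
    rintro _ hx ⟨t, rfl⟩
    have h0 : (kmData τ R).cartan t = 0 := Submodule.disjoint_def.1 hd _ hx ⟨t, rfl⟩
    rw [(injective_iff_map_eq_zero _).1 (kmData_cartan_injective τ R) t h0, map_zero]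
  rw [eq_bot_iff]
  intro x hx
  obtain ⟨x, rfl⟩ := (maxIdeal τ R).mkQ_surjective x
  exact (Submodule.Quotient.mk_eq_zero _).2 (hle hx)

theorem kmData_top_le : ⊤ ≤ LinearMap.range (kmData τ R).cartan ⊔
    (kmData τ R).nonzeroWeights := by
  rw [← Submodule.range_mkQ (maxIdeal τ R), ← Submodule.map_top]
  refine (Submodule.map_mono (tildeData_top_le τ R)).trans ?_
  rw [Submodule.map_sup, ← LinearMap.range_comp]
  exact sup_le_sup_left ((tildeData τ R).map_mkQ_nonzeroWeights_le _) _

theorem kmData_nPos_le : (kmData τ R).nPos ≤ Submodule.span ℂ {x | x ∈ (kmData τ R).nPos ∧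
    (∃ p, x ∈ (km τ R).part p) ∧ ∃ γ : I → ℤ, 0 < γ ∧ ∀ t,
      (km τ R).mul ((kmData τ R).cartan t) x = wt (kmData τ R).root γ t • x} := by
  refine (Submodule.map_mono (tildePos_le_span_pos τ R)).trans ?_
  rw [Submodule.map_span]
  refine Submodule.span_mono ?_
  rintro _ ⟨x, ⟨hx, ⟨p, hp⟩, γ, h, hγ⟩, rfl⟩
  exact ⟨⟨x, hx, rfl⟩, ⟨p, x, hp, rfl⟩, γ, h, fun t => congrArg (maxIdeal τ R).mkQ (hγ t)⟩

/-- The Chevalley generators of `𝔤(A, τ)`. -/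
def kmChevalley : Chevalley I H (km τ R) where
  cartan := (kmData τ R).cartan
  root := R.root
  coroot := R.coroot
  root_indep := R.root_indep
  coroot_indep := R.coroot_indep
  par := τ
  e i := (maxIdeal τ R).mkQ (tildeGen τ R (Gen.e i))
  f i := (maxIdeal τ R).mkQ (tildeGen τ R (Gen.f i))
  scale _ := 1
  cartan_even := (kmData τ R).cartan_even
  cartan_comm := (kmData τ R).cartan_comm
  e_mem i := ⟨_, tildeGen_mem τ R (Gen.e i), rfl⟩
  f_mem i := ⟨_, tildeGen_mem τ R (Gen.f i), rfl⟩
  cartan_e t i := congrArg (maxIdeal τ R).mkQ (tilde_he τ R t i)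
  cartan_f t i := congrArg (maxIdeal τ R).mkQ (tilde_hf τ R t i)
  e_f i := by
    have h := (IsRelator.ef (τ := τ) (R := R) i).mem
    rw [← Submodule.Quotient.mk_eq_zero, ← Submodule.mkQ_apply, map_sub] at h
    rw [one_smul]
    exact congrArg (maxIdeal τ R).mkQ (sub_eq_zero.1 h)
  e_f_ne i j hij := by
    have h := (IsRelator.ef_ne (τ := τ) (R := R) i j hij).mem
    rw [← Submodule.Quotient.mk_eq_zero, ← Submodule.mkQ_apply] at h
    exact congrArg (maxIdeal τ R).mkQ h
  top_le := by
    rw [← Submodule.range_mkQ (maxIdeal τ R), ← Submodule.map_top, ← tildeSum_eq_top τ R,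
      tildeSum, Submodule.map_sup, Submodule.map_sup, ← LinearMap.range_comp]
    refine sup_le_sup (sup_le_sup_right ?_ _) ?_
    · refine (map_mkQ_generated_le (tilde τ R) (isGradedIdeal_maxIdeal τ R) _).trans_eq ?_
      rw [← Set.range_comp]
      rfl
    · refine (map_mkQ_generated_le (tilde τ R) (isGradedIdeal_maxIdeal τ R) _).trans_eq ?_
      rw [← Set.range_comp]
      rfl
  proj := ((kmData τ R).exists_proj (kmData_cartan_injective τ R)).choose
  proj_cartan := ((kmData τ R).exists_proj (kmData_cartan_injective τ R)).choose_spec.1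
  proj_weight := ((kmData τ R).exists_proj (kmData_cartan_injective τ R)).choose_spec.2

/-- The kernel of the extended form is a graded ideal. It meets 𝔥 trivially because the form is
nondegenerate on 𝔥, so it is zero. -/
theorem exists_km_form (hA : IsSymmetrizable A) :
    ∃ θ : KMSpace τ R →ₗ[ℂ] Dual ℂ (KMSpace τ R),
      (∀ x y z, θ ((km τ R).mul x y) z = θ x ((km τ R).mul y z)) ∧
      (∀ p q, p ≠ q → ∀ x ∈ (km τ R).part p, ∀ y ∈ (km τ R).part q, θ x y = 0) ∧
      Function.Injective θ := by
  obtain ⟨B, η, hB, hB', hinj⟩ := R.exists_form hA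
  obtain ⟨θ, hinv, hcartan, heven⟩ := (kmChevalley τ R).exists_form B hB hB'
  refine ⟨θ, hinv, heven, ?_⟩
  rw [← LinearMap.ker_eq_bot]
  refine km_eq_bot_of_disjoint τ R (isGradedIdeal_ker (km τ R) hinv heven) ?_
  rw [Submodule.disjoint_def]
  rintro _ hx ⟨t, rfl⟩
  have h0 : B t = 0 := by
    ext s
    have h := hcartan t ((kmChevalley τ R).cartan s)
    rw [(kmChevalley τ R).proj_cartan] at h
    rw [← h, LinearMap.zero_apply]
    exact LinearMap.congr_fun hx _
  rw [(injective_iff_map_eq_zero _).1 hinj t h0, map_zero]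

theorem km_toHat_injective_and_centre [Nonempty I] (hA : IsSymmetrizable A)
    (hfin : FiniteDimensional ℂ (KMSpace τ R)) : Function.Injective (kmData τ R).toHat ∧
      (kmData τ R).centreHat = (kmData τ R).centreImage := by
  obtain ⟨θ, hinv, heven, hinj⟩ := exists_km_form τ R hA
  obtain ⟨κ, ⟨P⟩⟩ := (kmData τ R).exists_pairing hinv heven hinj (kmData_top_le τ R)
    (kmData_nPos_le τ R)
  exact P.toHat_injective_and_centre

end KacMoody

end SuperLie

end

/-! ### The theorem for the five families -/

theorem mainTheorem5 :
    (∀ n : ℕ, 2 ≤ n →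
      Function.Injective (SuperLie.qData n).toHat ∧
        (SuperLie.qData n).centreHat = (SuperLie.qData n).centreImage) ∧
    (∀ n : ℕ, 2 ≤ n →
      Function.Injective (SuperLie.sqData n).toHat ∧
        (SuperLie.sqData n).centreHat = (SuperLie.sqData n).centreImage) ∧
    (∀ n : ℕ, 3 ≤ n →
      Function.Injective (SuperLie.pqData n).toHat ∧
        (SuperLie.pqData n).centreHat = (SuperLie.pqData n).centreImage) ∧
    (∀ n : ℕ, 3 ≤ n →
      Function.Injective (SuperLie.psqData n).toHat ∧
        (SuperLie.psqData n).centreHat = (SuperLie.psqData n).centreImage) ∧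
    (∀ (I : Type*) (H : Type*) [Fintype I] [Nonempty I] [AddCommGroup H] [Module ℂ H]
      (A : Matrix I I ℂ) (τ : I → ZMod 2) (R : SuperLie.Realization A H),
      SuperLie.IsSymmetrizable A → FiniteDimensional ℂ (SuperLie.KMSpace τ R) →
      Function.Injective (SuperLie.kmData τ R).toHat ∧
        (SuperLie.kmData τ R).centreHat = (SuperLie.kmData τ R).centreImage) := by
  refine ⟨fun n hn => ?_, fun n hn => ?_, fun n hn => ?_, fun n hn => ?_, ?_⟩
  · have := SuperLie.nonempty_fin_sub_one hn
    exact (SuperLie.qPairing n).toHat_injective_and_centre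
  · have := SuperLie.nonempty_fin_sub_one hn
    exact (SuperLie.sqPairing n).toHat_injective_and_centre
  · have := SuperLie.nonempty_fin_sub_one (Nat.le_of_succ_le hn)
    exact (SuperLie.pqPairing n hn).toHat_injective_and_centre
  · have := SuperLie.nonempty_fin_sub_one (Nat.le_of_succ_le hn)
    exact (SuperLie.psqPairing n hn).toHat_injective_and_centre
  · exact fun I H _ _ _ _ A τ R hA hfin => SuperLie.km_toHat_injective_and_centre τ R hA hfin
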